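/- Fix an integer $m>0$. A function $\varphi:[0,m]\to\mathbb R$ is called admissible if it is continuous and piecewise linear and its graph is a union of segments with endpoints in $\mathbb Z^2$. Fix an admissible function $\varphi_0$. A $\varphi_0$-admissible shape is a set $S=\{(x,y): 0\le x\le m,\ \varphi_0(x)\le y\le\varphi(x)\}$ with $\varphi$ admissible and $\varphi\ge\varphi_0$ on $[0,m]$. The upper part of the boundary of $P\subset\mathbb R^2$ is $\{(x,y)\in P : y'>y\Rightarrow (x,y')\notin P\}$. A primitive lattice triangle is a triangle of area $1/2$ with vertices in $\mathbb Z^2$. A primitive lattice tile is one of the following: (1) a primitive lattice triangle without vertical sides; (2) a primitive lattice triangle whose vertical side lies on the boundary of the strip $0\le x\le m$; (3) a union $\Delta_1\cup\Delta_2$ of two primitive lattice triangles such that $\Delta_1\cap\Delta_2$ is a common vertical side of both. A primitive lattice tile $Q$ is $S$-maximal if $Q\subset S$ and the upper part of the boundary of $Q$ is contained in the upper part of the boundary of $S$. A $\varphi_0$-admissible subshape of $S$ is a set $S'$ which is the union of the graph of $\varphi_0$ and the closure of $S\setminus(Q_1\cup\dots\cup Q_n)$, where $n\ge 0$ and $Q_1,\dots,Q_n$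 are distinct $S$-maximal primitive lattice tiles with pairwise disjoint interiors; then $\#(S',S)=n$. It is proper if $S'\ne S$. Let $f^*(P)$ be the number of triangulations of $P$ into primitive lattice triangles, and let $f(P)$ be the number of those which have no interior edge (edge not contained in the boundary of $P$) whose projection to the $x$-axis is the whole segment $[0,m]$. One-dimensional parts of a shape, where $\varphi=\varphi_0$, are disregarded here: the triangles have to cover the closure of the interior of $P$. In particular $f^*=f=1$ for the graph of $\varphi_0$. **Lemma 2.2.** Let $S$ be a $\varphi_0$-admissible shape different from the graph of $\varphi_0$. Then $\#(S',S)$ is determined by $S'$ for every $\varphi_0$-admissible subshape $S'$ of $S$, there are finitely many such subshapes, each of them (including $S$) has finitely many primitive lattice triangulations, and $$f^*(S)=\sum_{S'}(-1)^{\#(S',S)-1}f^*(S'),$$ where the sum is over all proper $\varphi_0$-admissible subshapes $S'$ of $S$. Moreover, $$f(S)=\sum_{S'}(-1)^{\#(S',S)-1}f(S'),$$ where the sum is over those proper $\varphi_0$-admissible subshapes $S'$ of $S$ whose upper part of the boundary contains a point of $\mathbb Z^2\cap\{0<x<m\}$; for this second formula it is assumed that we are not in the case where $S$ is a single primitive lattice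 triangle and the graph of $\varphi_0$ contains no point of $\mathbb Z^2\cap\{0<x<m\}$. -/

import Mathlib

open Set

/-- The inclusion of the lattice `ℤ²` in the plane. -/
def latticePt (p : ℤ × ℤ) : ℝ × ℝ := ((p.1 : ℝ), (p.2 : ℝ))

/-- The convex hull in the plane of a finite set of lattice points. -/
def latticeHull (V : Finset (ℤ × ℤ)) : Set (ℝ × ℝ) :=
  convexHull ℝ (latticePt '' (V : Set (ℤ × ℤ)))

/-- `V` is the vertex set of a primitive lattice triangle, i.e. one of area `1/2`
(twice the signed area is the determinant below). -/
def IsPrimitiveTriangle (V : Finset (ℤ × ℤ)) : Prop :=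
  ∃ a b c : ℤ × ℤ, V = {a, b, c} ∧
    |(b.1 - a.1) * (c.2 - a.2) - (b.2 - a.2) * (c.1 - a.1)| = 1

/-- The upper part of the boundary of `P`. -/
def upperPart (P : Set (ℝ × ℝ)) : Set (ℝ × ℝ) :=
  {p | p ∈ P ∧ ∀ y' : ℝ, p.2 < y' → (p.1, y') ∉ P}

/-- The graph of (the restriction to `[0, m]` of) `φ`. -/
def graphOver (m : ℕ) (φ : ℝ → ℝ) : Set (ℝ × ℝ) :=
  {p | 0 ≤ p.1 ∧ p.1 ≤ m ∧ p.2 = φ p.1}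

/-- Admissible functions on `[0, m]`; the values of `φ` outside `[0, m]` play no role.
The segments are non-degenerate, and none is vertical because the graph contains it. Their
endpoints have abscissas in `{0, …, m}`, so there are finitely many of them, and `φ` is
piecewise linear. -/
def IsAdmissibleFun (m : ℕ) (φ : ℝ → ℝ) : Prop :=
  ContinuousOn φ (Icc (0 : ℝ) m) ∧
    ∃ E : Set ((ℤ × ℤ) × (ℤ × ℤ)), (∀ e ∈ E, e.1 ≠ e.2) ∧
      graphOver m φ = ⋃ e ∈ E, segment ℝ (latticePt e.1) (latticePt e.2)

/-- The region of the strip `0 ≤ x ≤ m` between the graphs of `φ₀` and `φ`. -/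
def stripRegion (m : ℕ) (φ₀ φ : ℝ → ℝ) : Set (ℝ × ℝ) :=
  {p | 0 ≤ p.1 ∧ p.1 ≤ m ∧ φ₀ p.1 ≤ p.2 ∧ p.2 ≤ φ p.1}

/-- `S` is a `φ₀`-admissible shape. (The case `φ = φ₀`, where `S` is just the graph
of `φ₀`, is allowed here.) -/
def IsAdmissibleShape (m : ℕ) (φ₀ : ℝ → ℝ) (S : Set (ℝ × ℝ)) : Prop :=
  ∃ φ : ℝ → ℝ, IsAdmissibleFun m φ ∧ (∀ x ∈ Icc (0 : ℝ) m, φ₀ x ≤ φ x) ∧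
    S = stripRegion m φ₀ φ

/-- Primitive lattice tiles of the strip `0 ≤ x ≤ m`: a primitive triangle without vertical
sides, a primitive triangle whose vertical side lies on the boundary of the strip, or the
union of two primitive triangles whose intersection is a common vertical side. -/
def IsPrimitiveTile (m : ℕ) (Q : Set (ℝ × ℝ)) : Prop :=
  (∃ V, IsPrimitiveTriangle V ∧ (∀ p ∈ V, ∀ q ∈ V, p.1 = q.1 → p = q) ∧ Q = latticeHull V) ∨
  (∃ V, IsPrimitiveTriangle V ∧
    (∃ p ∈ V, ∃ q ∈ V, p ≠ q ∧ p.1 = q.1 ∧ (p.1 = 0 ∨ p.1 = (m : ℤ))) ∧ Q = latticeHull V) ∨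
  (∃ V W, IsPrimitiveTriangle V ∧ IsPrimitiveTriangle W ∧
    (∃ p q : ℤ × ℤ, p ∈ V ∧ q ∈ V ∧ p ∈ W ∧ q ∈ W ∧ p ≠ q ∧ p.1 = q.1 ∧
      latticeHull V ∩ latticeHull W = segment ℝ (latticePt p) (latticePt q)) ∧
    Q = latticeHull V ∪ latticeHull W)

/-- `Q` is a `P`-maximal primitive lattice tile. -/
def IsMaximalTile (m : ℕ) (P Q : Set (ℝ × ℝ)) : Prop :=
  IsPrimitiveTile m Q ∧ Q ⊆ P ∧ upperPart Q ⊆ upperPart P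

/-- `S'` is the `φ₀`-admissible subshape of `S` obtained by removing `n` tiles which are
`S`-maximal and have pairwise disjoint interiors. As a shape with lower boundary function
`φ₀`, it always contains the graph of `φ₀`; where the tiles reach down to this graph, taking
the closure of the complement alone would lose it. -/
def IsSubshapeWith (m : ℕ) (φ₀ : ℝ → ℝ) (S S' : Set (ℝ × ℝ)) (n : ℕ) : Prop :=
  ∃ F : Finset (Set (ℝ × ℝ)), F.card = n ∧ (∀ Q ∈ F, IsMaximalTile m S Q) ∧
    (∀ Q ∈ F, ∀ R ∈ F, Q ≠ R → Disjoint (interior Q) (interior R)) ∧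
    S' = closure (S \ ⋃ Q ∈ F, Q) ∪ graphOver m φ₀

/-- The number `#(S', S)` of tiles removed from `S` to get the subshape `S'`. -/
noncomputable def removedCount (m : ℕ) (φ₀ : ℝ → ℝ) (S S' : Set (ℝ × ℝ)) : ℕ :=
  sInf {n | IsSubshapeWith m φ₀ S S' n}

/-- The proper `φ₀`-admissible subshapes of `S`. -/
def properSubshapes (m : ℕ) (φ₀ : ℝ → ℝ) (S : Set (ℝ × ℝ)) : Set (Set (ℝ × ℝ)) :=
  {S' | (∃ n, IsSubshapeWith m φ₀ S S' n) ∧ S' ≠ S}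

/-- `T` is (the set of triangles, given by their vertex sets, of) a primitive lattice
triangulation of `P`. The triangles meet face to face and cover the closure of the interior
of `P`: this is `P` itself for a genuine polygon, while one-dimensional parts of `P` (where
the upper boundary runs along the lower one) are disregarded. -/
def IsPrimitiveTriangulation (P : Set (ℝ × ℝ)) (T : Finset (Finset (ℤ × ℤ))) : Prop :=
  (∀ V ∈ T, IsPrimitiveTriangle V) ∧
    (∀ V ∈ T, ∀ W ∈ T, latticeHull V ∩ latticeHull W = latticeHull (V ∩ W)) ∧
    (⋃ V ∈ T, latticeHull V) = closure (interior P)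

/-- `T` has an interior edge (an edge that does not lie on the boundary of `P`) whose
projection to the `x`-axis is the whole segment `[0, m]`. -/
def HasFullInteriorEdge (m : ℕ) (P : Set (ℝ × ℝ)) (T : Finset (Finset (ℤ × ℤ))) : Prop :=
  ∃ V ∈ T, ∃ p ∈ V, ∃ q ∈ V,
    Prod.fst '' segment ℝ (latticePt p) (latticePt q) = Icc (0 : ℝ) m ∧
    ¬ segment ℝ (latticePt p) (latticePt q) ⊆ frontier P

/-- `f*(P)`: the number of primitive lattice triangulations of `P`. -/
noncomputable def fStar (P : Set (ℝ × ℝ)) : ℕ :=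
  {T | IsPrimitiveTriangulation P T}.ncard

/-- `f(P)`: the number of primitive lattice triangulations of `P` without an interior edge
whose projection to the `x`-axis is the whole segment `[0, m]`. -/
noncomputable def fRestricted (m : ℕ) (P : Set (ℝ × ℝ)) : ℕ :=
  {T | IsPrimitiveTriangulation P T ∧ ¬ HasFullInteriorEdge m P T}.ncard

/-- `A` contains a point of `ℤ² ∩ {0 < x < m}`. -/
def HasInnerLatticePoint (m : ℕ) (A : Set (ℝ × ℝ)) : Prop :=
  ∃ p : ℤ × ℤ, 0 < p.1 ∧ p.1 < (m : ℤ) ∧ latticePt p ∈ A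

/-! The proof is inclusion-exclusion over maximal tiles. Let `T` be a triangulation of `S`, and
consider the `S`-maximal tiles whose triangles all belong to `T`. There is at least one such tile
(`IsLatticeStrip.exists_maximalTile`), and any two have disjoint interiors, because distinct tiles
of one triangulation share no triangle (`IsTileTriangles.eq_of_mem`). Hence the sum of
`(-1)^(|F|-1)` over the nonempty sets `F` of these tiles is `1`. Summing over `T` and exchanging the
sums writes the number of triangulations as an alternating sum, over nonempty removable `F`, of the
number of triangulations containing `F` (`ncard_eq_sum`). Deleting the tiles of `F` is a bijection
from those triangulations onto the triangulations of the subshape (`ncard_triangulations`), and the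
subshape determines `F` (`eq_of_subshape_eq`), so the sum runs over proper subshapes.

A maximal tile is found as follows. Each triangle of `T` lies in a tile of `T`: across a vertical
side inside the strip there is a second triangle. Over every slab `[k, k+1]` where `S` has positive
height, some tile reaches the upper boundary. Among the tiles that reach it over their own first
slab, take one starting furthest to the right. If it left the upper boundary over a later slab, then
the top tile there would either start at that slab, against the choice, or start earlier, overlap
the first tile just below the upper boundary, and so be equal to it.

For the restricted count, suppose first that the top of the subshape has an inner lattice point.
Then `T` has a full interior edge exactly when the triangulation left after deletion has one
(`hasFullInteriorEdge_sdiff` and `hasFullInteriorEdge_of_subshape`). If the top has no inner lattice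
point, it is one straight segment without inner lattice points, and this segment is a full interior
edge of every `T` containing `F`; such `F` contribute nothing. The only exception is a shape that is
a single triangle standing on that segment (`hasFullInteriorEdge_of_no_inner`).

Overlaps and coverings are tested on generic points, those on no line through two lattice points.
They are dense and never lie on a boundary, so a triangulation is the same as a partition of the
generic points of the shape into primitive triangles (`isPrimitiveTriangulation_iff`). -/

/-! ### Orientation, barycentric coordinates and primitive triangles -/

/-- Twice the signed area of a lattice triangle. -/
def det3 (a b c : ℤ × ℤ) : ℤ := (b.1 - a.1) * (c.2 - a.2) - (b.2 - a.2) * (c.1 - a.1)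

/-- Twice the signed area of the triangle `a b w`; its sign tells the side of the line `a b` on
which `w` lies. -/
def side (a b : ℤ × ℤ) (w : ℝ × ℝ) : ℝ :=
  ((b.1 : ℝ) - a.1) * (w.2 - a.2) - ((b.2 : ℝ) - a.2) * (w.1 - a.1)

theorem side_latticePt (a b c : ℤ × ℤ) : side a b (latticePt c) = det3 a b c := by
  simp [side, det3, latticePt]

theorem continuous_side (a b : ℤ × ℤ) : Continuous (side a b) := by
  unfold side; fun_prop

theorem latticePt_injective : Function.Injective latticePt := by
  intro p q h
  simp only [latticePt, Prod.mk.injEq, Int.cast_inj] at h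
  exact Prod.ext h.1 h.2

theorem convex_side_nonneg (s : ℝ) (a b : ℤ × ℤ) : Convex ℝ {w | 0 ≤ s * side a b w} := by
  intro x hx y hy u v hu hv huv
  simp only [mem_ofPred_eq, side, Prod.fst_add, Prod.snd_add, Prod.smul_fst, Prod.smul_snd,
    smul_eq_mul] at *
  have hv' : v = 1 - u := by linarith
  subst hv'
  nlinarith [mul_nonneg hu hx, mul_nonneg hv hy]

theorem det3_rotate (a b c : ℤ × ℤ) : det3 b c a = det3 a b c := by
  simp only [det3]; ring

theorem det3_swap (a b c : ℤ × ℤ) : det3 b a c = -det3 a b c := by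
  simp only [det3]; ring

theorem side_swap (a b : ℤ × ℤ) (w : ℝ × ℝ) : side b a w = -side a b w := by
  simp only [side]; ring

theorem side_sum (a b c : ℤ × ℤ) (w : ℝ × ℝ) :
    side b c w + side c a w + side a b w = det3 a b c := by
  simp only [side, det3]; push_cast; ring

/-- Cramer's rule: up to the factor `det3 a b c`, the three values of `side` are the barycentric
coordinates of `w`. -/
theorem side_barycentric (a b c : ℤ × ℤ) (w : ℝ × ℝ) :
    side b c w • latticePt a + side c a w • latticePt b + side a b w • latticePt c =
      (det3 a b c : ℝ) • w := by
  ext <;> simp only [side, det3, latticePt, Prod.fst_add, Prod.snd_add, Prod.smul_fst,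
    Prod.smul_snd, smul_eq_mul] <;> push_cast <;> ring

theorem latticePt_mem_latticeHull {V : Finset (ℤ × ℤ)} {p : ℤ × ℤ} (hp : p ∈ V) :
    latticePt p ∈ latticeHull V :=
  subset_convexHull _ _ ⟨p, hp, rfl⟩

theorem latticeHull_mono {V W : Finset (ℤ × ℤ)} (h : V ⊆ W) : latticeHull V ⊆ latticeHull W :=
  convexHull_mono (image_mono (by exact_mod_cast h))

theorem convex_latticeHull (V : Finset (ℤ × ℤ)) : Convex ℝ (latticeHull V) :=
  convex_convexHull _ _

theorem segment_subset_latticeHull {V : Finset (ℤ × ℤ)} {p q : ℤ × ℤ} (hp : p ∈ V) (hq : q ∈ V) :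
    segment ℝ (latticePt p) (latticePt q) ⊆ latticeHull V :=
  (convex_latticeHull V).segment_subset (latticePt_mem_latticeHull hp)
    (latticePt_mem_latticeHull hq)

theorem latticeHull_pair (p q : ℤ × ℤ) :
    latticeHull {p, q} = segment ℝ (latticePt p) (latticePt q) := by
  simp [latticeHull, image_pair, convexHull_pair]

theorem isClosed_latticeHull (V : Finset (ℤ × ℤ)) : IsClosed (latticeHull V) :=
  ((V.finite_toSet.image _).isCompact_convexHull ℝ).isClosed

theorem sq_det_cast {a b c : ℤ × ℤ} (h : |det3 a b c| = 1) :
    (det3 a b c : ℝ) * det3 a b c = 1 := by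
  have : det3 a b c * det3 a b c = 1 := by
    rw [← abs_mul_abs_self, h]; rfl
  exact_mod_cast this

/-- The determinant is its own inverse, so multiplying by it turns the three values of `side` into
the true barycentric coordinates, whatever the orientation. -/
theorem mem_latticeHull_iff {a b c : ℤ × ℤ} (h : |det3 a b c| = 1) (w : ℝ × ℝ) :
    w ∈ latticeHull {a, b, c} ↔ 0 ≤ (det3 a b c : ℝ) * side b c w ∧
      0 ≤ (det3 a b c : ℝ) * side c a w ∧ 0 ≤ (det3 a b c : ℝ) * side a b w := by
  have hD := sq_det_cast h
  constructor
  · intro hw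
    have hc : Convex ℝ ({w | 0 ≤ (det3 a b c : ℝ) * side b c w} ∩
        {w | 0 ≤ (det3 a b c : ℝ) * side c a w} ∩ {w | 0 ≤ (det3 a b c : ℝ) * side a b w}) :=
      ((convex_side_nonneg _ _ _).inter (convex_side_nonneg _ _ _)).inter (convex_side_nonneg _ _ _)
    have := convexHull_min (s := latticePt '' (({a, b, c} : Finset (ℤ × ℤ)) : Set (ℤ × ℤ)))
      ?_ hc hw
    · simpa [and_assoc] using this
    · have e1 : det3 b c a = det3 a b c := det3_rotate a b c
      have e2 : det3 c a b = det3 a b c := by rw [← det3_rotate a b c, ← det3_rotate b c a]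
      have z1 : ∀ u v : ℤ × ℤ, det3 u v u = 0 := by intro u v; simp [det3]
      have z2 : ∀ u v : ℤ × ℤ, det3 u v v = 0 := by intro u v; simp [det3]; ring
      rintro _ ⟨p, hp, rfl⟩
      simp only [Finset.coe_insert, Finset.coe_singleton, mem_insert_iff, mem_singleton_iff] at hp
      rcases hp with rfl | rfl | rfl <;>
        simp [side_latticePt, e1, e2, z1, z2, hD]
  · rintro ⟨h1, h2, h3⟩
    have key : w = ∑ i : Fin 3, (![(det3 a b c : ℝ) * side b c w, (det3 a b c : ℝ) * side c a w,
        (det3 a b c : ℝ) * side a b w] i) • (![latticePt a, latticePt b, latticePt c] i) := by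
      have := side_barycentric a b c w
      simp only [Fin.sum_univ_three, Matrix.cons_val_zero, Matrix.cons_val_one, Matrix.cons_val,
        mul_smul]
      rw [← smul_add, ← smul_add, this, smul_smul, hD, one_smul]
    rw [key]
    apply (convex_latticeHull _).sum_mem
    · intro i _; fin_cases i <;> simpa
    · simp only [Fin.sum_univ_three, Matrix.cons_val_zero, Matrix.cons_val_one, Matrix.cons_val]
      rw [← mul_add, ← mul_add, side_sum, hD]
    · intro i _
      fin_cases i <;> exact latticePt_mem_latticeHull (by simp)

theorem abs_det3_rotate {a b c : ℤ × ℤ} (h : |det3 a b c| = 1) : |det3 b c a| = 1 := by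
  rw [det3_rotate]; exact h

theorem abs_det3_swap {a b c : ℤ × ℤ} (h : |det3 a b c| = 1) : |det3 b a c| = 1 := by
  rw [det3_swap, abs_neg]; exact h

theorem det3_ne {a b c : ℤ × ℤ} (h : |det3 a b c| = 1) : a ≠ b ∧ b ≠ c ∧ c ≠ a := by
  refine ⟨?_, ?_, ?_⟩ <;> rintro rfl <;> simp [det3, mul_comm] at h

theorem IsPrimitiveTriangle.of_det {a b c : ℤ × ℤ} (h : |det3 a b c| = 1) :
    IsPrimitiveTriangle {a, b, c} := ⟨a, b, c, rfl, h⟩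

theorem IsPrimitiveTriangle.exists_det {V : Finset (ℤ × ℤ)} (hV : IsPrimitiveTriangle V) :
    ∃ a b c, V = {a, b, c} ∧ |det3 a b c| = 1 := hV

theorem IsPrimitiveTriangle.card_eq {V : Finset (ℤ × ℤ)} (hV : IsPrimitiveTriangle V) :
    V.card = 3 := by
  obtain ⟨a, b, c, rfl, h⟩ := hV.exists_det
  obtain ⟨h1, h2, h3⟩ := det3_ne h
  exact Finset.card_eq_three.2 ⟨a, b, c, h1, h3.symm, h2, rfl⟩

theorem IsPrimitiveTriangle.exists_third {V : Finset (ℤ × ℤ)} (hV : IsPrimitiveTriangle V)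
    {p q : ℤ × ℤ} (hp : p ∈ V) (hq : q ∈ V) (hpq : p ≠ q) :
    ∃ c, V = {p, q, c} ∧ |det3 p q c| = 1 := by
  obtain ⟨a, b, c, rfl, h⟩ := hV.exists_det
  have h1 := abs_det3_rotate h
  have h2 := abs_det3_rotate h1
  simp only [Finset.mem_insert, Finset.mem_singleton] at hp hq
  rcases hp with rfl | rfl | rfl <;> rcases hq with rfl | rfl | rfl
  · exact absurd rfl hpq
  · exact ⟨_, rfl, h⟩
  · exact ⟨b, by ext; simp; tauto, abs_det3_swap h2⟩
  · exact ⟨c, by ext; simp; tauto, abs_det3_swap h⟩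
  · exact absurd rfl hpq
  · exact ⟨a, by ext; simp; tauto, h1⟩
  · exact ⟨b, by ext; simp; tauto, h2⟩
  · exact ⟨a, by ext; simp; tauto, abs_det3_swap h1⟩
  · exact absurd rfl hpq

theorem IsPrimitiveTriangle.exists_others {V : Finset (ℤ × ℤ)} (hV : IsPrimitiveTriangle V)
    {p : ℤ × ℤ} (hp : p ∈ V) : ∃ b c, V = {p, b, c} ∧ |det3 p b c| = 1 := by
  obtain ⟨q, hq, hne⟩ := Finset.exists_mem_ne (by rw [hV.card_eq]; norm_num) p
  obtain ⟨c, h⟩ := hV.exists_third hp hq hne.symm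
  exact ⟨q, c, h⟩

/-- The vertices of a primitive lattice triangle are its only lattice points. -/
theorem IsPrimitiveTriangle.mem_of_latticePt_mem {V : Finset (ℤ × ℤ)} (hV : IsPrimitiveTriangle V)
    {p : ℤ × ℤ} (hp : latticePt p ∈ latticeHull V) : p ∈ V := by
  obtain ⟨a, b, c, rfl, h⟩ := hV.exists_det
  rw [mem_latticeHull_iff h] at hp
  have hs := side_sum a b c (latticePt p)
  have hb := side_barycentric a b c (latticePt p)
  have hD := sq_det_cast h
  simp only [side_latticePt] at hp hs hb
  have hs' : det3 b c p + det3 c a p + det3 a b p = det3 a b c := by exact_mod_cast hs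
  have hD' : det3 a b c * det3 a b c = 1 := by exact_mod_cast hD
  obtain ⟨h1, h2, h3⟩ := hp
  have h1' : 0 ≤ det3 a b c * det3 b c p := by exact_mod_cast h1
  have h2' : 0 ≤ det3 a b c * det3 c a p := by exact_mod_cast h2
  have h3' : 0 ≤ det3 a b c * det3 a b p := by exact_mod_cast h3
  set D := det3 a b c with hDdef
  have hsum : D * det3 b c p + D * det3 c a p + D * det3 a b p = 1 := by
    rw [← mul_add, ← mul_add, hs', hD']
  have hb' : latticePt p = ((D * det3 b c p : ℤ) : ℝ) • latticePt a +
      ((D * det3 c a p : ℤ) : ℝ) • latticePt b + ((D * det3 a b p : ℤ) : ℝ) • latticePt c := by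
    push_cast
    simp only [mul_smul]
    rw [← smul_add, ← smul_add, hb, smul_smul, hD, one_smul]
  simp only [Finset.mem_insert, Finset.mem_singleton]
  -- The barycentric coordinates of a lattice point are integers; being nonnegative with sum `1`,
  -- they are a unit vector.
  have cases3 : (D * det3 b c p = 1 ∧ D * det3 c a p = 0 ∧ D * det3 a b p = 0) ∨
      (D * det3 b c p = 0 ∧ D * det3 c a p = 1 ∧ D * det3 a b p = 0) ∨
      (D * det3 b c p = 0 ∧ D * det3 c a p = 0 ∧ D * det3 a b p = 1) := by omega
  rcases cases3 with ⟨e1, e2, e3⟩ | ⟨e1, e2, e3⟩ | ⟨e1, e2, e3⟩ <;> rw [e1, e2, e3] at hb' <;>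
    simp at hb'
  · exact Or.inl (latticePt_injective hb')
  · exact Or.inr (Or.inl (latticePt_injective hb'))
  · exact Or.inr (Or.inr (latticePt_injective hb'))

theorem side_combination {p q a b : ℤ × ℤ} {s t : ℝ} (hst : s + t = 1) :
    side a b (s • latticePt p + t • latticePt q) = s * det3 a b p + t * det3 a b q := by
  obtain rfl : t = 1 - s := by linarith
  simp only [side, det3, latticePt, Prod.fst_add, Prod.snd_add, Prod.smul_fst, Prod.smul_snd,
    smul_eq_mul]
  push_cast; ring

/-- Near a point inside the edge `p q`, a triangle with vertices `p`, `q`, `c` is a half-plane. -/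
theorem eventually_mem_latticeHull {p q c : ℤ × ℤ} (h : |det3 p q c| = 1) {z : ℝ × ℝ}
    (hz : z ∈ openSegment ℝ (latticePt p) (latticePt q)) :
    ∀ᶠ w in nhds z, 0 ≤ (det3 p q c : ℝ) * side p q w → w ∈ latticeHull {p, q, c} := by
  obtain ⟨s, t, hs, ht, hst, rfl⟩ := hz
  have hD := sq_det_cast h
  have e1 : det3 q c p = det3 p q c := det3_rotate p q c
  have e2 : det3 c p q = det3 p q c := by rw [← det3_rotate p q c, ← det3_rotate q c p]
  have z1 : ∀ u v : ℤ × ℤ, det3 u v u = 0 := by intro u v; simp [det3]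
  have z2 : ∀ u v : ℤ × ℤ, det3 u v v = 0 := by intro u v; simp [det3]; ring
  -- The other two barycentric coordinates equal `s` and `t` at the given point, hence stay positive
  -- nearby.
  have c1 : ∀ᶠ w in nhds (s • latticePt p + t • latticePt q),
      0 < (det3 p q c : ℝ) * side q c w := by
    apply (continuous_const.mul (continuous_side q c)).continuousAt.eventually_const_lt
    simp only [Pi.mul_apply, side_combination hst, e1, z1]; simp
    rw [mul_left_comm, hD]; simpa
  have c2 : ∀ᶠ w in nhds (s • latticePt p + t • latticePt q),
      0 < (det3 p q c : ℝ) * side c p w := by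
    apply (continuous_const.mul (continuous_side c p)).continuousAt.eventually_const_lt
    simp only [Pi.mul_apply, side_combination hst, e2, z2]; simp
    rw [mul_left_comm, hD]; simpa
  filter_upwards [c1, c2] with w w1 w2 w3
  exact (mem_latticeHull_iff h w).2 ⟨w1.le, w2.le, w3⟩

/-! ### Generic points -/

/-- Points which do not lie on any line through two lattice points. -/
def genericPts : Set (ℝ × ℝ) := {w | ∀ a b : ℤ × ℤ, a ≠ b → side a b w ≠ 0}

theorem dense_side_ne {a b : ℤ × ℤ} (hab : a ≠ b) : Dense {w | side a b w ≠ 0} := by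
  rw [Metric.dense_iff]
  intro x r hr
  by_cases hx : side a b x = 0
  swap
  · exact ⟨x, Metric.mem_ball_self hr, hx⟩
  have hd : ((b.1 : ℝ) - a.1) ≠ 0 ∨ ((b.2 : ℝ) - a.2) ≠ 0 := by
    by_contra! hcon
    exact hab (Prod.ext (by exact_mod_cast (sub_eq_zero.1 hcon.1).symm)
      (by exact_mod_cast (sub_eq_zero.1 hcon.2).symm))
  rcases hd with hd | hd
  · refine ⟨(x.1, x.2 + r / 2), ?_, ?_⟩
    · simp [Prod.dist_eq, abs_of_pos hr, hr]
    · have : side a b (x.1, x.2 + r / 2) = side a b x + ((b.1 : ℝ) - a.1) * (r / 2) := by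
        simp only [side]; ring
      simp only [mem_ofPred_eq, this, hx, zero_add]
      positivity
  · refine ⟨(x.1 + r / 2, x.2), ?_, ?_⟩
    · simp [Prod.dist_eq, abs_of_pos hr, hr]
    · have : side a b (x.1 + r / 2, x.2) = side a b x - ((b.2 : ℝ) - a.2) * (r / 2) := by
        simp only [side]; ring
      simp only [mem_ofPred_eq, this, hx, zero_sub, neg_ne_zero]
      positivity

/-- Baire category: there are countably many lines through two lattice points, and each has an open
dense complement. -/
theorem dense_genericPts : Dense genericPts := by
  have : genericPts = ⋂ e : {e : (ℤ × ℤ) × (ℤ × ℤ) // e.1 ≠ e.2},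
      {w | side e.1.1 e.1.2 w ≠ 0} := by
    ext w; simp [genericPts]
  rw [this]
  apply dense_iInter_of_isOpen
  · intro e; exact isOpen_ne_fun (continuous_side _ _) continuous_const
  · intro e; exact dense_side_ne e.2

theorem exists_generic_mem {U : Set (ℝ × ℝ)} (hU : IsOpen U) (hne : U.Nonempty) :
    ∃ g ∈ genericPts, g ∈ U := by
  obtain ⟨g, h1, h2⟩ := dense_genericPts.inter_open_nonempty U hU hne
  exact ⟨g, h2, h1⟩

theorem isOpen_strict (a b c : ℤ × ℤ) : IsOpen {w | 0 < (det3 a b c : ℝ) * side b c w ∧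
    0 < (det3 a b c : ℝ) * side c a w ∧ 0 < (det3 a b c : ℝ) * side a b w} := by
  have : ∀ u v, IsOpen {w | 0 < (det3 a b c : ℝ) * side u v w} := fun u v =>
    isOpen_lt continuous_const (continuous_const.mul (continuous_side u v))
  exact (this b c).inter ((this c a).inter (this a b))

/-- None of the three inequalities that describe the triangle can be an equality at a generic point.
-/
theorem generic_mem_interior {V : Finset (ℤ × ℤ)} (hV : IsPrimitiveTriangle V) {g : ℝ × ℝ}
    (hg : g ∈ genericPts) (hgV : g ∈ latticeHull V) : g ∈ interior (latticeHull V) := by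
  obtain ⟨a, b, c, rfl, h⟩ := hV.exists_det
  obtain ⟨n1, n2, n3⟩ := det3_ne h
  have hD : (det3 a b c : ℝ) ≠ 0 := by
    intro h0; have := sq_det_cast h; rw [h0] at this; simp at this
  have := (mem_latticeHull_iff h g).1 hgV
  rw [mem_interior]
  refine ⟨_, ?_, isOpen_strict a b c, ?_⟩
  · rintro w ⟨h1, h2, h3⟩
    exact (mem_latticeHull_iff h w).2 ⟨h1.le, h2.le, h3.le⟩
  · exact ⟨this.1.lt_of_ne' (mul_ne_zero hD (hg _ _ n2)),
      this.2.1.lt_of_ne' (mul_ne_zero hD (hg _ _ n3)),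
      this.2.2.lt_of_ne' (mul_ne_zero hD (hg _ _ n1))⟩

theorem interior_latticeHull_nonempty {V : Finset (ℤ × ℤ)} (hV : IsPrimitiveTriangle V) :
    (interior (latticeHull V)).Nonempty := by
  obtain ⟨a, b, c, rfl, h⟩ := hV.exists_det
  have hD := sq_det_cast h
  refine ⟨(3 : ℝ)⁻¹ • (latticePt a + latticePt b + latticePt c), ?_⟩
  rw [mem_interior]
  refine ⟨_, ?_, isOpen_strict a b c, ?_⟩
  · rintro w ⟨h1, h2, h3⟩
    exact (mem_latticeHull_iff h w).2 ⟨h1.le, h2.le, h3.le⟩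
  · have e : ∀ u v x, det3 u v x = det3 a b c →
      (∀ y, y = (3 : ℝ)⁻¹ • (latticePt u + latticePt v + latticePt x) →
      0 < (det3 a b c : ℝ) * side u v y) := by
      intro u v x hx y hy
      have : side u v y = (det3 u v x : ℝ) / 3 := by
        rw [hy]; simp only [side, det3, latticePt]; push_cast; simp; ring
      rw [this, hx, mul_div_assoc', hD]; norm_num
    refine ⟨e b c a (det3_rotate a b c) _ ?_, e c a b ?_ _ ?_, e a b c rfl _ rfl⟩
    · rw [show latticePt b + latticePt c + latticePt a = latticePt a + latticePt b + latticePt c by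
        abel]
    · rw [← det3_rotate a b c, ← det3_rotate b c a]
    · rw [show latticePt c + latticePt a + latticePt b = latticePt a + latticePt b + latticePt c by
        abel]

theorem exists_generic_mem_latticeHull {V : Finset (ℤ × ℤ)} (hV : IsPrimitiveTriangle V) :
    ∃ g ∈ genericPts, g ∈ latticeHull V := by
  obtain ⟨g, h1, h2⟩ := exists_generic_mem isOpen_interior (interior_latticeHull_nonempty hV)
  exact ⟨g, h1, interior_subset h2⟩

/-- A convex set with nonempty interior lies in the closure of that interior. This lets inclusions
in closed sets be checked on generic points. -/
theorem latticeHull_subset_closure {V : Finset (ℤ × ℤ)} (hV : IsPrimitiveTriangle V) :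
    latticeHull V ⊆ closure (genericPts ∩ latticeHull V) := by
  have h1 : latticeHull V ⊆ closure (interior (latticeHull V)) := by
    rw [(convex_latticeHull V).closure_interior_eq_closure_of_nonempty_interior
      (interior_latticeHull_nonempty hV)]
    exact subset_closure
  refine h1.trans (closure_minimal ?_ isClosed_closure)
  refine (dense_genericPts.open_subset_closure_inter isOpen_interior).trans (closure_mono ?_)
  exact fun x hx => ⟨hx.2, interior_subset hx.1⟩

theorem generic_notMem_latticeHull_pair {g : ℝ × ℝ} (hg : g ∈ genericPts) {a b : ℤ × ℤ}
    (hab : a ≠ b) : g ∉ latticeHull {a, b} := by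
  rw [latticeHull_pair]
  rintro ⟨s, t, -, -, hst, rfl⟩
  apply hg a b hab
  rw [side_combination hst]; simp [det3]; right; ring

/-- Distinct vertex sets share at most two points, whose hull lies on a lattice line. Face-to-face
triangles therefore have no common generic point. -/
theorem generic_notMem_inter {V W : Finset (ℤ × ℤ)} (hV : IsPrimitiveTriangle V)
    (hW : IsPrimitiveTriangle W) (hne : V ≠ W) {g : ℝ × ℝ} (hg : g ∈ genericPts) :
    g ∉ latticeHull (V ∩ W) := by
  have : ∃ v ∈ V, v ∉ W := by
    by_contra! hcon
    exact hne (Finset.eq_of_subset_of_card_le hcon (by rw [hV.card_eq, hW.card_eq]))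
  obtain ⟨v, hv, hvW⟩ := this
  obtain ⟨b, c, rfl, h⟩ := hV.exists_others hv
  intro hgm
  refine generic_notMem_latticeHull_pair hg (det3_ne h).2.1 (latticeHull_mono ?_ hgm)
  intro x hx
  simp only [Finset.mem_inter, Finset.mem_insert, Finset.mem_singleton] at hx ⊢
  rcases hx with ⟨rfl | h | h, hx⟩
  · exact absurd hx hvW
  · exact Or.inl h
  · exact Or.inr h

/-! ### Primitive triangles without overlap meet face to face -/

theorem mem_edge_cases {V : Finset (ℤ × ℤ)} (hV : IsPrimitiveTriangle V) {x : ℝ × ℝ}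
    (hx : x ∈ latticeHull V) :
    x ∈ interior (latticeHull V) ∨ (∃ p ∈ V, x = latticePt p) ∨
      ∃ p ∈ V, ∃ q ∈ V, p ≠ q ∧ x ∈ openSegment ℝ (latticePt p) (latticePt q) := by
  obtain ⟨a, b, c, rfl, h⟩ := hV.exists_det
  by_cases hint : 0 < (det3 a b c : ℝ) * side b c x ∧
    0 < (det3 a b c : ℝ) * side c a x ∧ 0 < (det3 a b c : ℝ) * side a b x
  · left
    rw [mem_interior]
    exact ⟨_, fun w hw => (mem_latticeHull_iff h w).2 ⟨hw.1.le, hw.2.1.le, hw.2.2.le⟩,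
      isOpen_strict a b c, hint⟩
  right
  -- When one barycentric coordinate vanishes, the other two decide between an endpoint and the open
  -- edge.
  have key : ∀ u v w : ℤ × ℤ, |det3 u v w| = 1 → x ∈ latticeHull {u, v, w} →
      (det3 u v w : ℝ) * side u v x = 0 → x = latticePt u ∨ x = latticePt v ∨
        x ∈ openSegment ℝ (latticePt u) (latticePt v) := by
    intro u v w hd hxm h0
    obtain ⟨h1, h2, -⟩ := (mem_latticeHull_iff hd x).1 hxm
    have hD := sq_det_cast hd
    have hsum : (det3 u v w : ℝ) * side v w x + (det3 u v w : ℝ) * side w u x = 1 := by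
      linear_combination (det3 u v w : ℝ) * side_sum u v w x + hD - h0
    have hb := side_barycentric u v w x
    have hx' : x = ((det3 u v w : ℝ) * side v w x) • latticePt u +
        ((det3 u v w : ℝ) * side w u x) • latticePt v := by
      have := congrArg (fun y => (det3 u v w : ℝ) • y) hb
      simp only [smul_add, smul_smul, h0, hD, zero_smul, one_smul, add_zero] at this
      exact this.symm
    rcases h1.eq_or_lt with e1 | e1
    · rw [← e1] at hx' hsum
      rw [zero_add] at hsum
      rw [hsum] at hx'
      right; left; simpa using hx'
    rcases h2.eq_or_lt with e2 | e2
    · rw [← e2] at hx' hsum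
      rw [add_zero] at hsum
      rw [hsum] at hx'
      left; simpa using hx'
    · exact Or.inr (Or.inr ⟨_, _, e1, e2, hsum, hx'.symm⟩)
  obtain ⟨n1, n2, n3⟩ := det3_ne h
  obtain ⟨m1, m2, m3⟩ := (mem_latticeHull_iff h x).1 hx
  have h1 := abs_det3_rotate h
  have h2 := abs_det3_rotate h1
  have e1 : det3 b c a = det3 a b c := det3_rotate a b c
  have e2 : det3 c a b = det3 a b c := by rw [← det3_rotate a b c, ← det3_rotate b c a]
  have s1 : ({b, c, a} : Finset (ℤ × ℤ)) = {a, b, c} := by ext; simp; tauto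
  have s2 : ({c, a, b} : Finset (ℤ × ℤ)) = {a, b, c} := by ext; simp; tauto
  have hzero : (det3 a b c : ℝ) * side b c x = 0 ∨ (det3 a b c : ℝ) * side c a x = 0 ∨
      (det3 a b c : ℝ) * side a b x = 0 := by
    by_contra! hcon
    exact hint ⟨m1.lt_of_ne' hcon.1, m2.lt_of_ne' hcon.2.1, m3.lt_of_ne' hcon.2.2⟩
  rcases hzero with h0 | h0 | h0
  · rcases key b c a h1 (by rwa [s1]) (by rwa [e1]) with r | r | r
    · exact Or.inl ⟨b, by simp, r⟩
    · exact Or.inl ⟨c, by simp, r⟩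
    · exact Or.inr ⟨b, by simp, c, by simp, n2, r⟩
  · rcases key c a b h2 (by rwa [s2]) (by rwa [e2]) with r | r | r
    · exact Or.inl ⟨c, by simp, r⟩
    · exact Or.inl ⟨a, by simp, r⟩
    · exact Or.inr ⟨c, by simp, a, by simp, n3, r⟩
  · rcases key a b c h hx h0 with r | r | r
    · exact Or.inl ⟨a, by simp, r⟩
    · exact Or.inl ⟨b, by simp, r⟩
    · exact Or.inr ⟨a, by simp, b, by simp, n1, r⟩

theorem exists_generic_of_interior {V W : Finset (ℤ × ℤ)} (hW : IsPrimitiveTriangle W) {x : ℝ × ℝ}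
    (hV : x ∈ interior (latticeHull V)) (hxW : x ∈ latticeHull W) :
    ∃ g ∈ genericPts, g ∈ latticeHull V ∧ g ∈ latticeHull W := by
  obtain ⟨g, hg, hgG, hgW⟩ := mem_closure_iff.1 (latticeHull_subset_closure hW hxW) _
    isOpen_interior hV
  exact ⟨g, hgG, interior_subset hg, hgW⟩

theorem side_eq_zero_of_mem_openSegment {p q : ℤ × ℤ} {x : ℝ × ℝ}
    (hx : x ∈ openSegment ℝ (latticePt p) (latticePt q)) : side p q x = 0 := by
  obtain ⟨s, t, -, -, hst, rfl⟩ := hx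
  rw [side_combination hst]; simp [det3]; right; ring

theorem exists_pos_add_smul_mem {U : Set (ℝ × ℝ)} (hU : IsOpen U) {z : ℝ × ℝ} (hz : z ∈ U)
    (v : ℝ × ℝ) : ∃ t : ℝ, 0 < t ∧ z + t • v ∈ U := by
  have ht : Filter.Tendsto (fun t : ℝ => z + t • v) (nhdsWithin 0 (Ioi 0)) (nhds z) := by
    have : Filter.Tendsto (fun t : ℝ => z + t • v) (nhds 0) (nhds (z + (0 : ℝ) • v)) :=
      (Continuous.tendsto (by fun_prop) 0)
    rw [zero_smul, add_zero] at this
    exact this.mono_left nhdsWithin_le_nhds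
  obtain ⟨t, ht1, ht2⟩ := ((ht.eventually (hU.mem_nhds hz)).and self_mem_nhdsWithin).exists
  exact ⟨t, ht2, ht1⟩

/-- Near `x` both triangles are half-planes bounded by lines through `x`. A small step along `v`
enters both open half-planes, so they have a common open set near `x`. -/
theorem exists_generic_of_half_planes {p q c p' q' c' : ℤ × ℤ} (h : |det3 p q c| = 1)
    (h' : |det3 p' q' c'| = 1) {x : ℝ × ℝ}
    (hx : x ∈ openSegment ℝ (latticePt p) (latticePt q))
    (hx' : x ∈ openSegment ℝ (latticePt p') (latticePt q')) {v : ℝ × ℝ}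
    (hv : 0 < (det3 p q c : ℝ) * side p q (x + v))
    (hv' : 0 < (det3 p' q' c' : ℝ) * side p' q' (x + v)) :
    ∃ g ∈ genericPts, g ∈ latticeHull {p, q, c} ∧ g ∈ latticeHull {p', q', c'} := by
  have e := (eventually_mem_latticeHull h hx).and (eventually_mem_latticeHull h' hx')
  obtain ⟨U, hU, hUo, hxU⟩ := mem_nhds_iff.1 e
  have hz := side_eq_zero_of_mem_openSegment hx
  have hz' := side_eq_zero_of_mem_openSegment hx'
  have hlin : ∀ (p q : ℤ × ℤ) (t : ℝ), side p q x = 0 →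
      side p q (x + t • v) = t * side p q (x + v) := by
    intro p q t h0
    simp only [side, Prod.fst_add, Prod.snd_add, Prod.smul_fst, Prod.smul_snd, smul_eq_mul] at *
    linear_combination (1 - t) * h0
  have hopen : IsOpen (U ∩ ({w | 0 < (det3 p q c : ℝ) * side p q w} ∩
      {w | 0 < (det3 p' q' c' : ℝ) * side p' q' w})) :=
    hUo.inter ((isOpen_lt continuous_const (continuous_const.mul (continuous_side _ _))).inter
      (isOpen_lt continuous_const (continuous_const.mul (continuous_side _ _))))
  have hne : (U ∩ ({w | 0 < (det3 p q c : ℝ) * side p q w} ∩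
      {w | 0 < (det3 p' q' c' : ℝ) * side p' q' w})).Nonempty := by
    obtain ⟨t, ht2, ht1⟩ := exists_pos_add_smul_mem hUo hxU v
    refine ⟨x + t • v, ht1, ?_, ?_⟩
    · simp only [mem_ofPred_eq]
      rw [hlin p q t hz, mul_left_comm]; positivity
    · simp only [mem_ofPred_eq]
      rw [hlin p' q' t hz', mul_left_comm]; positivity
  obtain ⟨g, hg, hgU, hg1, hg2⟩ := exists_generic_mem hopen hne
  have := hU hgU
  exact ⟨g, hg, this.1 (le_of_lt hg1), this.2 (le_of_lt hg2)⟩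

/-- An interval with integer ends that contains a point of `(0, 1)` in its interior contains `[0,
1]`; unimodularity makes the coordinates of `p'` and `q'` integers. -/
theorem mem_segment_of_collinear {p q c p' q' : ℤ × ℤ} (h : |det3 p q c| = 1)
    (h1 : det3 p q p' = 0) (h2 : det3 p q q' = 0) {x : ℝ × ℝ}
    (hx : x ∈ openSegment ℝ (latticePt p) (latticePt q))
    (hx' : x ∈ openSegment ℝ (latticePt p') (latticePt q')) :
    latticePt p ∈ segment ℝ (latticePt p') (latticePt q') ∧
      latticePt q ∈ segment ℝ (latticePt p') (latticePt q') := by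
  have hD := sq_det_cast h
  -- the affine coordinate on the line `p q`, equal to `0` at `p` and to `1` at `q`
  set D := det3 p q c with hDdef
  have hDZ : D * D = 1 := by exact_mod_cast hD
  have bary : ∀ r : ℤ × ℤ, det3 p q r = 0 →
      latticePt r = (1 - ((D * det3 c p r : ℤ) : ℝ)) • latticePt p +
        ((D * det3 c p r : ℤ) : ℝ) • latticePt q := by
    intro r hr
    have hb := side_barycentric p q c (latticePt r)
    have hs := side_sum p q c (latticePt r)
    simp only [side_latticePt, hr] at hb hs
    have := congrArg (fun y => (D : ℝ) • y) hb
    simp only [smul_add, smul_smul, ← hDdef, hD, Int.cast_zero, zero_smul, one_smul,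
      add_zero] at this
    rw [← this]
    have e : (D : ℝ) * det3 q c r = 1 - ((D * det3 c p r : ℤ) : ℝ) := by
      push_cast
      rw [← hD, hDdef, ← hs]; push_cast; ring
    rw [e]; push_cast; rfl
  have hpq : latticePt p ≠ latticePt q := fun he => (det3_ne h).1 (latticePt_injective he)
  obtain ⟨s, t, hs, ht, hst, rfl⟩ := hx
  obtain ⟨s', t', hs', ht', hst', hx'⟩ := hx'
  set n := D * det3 c p p'
  set n' := D * det3 c p q'
  have b1 : latticePt p' = (1 - (n : ℝ)) • latticePt p + (n : ℝ) • latticePt q := bary p' h1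
  have b2 : latticePt q' = (1 - (n' : ℝ)) • latticePt p + (n' : ℝ) • latticePt q := bary q' h2
  have hval : s' * n + t' * n' = t := by
    rw [b1, b2] at hx'
    have : (s' * n + t' * n' - t) • (latticePt q - latticePt p) = 0 := by
      have hs2 : s' = 1 - t' := by linarith
      have hs3 : s = 1 - t := by linarith
      subst hs2 hs3
      have e : (1 - t') • ((1 - (n : ℝ)) • latticePt p + (n : ℝ) • latticePt q) +
          t' • ((1 - (n' : ℝ)) • latticePt p + (n' : ℝ) • latticePt q) -
          ((1 - t) • latticePt p + t • latticePt q) = 0 := sub_eq_zero.2 hx'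
      rw [← e]; module
    rcases smul_eq_zero.1 this with h0 | h0
    · linarith
    · exact absurd (sub_eq_zero.1 h0).symm hpq
  have hcoord : ∀ θ : ℝ, (1 - θ) • latticePt p' + θ • latticePt q' =
      (1 - ((1 - θ) * n + θ * n')) • latticePt p + ((1 - θ) * n + θ * n') • latticePt q := by
    intro θ; rw [b1, b2]; module
  -- The point has coordinate `t` with `0 < t < 1`, and no integer lies in between, so `n` and `n'`
  -- cannot be on the same side of it.
  have hcase : (n ≤ 0 ∧ 1 ≤ n') ∨ (n' ≤ 0 ∧ 1 ≤ n) := by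
    have ht1 : t < 1 := by linarith
    by_contra! hcon
    obtain ⟨c1, c2⟩ := hcon
    by_cases hn : n ≤ 0
    · have h3 := c1 hn
      have h3' : (n' : ℝ) ≤ 0 := by exact_mod_cast (by omega : n' ≤ 0)
      have hn' : (n : ℝ) ≤ 0 := by exact_mod_cast hn
      nlinarith
    · have h4 : 1 ≤ n' := by by_contra hh; have := c2 (by omega); omega
      have h3' : (1 : ℝ) ≤ n' := by exact_mod_cast h4
      have hn' : (1 : ℝ) ≤ n := by exact_mod_cast (by omega : 1 ≤ n)
      nlinarith
  have hne : (n' : ℝ) - n ≠ 0 := by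
    rw [sub_ne_zero]; exact_mod_cast (by omega : n' ≠ n)
  have hmem : ∀ u : ℝ, 0 ≤ u → u ≤ 1 →
      (1 - u) • latticePt p + u • latticePt q ∈ segment ℝ (latticePt p') (latticePt q') := by
    intro u hu0 hu1
    rw [segment_eq_image]
    refine ⟨(u - n) / (n' - n), ?_, ?_⟩
    · rcases hcase with ⟨g1, g2⟩ | ⟨g1, g2⟩
      · have g1' : (n : ℝ) ≤ 0 := by exact_mod_cast g1
        have g2' : (1 : ℝ) ≤ n' := by exact_mod_cast g2
        exact ⟨div_nonneg (by linarith) (by linarith), (div_le_one (by linarith)).2 (by linarith)⟩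
      · have g1' : (n' : ℝ) ≤ 0 := by exact_mod_cast g1
        have g2' : (1 : ℝ) ≤ n := by exact_mod_cast g2
        refine ⟨div_nonneg_of_nonpos (by linarith) (by linarith), ?_⟩
        rw [div_le_one_of_neg (by linarith)]; linarith
    · simp only [hcoord]
      have : (1 - (u - n) / ((n' : ℝ) - n)) * n + (u - n) / ((n' : ℝ) - n) * n' = u := by
        field_simp; ring
      rw [this]
  constructor
  · simpa using hmem 0 le_rfl zero_le_one
  · simpa using hmem 1 zero_le_one le_rfl

/-- Primitive lattice triangles which do not overlap meet face to face. -/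
theorem latticeHull_inter_eq {V W : Finset (ℤ × ℤ)} (hV : IsPrimitiveTriangle V)
    (hW : IsPrimitiveTriangle W)
    (hVW : ∀ g ∈ genericPts, g ∈ latticeHull V → g ∉ latticeHull W) :
    latticeHull V ∩ latticeHull W = latticeHull (V ∩ W) := by
  refine Subset.antisymm ?_ (subset_inter (latticeHull_mono Finset.inter_subset_left)
    (latticeHull_mono Finset.inter_subset_right))
  rintro x ⟨hxV, hxW⟩
  rcases mem_edge_cases hV hxV with hi | ⟨p, hp, rfl⟩ | ⟨p, hp, q, hq, hpq, hx⟩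
  · obtain ⟨g, hg, h1, h2⟩ := exists_generic_of_interior hW hi hxW
    exact absurd h2 (hVW g hg h1)
  · exact latticePt_mem_latticeHull (Finset.mem_inter.2 ⟨hp, hW.mem_of_latticePt_mem hxW⟩)
  rcases mem_edge_cases hW hxW with hi | ⟨p', hp', rfl⟩ | ⟨p', hp', q', hq', hpq', hx'⟩
  · obtain ⟨g, hg, h1, h2⟩ := exists_generic_of_interior hV hi hxV
    exact absurd h1 (hVW g hg h2)
  · exact latticePt_mem_latticeHull (Finset.mem_inter.2 ⟨hV.mem_of_latticePt_mem hxV, hp'⟩)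
  obtain ⟨c, hc, hd⟩ := hV.exists_third hp hq hpq
  obtain ⟨c', hc', hd'⟩ := hW.exists_third hp' hq' hpq'
  have z := side_eq_zero_of_mem_openSegment hx
  have z' := side_eq_zero_of_mem_openSegment hx'
  -- The edges are parallel: two transversal lines through `x` would bound half-planes with a common
  -- sector, and the triangles would overlap there.
  have hcross : (q.1 - p.1) * (q'.2 - p'.2) - (q.2 - p.2) * (q'.1 - p'.1) = 0 := by
    by_contra hne
    have hne' : ((q.1 : ℝ) - p.1) * (q'.2 - p'.2) - ((q.2 : ℝ) - p.2) * (q'.1 - p'.1) ≠ 0 := by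
      exact_mod_cast hne
    set δ := ((q.1 : ℝ) - p.1) * (q'.2 - p'.2) - ((q.2 : ℝ) - p.2) * (q'.1 - p'.1) with hδ
    set D : ℝ := (det3 p q c : ℝ) with hDd
    set D' : ℝ := (det3 p' q' c' : ℝ) with hDd'
    have hDD : D * D = 1 := sq_det_cast hd
    have hDD' : D' * D' = 1 := sq_det_cast hd'
    -- The direction solves the linear system demanding that `side p q` grow by `D` and `side p' q'`
    -- by `D'`; its determinant is nonzero because the edges are transversal.
    have hv : 0 < D * side p q (x + ((D' * (q.1 - p.1) - D * (q'.1 - p'.1)) / (-δ),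
        (D' * (q.2 - p.2) - D * (q'.2 - p'.2)) / (-δ))) := by
      have : side p q (x + ((D' * (q.1 - p.1) - D * (q'.1 - p'.1)) / (-δ),
          (D' * (q.2 - p.2) - D * (q'.2 - p'.2)) / (-δ))) = side p q x + D := by
        simp only [side, Prod.fst_add, Prod.snd_add]; field_simp; rw [hδ]; ring
      rw [this, z, zero_add, hDD]; norm_num
    have hv' : 0 < D' * side p' q' (x + ((D' * (q.1 - p.1) - D * (q'.1 - p'.1)) / (-δ),
        (D' * (q.2 - p.2) - D * (q'.2 - p'.2)) / (-δ))) := by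
      have : side p' q' (x + ((D' * (q.1 - p.1) - D * (q'.1 - p'.1)) / (-δ),
          (D' * (q.2 - p.2) - D * (q'.2 - p'.2)) / (-δ))) = side p' q' x + D' := by
        simp only [side, Prod.fst_add, Prod.snd_add]; field_simp; rw [hδ]; ring
      rw [this, z', zero_add, hDD']; norm_num
    obtain ⟨g, hg, h1, h2⟩ := exists_generic_of_half_planes hd hd' hx hx' hv hv'
    rw [← hc] at h1; rw [← hc'] at h2; exact hVW g hg h1 h2
  have hcross' : ((q.1 : ℝ) - p.1) * (q'.2 - p'.2) - ((q.2 : ℝ) - p.2) * (q'.1 - p'.1) = 0 := by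
    exact_mod_cast hcross
  have hcol : det3 p q p' = 0 ∧ det3 p q q' = 0 := by
    obtain ⟨s, t, hs, ht, hst, rfl⟩ := hx'
    rw [side_combination hst] at z
    have hd : (det3 p q q' : ℝ) = det3 p q p' := by
      simp only [det3]; push_cast; linear_combination hcross'
    rw [hd, ← add_mul, hst, one_mul] at z
    rw [z] at hd
    exact ⟨by exact_mod_cast z, by exact_mod_cast hd⟩
  obtain ⟨m1, m2⟩ := mem_segment_of_collinear hd hcol.1 hcol.2 hx hx'
  have hsub := segment_subset_latticeHull hp' hq'
  have hpI : p ∈ V ∩ W := Finset.mem_inter.2 ⟨hp, hW.mem_of_latticePt_mem (hsub m1)⟩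
  have hqI : q ∈ V ∩ W := Finset.mem_inter.2 ⟨hq, hW.mem_of_latticePt_mem (hsub m2)⟩
  exact segment_subset_latticeHull hpI hqI (openSegment_subset_segment _ _ _ hx)

/-! ### Piecewise linear functions with lattice break points -/

/-- The height at `x` of the line through the lattice points `p` and `q`. -/
noncomputable def lineThrough (p q : ℤ × ℤ) (x : ℝ) : ℝ :=
  p.2 + ((q.2 : ℝ) - p.2) / ((q.1 : ℝ) - p.1) * (x - p.1)

theorem lineThrough_left (p q : ℤ × ℤ) : lineThrough p q p.1 = p.2 := by simp [lineThrough]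

theorem lineThrough_right {p q : ℤ × ℤ} (h : p.1 < q.1) : lineThrough p q q.1 = q.2 := by
  have : (q.1 : ℝ) - p.1 ≠ 0 := by
    rw [sub_ne_zero]; exact_mod_cast h.ne'
  simp only [lineThrough]; field_simp; ring

theorem side_eq_lineThrough {p q : ℤ × ℤ} (h : p.1 < q.1) (w : ℝ × ℝ) :
    side p q w = ((q.1 : ℝ) - p.1) * (w.2 - lineThrough p q w.1) := by
  have : (q.1 : ℝ) - p.1 ≠ 0 := by
    rw [sub_ne_zero]; exact_mod_cast h.ne'
  simp only [lineThrough, side]; field_simp; ring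

theorem mem_segment_iff_lineThrough {p q : ℤ × ℤ} (h : p.1 < q.1) (w : ℝ × ℝ) :
    w ∈ segment ℝ (latticePt p) (latticePt q) ↔
      (p.1 : ℝ) ≤ w.1 ∧ w.1 ≤ q.1 ∧ w.2 = lineThrough p q w.1 := by
  have h' : (0 : ℝ) < (q.1 : ℝ) - p.1 := by
    rw [sub_pos]; exact_mod_cast h
  constructor
  · rintro ⟨s, t, hs, ht, hst, rfl⟩
    obtain rfl : s = 1 - t := by linarith
    simp only [latticePt, lineThrough, Prod.fst_add, Prod.snd_add, Prod.smul_fst,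
      Prod.smul_snd, smul_eq_mul]
    refine ⟨by nlinarith, by nlinarith, ?_⟩
    field_simp; ring
  · rintro ⟨h1, h2, h3⟩
    rw [segment_eq_image]
    refine ⟨(w.1 - p.1) / ((q.1 : ℝ) - p.1), ⟨div_nonneg (by linarith) h'.le,
      (div_le_one h').2 (by linarith)⟩, ?_⟩
    ext
    · simp only [latticePt, Prod.fst_add, Prod.smul_fst, smul_eq_mul]; field_simp; ring
    · rw [h3]
      simp only [latticePt, lineThrough, Prod.snd_add, Prod.smul_snd, smul_eq_mul]
      field_simp; ring

/-- `f` is piecewise linear on `[l, r]`, its pieces lie on lines through lattice points, and it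
takes integer values at its break points and at `l` and `r`. -/
structure IsLatticePL (l r : ℤ) (f : ℝ → ℝ) : Prop where
  slab : ∀ k : ℤ, l ≤ k → k < r → ∃ p q : ℤ × ℤ, p.1 < q.1 ∧
    ∀ x ∈ Icc (k : ℝ) (k + 1), f x = lineThrough p q x
  inner : ∀ k : ℤ, l < k → k < r → (∃ n : ℤ, f k = n) ∨ f (k - 1) + f (k + 1) = 2 * f k
  left : ∃ n : ℤ, f l = n
  right : ∃ n : ℤ, f r = n

/-- `f` is affine on each of the slabs `[k, k + 1]`, `l ≤ k < r`. -/
def IsSlabAffine (l r : ℤ) (f : ℝ → ℝ) : Prop :=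
  ∀ k : ℤ, l ≤ k → k < r → ∃ α β : ℝ, ∀ x ∈ Icc (k : ℝ) (k + 1), f x = α + β * x

theorem IsLatticePL.isSlabAffine {l r : ℤ} {f : ℝ → ℝ} (hf : IsLatticePL l r f) :
    IsSlabAffine l r f := by
  intro k h1 h2
  obtain ⟨p, q, -, h⟩ := hf.slab k h1 h2
  refine ⟨p.2 - ((q.2 : ℝ) - p.2) / ((q.1 : ℝ) - p.1) * p.1,
    ((q.2 : ℝ) - p.2) / ((q.1 : ℝ) - p.1), fun x hx => ?_⟩
  rw [h x hx, lineThrough]; ring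

theorem IsSlabAffine.sub {l r : ℤ} {f g : ℝ → ℝ} (hf : IsSlabAffine l r f)
    (hg : IsSlabAffine l r g) : IsSlabAffine l r (fun x => f x - g x) := by
  intro k h1 h2
  obtain ⟨α, β, h⟩ := hf k h1 h2
  obtain ⟨α', β', h'⟩ := hg k h1 h2
  exact ⟨α - α', β - β', fun x hx => by simp only [h x hx, h' x hx]; ring⟩

theorem IsSlabAffine.mono {l r l' r' : ℤ} {f : ℝ → ℝ} (hf : IsSlabAffine l r f) (hl : l ≤ l')
    (hr : r' ≤ r) : IsSlabAffine l' r' f :=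
  fun k h1 h2 => hf k (hl.trans h1) (h2.trans_le hr)

theorem IsSlabAffine.continuousOn {l r : ℤ} {f : ℝ → ℝ} (hf : IsSlabAffine l r f) (hlr : l ≤ r) :
    ContinuousOn f (Icc (l : ℝ) r) := by
  have : ∀ k : ℤ, l ≤ k → k ≤ r → ContinuousOn f (Icc (l : ℝ) k) := by
    intro k hk
    induction k, hk using Int.leInduction with
    | base => intro _; simp
    | succ k hk ih =>
      intro hk'
      obtain ⟨α, β, h⟩ := hf k hk (by omega)
      have h2 : ContinuousOn f (Icc (k : ℝ) (k + 1)) :=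
        ContinuousOn.congr (f := fun x => α + β * x) (by fun_prop) h
      have e : Icc (l : ℝ) ((k + 1 : ℤ) : ℝ) = Icc (l : ℝ) k ∪ Icc (k : ℝ) (k + 1) := by
        rw [Icc_union_Icc_eq_Icc (by exact_mod_cast hk) (by linarith)]; push_cast; rfl
      rw [e]
      exact (ih (by omega)).union_of_isClosed h2 isClosed_Icc isClosed_Icc
  exact this r hlr le_rfl

theorem exists_slab {l r : ℤ} {x : ℝ} (hlr : l < r) (h1 : (l : ℝ) ≤ x) (h2 : x ≤ r) :
    ∃ k : ℤ, l ≤ k ∧ k < r ∧ x ∈ Icc (k : ℝ) (k + 1) := by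
  by_cases hx : x = r
  · exact ⟨r - 1, by omega, by omega, by subst hx; push_cast; constructor <;> linarith⟩
  · refine ⟨⌊x⌋, Int.le_floor.2 h1, ?_, Int.floor_le x, (Int.lt_floor_add_one x).le⟩
    exact Int.floor_lt.2 (lt_of_le_of_ne h2 hx)

/-- A nonnegative affine function on an interval which vanishes inside vanishes throughout. -/
theorem IsSlabAffine.eq_zero_on_slab {l r : ℤ} {h : ℝ → ℝ} (hh : IsSlabAffine l r h) {k : ℤ}
    (hlk : l ≤ k) (hkr : k < r) (h0 : ∀ x ∈ Icc (k : ℝ) (k + 1), 0 ≤ h x) {x₀ : ℝ}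
    (hx₀ : x₀ ∈ Ioo (k : ℝ) (k + 1)) (hz : h x₀ = 0) : ∀ x ∈ Icc (k : ℝ) (k + 1), h x = 0 := by
  obtain ⟨α, β, e⟩ := hh k hlk hkr
  have m1 : (k : ℝ) ∈ Icc (k : ℝ) (k + 1) := ⟨le_rfl, by linarith⟩
  have m2 : (k : ℝ) + 1 ∈ Icc (k : ℝ) (k + 1) := ⟨by linarith, le_rfl⟩
  have a1 := h0 _ m1
  have a2 := h0 _ m2
  rw [e _ m1] at a1
  rw [e _ m2] at a2
  rw [e _ ⟨hx₀.1.le, hx₀.2.le⟩] at hz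
  have hβ : β = 0 := by
    rcases lt_trichotomy β 0 with hb | hb | hb
    · nlinarith [hx₀.2]
    · exact hb
    · nlinarith [hx₀.1]
  intro x hx
  rw [e x hx]; subst hβ; linarith

theorem IsSlabAffine.eq_zero_of_ends {l r : ℤ} {h : ℝ → ℝ} (hh : IsSlabAffine l r h) {k : ℤ}
    (hlk : l ≤ k) (hkr : k < r) (h1 : h k = 0) (h2 : h (k + 1) = 0) :
    ∀ x ∈ Icc (k : ℝ) (k + 1), h x = 0 := by
  obtain ⟨α, β, e⟩ := hh k hlk hkr
  rw [e _ ⟨le_rfl, by linarith⟩] at h1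
  rw [e _ ⟨by linarith, le_rfl⟩] at h2
  have hβ : β = 0 := by linarith
  intro x hx
  rw [e x hx]; subst hβ; linarith

/-- A nonnegative function which is affine on slabs and, at its integer zeros, has no break
vanishes nowhere in the interior or everywhere. -/
theorem IsSlabAffine.touch {l r : ℤ} {h : ℝ → ℝ} (hh : IsSlabAffine l r h) (hlr : l < r)
    (h0 : ∀ x ∈ Icc (l : ℝ) r, 0 ≤ h x)
    (hb : ∀ k : ℤ, l < k → k < r → h k = 0 → h (k - 1) + h (k + 1) = 0) :
    (∀ x ∈ Ioo (l : ℝ) r, h x ≠ 0) ∨ ∀ x ∈ Icc (l : ℝ) r, h x = 0 := by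
  by_contra! hcon
  obtain ⟨⟨x₀, hx₀, hz⟩, x₁, hx₁, hnz⟩ := hcon
  apply hnz
  have hsub : ∀ k : ℤ, l ≤ k → k < r → ∀ x ∈ Icc (k : ℝ) (k + 1), 0 ≤ h x := by
    intro k h1 h2 x hx
    have h1' : (l : ℝ) ≤ k := by exact_mod_cast h1
    have h2' : (k : ℝ) + 1 ≤ r := by exact_mod_cast h2
    exact h0 x ⟨h1'.trans hx.1, hx.2.trans h2'⟩
  have hbb : ∀ k : ℤ, l < k → k < r → h k = 0 → h ((k - 1 : ℤ) : ℝ) = 0 ∧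
      h ((k : ℝ) + 1) = 0 := by
    intro k h1 h2 h3
    have e := hb k h1 h2 h3
    have p1 := hsub (k - 1) (by omega) (by omega) ((k - 1 : ℤ) : ℝ) ⟨le_rfl, by linarith⟩
    have p2 := hsub k h1.le h2 ((k : ℝ) + 1) ⟨by linarith, le_rfl⟩
    push_cast at p1 ⊢
    constructor <;> linarith
  -- One inner zero annihilates a whole slab: inside a slab by affinity and nonnegativity, at an
  -- integer because both neighbouring values are nonnegative with sum `0`.
  have hslab : ∃ k : ℤ, l ≤ k ∧ k < r ∧ ∀ x ∈ Icc (k : ℝ) (k + 1), h x = 0 := by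
    obtain ⟨k, hk1, hk2, hk3⟩ := exists_slab hlr hx₀.1.le hx₀.2.le
    rcases hk3.1.eq_or_lt with e | e
    · rw [← e] at hz hx₀
      have := hbb k (by exact_mod_cast hx₀.1) hk2 hz
      exact ⟨k, hk1, hk2, hh.eq_zero_of_ends hk1 hk2 hz this.2⟩
    rcases hk3.2.eq_or_lt with e' | e'
    · rw [e'] at hz hx₀
      have hr : k + 1 < r := by exact_mod_cast hx₀.2
      have := hbb (k + 1) (by omega) hr (by push_cast; exact hz)
      refine ⟨k, hk1, hk2, hh.eq_zero_of_ends hk1 hk2 ?_ hz⟩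
      simpa using this.1
    · exact ⟨k, hk1, hk2, hh.eq_zero_on_slab hk1 hk2 (hsub k hk1 hk2) ⟨e, e'⟩ hz⟩
  obtain ⟨k, hk1, hk2, hk⟩ := hslab
  -- The zero slab spreads in both directions, since `h` has no break at an inner integer zero.
  have up : ∀ j : ℤ, k ≤ j → j < r → ∀ x ∈ Icc (j : ℝ) (j + 1), h x = 0 := by
    intro j hj
    induction j, hj using Int.leInduction with
    | base => intro _; exact hk
    | succ j hj ih =>
      intro hjr
      have z := ih (by omega) ((j : ℝ) + 1) ⟨by linarith, le_rfl⟩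
      have z' : h ((j + 1 : ℤ) : ℝ) = 0 := by push_cast; exact z
      exact hh.eq_zero_of_ends (by omega) hjr z' (hbb (j + 1) (by omega) hjr z').2
  have down : ∀ j : ℤ, j ≤ k → l ≤ j → ∀ x ∈ Icc (j : ℝ) (j + 1), h x = 0 := by
    intro j hj
    induction j, hj using Int.leInductionDown with
    | base => intro _; exact hk
    | pred j hj ih =>
      intro hlj
      have z := ih (by omega) (j : ℝ) ⟨le_rfl, by linarith⟩
      have := (hbb j (by omega) (by omega) z).1
      refine hh.eq_zero_of_ends hlj (by omega) this ?_
      push_cast; rw [sub_add_cancel]; exact z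
  obtain ⟨j, hj1, hj2, hj3⟩ := exists_slab hlr hx₁.1 hx₁.2
  rcases le_total k j with hkj | hkj
  · exact up j hkj hj2 _ hj3
  · exact down j hkj hj1 _ hj3

/-- A function which is affine on slabs, has no breaks and vanishes at both ends is zero. -/
theorem IsSlabAffine.eq_zero_of_no_break {m : ℕ} (hm : 0 < m) {h : ℝ → ℝ}
    (hh : IsSlabAffine 0 m h)
    (hb : ∀ k : ℤ, 0 < k → k < m → h (k - 1) + h (k + 1) = 2 * h k) (h0 : h 0 = 0)
    (h1 : h m = 0) : ∀ x ∈ Icc (0 : ℝ) m, h x = 0 := by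
  -- Without breaks, the values at the integers form an arithmetic progression starting at `0`.
  have key : ∀ k : ℕ, k + 1 ≤ m → h k = k * h 1 ∧ h (k + 1) = (k + 1) * h 1 := by
    intro k
    induction k with
    | zero => intro _; simp [h0]
    | succ k ih =>
      intro hk
      obtain ⟨i1, i2⟩ := ih (by omega)
      have := hb (k + 1) (by omega) (by omega)
      push_cast at this ⊢
      rw [add_sub_cancel_right, i1, i2] at this
      exact ⟨i2, by linarith⟩
  have hone : h 1 = 0 := by
    obtain ⟨n, rfl⟩ := Nat.exists_eq_add_of_le' hm
    have := (key n (by omega)).2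
    push_cast at h1
    rw [h1] at this
    rcases mul_eq_zero.1 this.symm with h' | h'
    · exact absurd h' (by positivity)
    · exact h'
  intro x hx
  obtain ⟨k, k1, k2, k3⟩ := exists_slab (l := 0) (r := m) (x := x) (by exact_mod_cast hm)
    (by simpa using hx.1) (by simpa using hx.2)
  obtain ⟨n, rfl⟩ := Int.eq_ofNat_of_zero_le k1
  obtain ⟨i1, i2⟩ := key n (by omega)
  rw [hone, mul_zero] at i1 i2
  exact hh.eq_zero_of_ends k1 k2 (by exact_mod_cast i1) (by exact_mod_cast i2) x k3

/-- A vertical segment contained in a graph has equal endpoints, which is excluded, so the segment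
through `(x, φ x)` can be oriented from left to right. -/
theorem IsAdmissibleFun.exists_edge {m : ℕ} {φ : ℝ → ℝ} (hφ : IsAdmissibleFun m φ) {x : ℝ}
    (hx : x ∈ Icc (0 : ℝ) m) : ∃ p q : ℤ × ℤ, p.1 < q.1 ∧ 0 ≤ p.1 ∧ q.1 ≤ m ∧
      (p.1 : ℝ) ≤ x ∧ x ≤ q.1 ∧ ∀ y ∈ Icc (p.1 : ℝ) q.1, φ y = lineThrough p q y := by
  obtain ⟨-, E, hE, hg⟩ := hφ
  have hmem : (x, φ x) ∈ graphOver m φ := ⟨hx.1, hx.2, rfl⟩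
  rw [hg] at hmem
  simp only [mem_iUnion] at hmem
  obtain ⟨e, he, hxe⟩ := hmem
  have hsub : segment ℝ (latticePt e.1) (latticePt e.2) ⊆ graphOver m φ := by
    rw [hg]; exact subset_biUnion_of_mem (u := fun e : (ℤ × ℤ) × (ℤ × ℤ) =>
      segment ℝ (latticePt e.1) (latticePt e.2)) he
  have key : ∀ p q : ℤ × ℤ, p.1 < q.1 → segment ℝ (latticePt p) (latticePt q) ⊆ graphOver m φ →
      (x, φ x) ∈ segment ℝ (latticePt p) (latticePt q) → ∃ p q : ℤ × ℤ, p.1 < q.1 ∧ 0 ≤ p.1 ∧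
      q.1 ≤ m ∧ (p.1 : ℝ) ≤ x ∧ x ≤ q.1 ∧ ∀ y ∈ Icc (p.1 : ℝ) q.1, φ y = lineThrough p q y := by
    intro p q hpq hs hxs
    have h1 : (0 : ℝ) ≤ (p.1 : ℝ) := (hs (left_mem_segment ℝ _ _)).1
    have h2 : (q.1 : ℝ) ≤ m := (hs (right_mem_segment ℝ _ _)).2.1
    have h3 := (mem_segment_iff_lineThrough hpq _).1 hxs
    refine ⟨p, q, hpq, by exact_mod_cast h1, by exact_mod_cast h2, h3.1, h3.2.1, fun y hy => ?_⟩
    exact (hs ((mem_segment_iff_lineThrough hpq (y, lineThrough p q y)).2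
      ⟨hy.1, hy.2, rfl⟩)).2.2.symm
  rcases lt_trichotomy e.1.1 e.2.1 with h | h | h
  · exact key _ _ h hsub hxe
  · exfalso
    have h1 := (hsub (left_mem_segment ℝ _ _)).2.2
    have h2 := (hsub (right_mem_segment ℝ _ _)).2.2
    simp only [latticePt] at h1 h2
    rw [h, ← h2] at h1
    exact hE e he (Prod.ext h (by exact_mod_cast h1))
  · rw [segment_symm] at hsub hxe
    exact key _ _ h hsub hxe

/-- An edge has integer end abscissas. The edge over the midpoint of a slab thus covers the slab,
and the edge over an inner integer either ends there, at an integer height, or passes through it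
without a break. -/
theorem IsAdmissibleFun.isLatticePL {m : ℕ} {φ : ℝ → ℝ}
    (hφ : IsAdmissibleFun m φ) : IsLatticePL 0 m φ := by
  have ends : ∀ {p q : ℤ × ℤ}, p.1 < q.1 → (∀ y ∈ Icc (p.1 : ℝ) q.1, φ y = lineThrough p q y) →
      φ p.1 = p.2 ∧ φ q.1 = q.2 := by
    intro p q h hy
    have h' : (p.1 : ℝ) ≤ q.1 := by exact_mod_cast h.le
    rw [hy _ ⟨le_rfl, h'⟩, hy _ ⟨h', le_rfl⟩]
    exact ⟨lineThrough_left p q, lineThrough_right h⟩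
  refine ⟨fun k h1 h2 => ?_, fun k h1 h2 => ?_, ?_, ?_⟩
  · have h1' : (0 : ℝ) ≤ k := by exact_mod_cast h1
    have h2' : (k : ℝ) + 1 ≤ m := by exact_mod_cast h2
    obtain ⟨p, q, hpq, -, -, hp, hq, hy⟩ :=
      hφ.exists_edge (x := k + 1 / 2) ⟨by linarith, by linarith⟩
    refine ⟨p, q, hpq, fun x hx => hy x ⟨?_, ?_⟩⟩
    · have : p.1 < k + 1 := by
        have : (p.1 : ℝ) < k + 1 := by linarith
        exact_mod_cast this
      have : (p.1 : ℝ) ≤ k := by exact_mod_cast (by omega : p.1 ≤ k)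
      exact this.trans hx.1
    · have : k < q.1 := by
        have : (k : ℝ) < q.1 := by linarith
        exact_mod_cast this
      have : (k : ℝ) + 1 ≤ q.1 := by exact_mod_cast (by omega : k + 1 ≤ q.1)
      exact hx.2.trans this
  · have h1' : (0 : ℝ) ≤ k := by exact_mod_cast h1.le
    have h2' : (k : ℝ) ≤ m := by exact_mod_cast h2.le
    obtain ⟨p, q, hpq, -, -, hp, hq, hy⟩ := hφ.exists_edge (x := k) ⟨h1', h2'⟩
    have hp' : p.1 ≤ k := by exact_mod_cast hp
    have hq' : k ≤ q.1 := by exact_mod_cast hq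
    obtain ⟨e1, e2⟩ := ends hpq hy
    rcases hp'.eq_or_lt with rfl | hp'
    · exact Or.inl ⟨_, e1⟩
    rcases hq'.eq_or_lt with rfl | hq'
    · exact Or.inl ⟨_, e2⟩
    right
    have hp2 : (p.1 : ℝ) ≤ k - 1 := by exact_mod_cast (by omega : p.1 ≤ k - 1)
    have hq2 : (k : ℝ) + 1 ≤ q.1 := by exact_mod_cast (by omega : k + 1 ≤ q.1)
    rw [hy _ ⟨hp2, by linarith⟩, hy _ ⟨hp, hq⟩, hy _ ⟨by linarith, hq2⟩]
    simp only [lineThrough]; ring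
  · obtain ⟨p, q, hpq, hp0, -, hp, hq, hy⟩ := hφ.exists_edge (x := 0) ⟨le_rfl, by positivity⟩
    have : p.1 = 0 := le_antisymm (by exact_mod_cast hp) hp0
    exact ⟨p.2, by have := (ends hpq hy).1; simp_all⟩
  · obtain ⟨p, q, hpq, -, hq0, hp, hq, hy⟩ := hφ.exists_edge (x := m) ⟨by positivity, le_rfl⟩
    have : q.1 = m := le_antisymm hq0 (by exact_mod_cast hq)
    exact ⟨q.2, by have := (ends hpq hy).2; simp_all⟩

/-! ### Regions between graphs, and triangulations as tilings of generic points -/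

/-- The region over `[l, r]` between the graphs of `lo` and `up`. -/
def regionBetweenGraphs (l r : ℤ) (lo up : ℝ → ℝ) : Set (ℝ × ℝ) :=
  {p | (l : ℝ) ≤ p.1 ∧ p.1 ≤ r ∧ lo p.1 ≤ p.2 ∧ p.2 ≤ up p.1}

theorem stripRegion_eq (m : ℕ) (lo up : ℝ → ℝ) :
    stripRegion m lo up = regionBetweenGraphs 0 m lo up := by
  simp [stripRegion, regionBetweenGraphs]

theorem isClosed_regionBetweenGraphs {l r : ℤ} {lo up : ℝ → ℝ}
    (hlo : ContinuousOn lo (Icc (l : ℝ) r)) (hup : ContinuousOn up (Icc (l : ℝ) r)) :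
    IsClosed (regionBetweenGraphs l r lo up) := by
  have hs : IsClosed {p : ℝ × ℝ | p.1 ∈ Icc (l : ℝ) r} := isClosed_Icc.preimage continuous_fst
  have c1 : ContinuousOn (fun p : ℝ × ℝ => p.2 - lo p.1) {p : ℝ × ℝ | p.1 ∈ Icc (l : ℝ) r} :=
    continuousOn_snd.sub (hlo.comp continuousOn_fst fun p hp => hp)
  have c2 : ContinuousOn (fun p : ℝ × ℝ => up p.1 - p.2) {p : ℝ × ℝ | p.1 ∈ Icc (l : ℝ) r} :=
    (hup.comp continuousOn_fst fun p hp => hp).sub continuousOn_snd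
  have := (c1.preimage_isClosed_of_isClosed hs (isClosed_Ici (a := 0))).inter
    (c2.preimage_isClosed_of_isClosed hs (isClosed_Ici (a := 0)))
  convert this using 1
  ext p
  simp only [regionBetweenGraphs, mem_ofPred_eq, mem_inter_iff, mem_preimage, mem_Ici, mem_Icc,
    sub_nonneg]
  tauto

theorem isOpen_strictRegion {l r : ℤ} {lo up : ℝ → ℝ}
    (hlo : ContinuousOn lo (Icc (l : ℝ) r)) (hup : ContinuousOn up (Icc (l : ℝ) r)) :
    IsOpen {p : ℝ × ℝ | (l : ℝ) < p.1 ∧ p.1 < r ∧ lo p.1 < p.2 ∧ p.2 < up p.1} := by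
  have hs : IsOpen {p : ℝ × ℝ | p.1 ∈ Ioo (l : ℝ) r} := isOpen_Ioo.preimage continuous_fst
  have c1 : ContinuousOn (fun p : ℝ × ℝ => p.2 - lo p.1) {p : ℝ × ℝ | p.1 ∈ Ioo (l : ℝ) r} :=
    continuousOn_snd.sub (hlo.comp continuousOn_fst fun p hp => Ioo_subset_Icc_self hp)
  have c2 : ContinuousOn (fun p : ℝ × ℝ => up p.1 - p.2) {p : ℝ × ℝ | p.1 ∈ Ioo (l : ℝ) r} :=
    (hup.comp continuousOn_fst fun p hp => Ioo_subset_Icc_self hp).sub continuousOn_snd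
  have := (c1.isOpen_inter_preimage hs (isOpen_Ioi (a := 0))).inter
    (c2.isOpen_inter_preimage hs (isOpen_Ioi (a := 0)))
  convert this using 1
  ext p
  simp only [mem_ofPred_eq, mem_inter_iff, mem_preimage, mem_Ioi, mem_Ioo, sub_pos]
  tauto

theorem mem_interior_regionBetweenGraphs {l r : ℤ} {lo up : ℝ → ℝ}
    (hlo : ContinuousOn lo (Icc (l : ℝ) r)) (hup : ContinuousOn up (Icc (l : ℝ) r)) {p : ℝ × ℝ}
    (h1 : (l : ℝ) < p.1) (h2 : p.1 < r) (h3 : lo p.1 < p.2) (h4 : p.2 < up p.1) :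
    p ∈ interior (regionBetweenGraphs l r lo up) :=
  mem_interior.2 ⟨_, fun _ h => ⟨h.1.le, h.2.1.le, h.2.2.1.le, h.2.2.2.le⟩,
    isOpen_strictRegion hlo hup, ⟨h1, h2, h3, h4⟩⟩

theorem generic_fst_ne {g : ℝ × ℝ} (hg : g ∈ genericPts) (k : ℤ) : g.1 ≠ k := by
  intro h
  apply hg (k, 0) (k, 1) (by simp)
  simp [side, h]

/-- The pieces of the graph lie on lines through lattice points, which generic points avoid. -/
theorem IsLatticePL.generic_ne {l r : ℤ} {f : ℝ → ℝ} (hf : IsLatticePL l r f) (hlr : l < r)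
    {g : ℝ × ℝ} (hg : g ∈ genericPts) (h1 : (l : ℝ) ≤ g.1) (h2 : g.1 ≤ r) : g.2 ≠ f g.1 := by
  obtain ⟨k, k1, k2, k3⟩ := exists_slab hlr h1 h2
  obtain ⟨p, q, hpq, h⟩ := hf.slab k k1 k2
  intro he
  apply hg p q (fun h => by rw [h] at hpq; exact lt_irrefl _ hpq)
  rw [side_eq_lineThrough hpq, he, h _ k3, sub_self, mul_zero]

theorem generic_mem_interior_regionBetweenGraphs {l r : ℤ} {lo up : ℝ → ℝ} (hlr : l < r)
    (hlo : IsLatticePL l r lo) (hup : IsLatticePL l r up) {g : ℝ × ℝ} (hg : g ∈ genericPts)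
    (hgm : g ∈ regionBetweenGraphs l r lo up) : g ∈ interior (regionBetweenGraphs l r lo up) := by
  obtain ⟨h1, h2, h3, h4⟩ := hgm
  exact mem_interior_regionBetweenGraphs (hlo.isSlabAffine.continuousOn hlr.le)
    (hup.isSlabAffine.continuousOn hlr.le) (h1.lt_of_ne' (generic_fst_ne hg l))
    (h2.lt_of_ne (generic_fst_ne hg r)) (h3.lt_of_ne' (hlo.generic_ne hlr hg h1 h2))
    (h4.lt_of_ne (hup.generic_ne hlr hg h1 h2))

/-- The primitive triangles in `T` partition the generic points of `P`. -/
structure IsGenericTiling (P : Set (ℝ × ℝ)) (T : Finset (Finset (ℤ × ℤ))) : Prop where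
  primitive : ∀ V ∈ T, IsPrimitiveTriangle V
  subset : ∀ V ∈ T, ∀ g ∈ genericPts, g ∈ latticeHull V → g ∈ P
  cover : ∀ g ∈ genericPts, g ∈ P → ∃ V ∈ T, g ∈ latticeHull V
  unique : ∀ V ∈ T, ∀ W ∈ T, ∀ g ∈ genericPts, g ∈ latticeHull V → g ∈ latticeHull W → V = W

theorem IsPrimitiveTriangulation.eq_of_generic {P : Set (ℝ × ℝ)} {T : Finset (Finset (ℤ × ℤ))}
    (hT : IsPrimitiveTriangulation P T) {V W : Finset (ℤ × ℤ)} (hV : V ∈ T) (hW : W ∈ T)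
    {g : ℝ × ℝ} (hg : g ∈ genericPts) (hgV : g ∈ latticeHull V) (hgW : g ∈ latticeHull W) :
    V = W := by
  by_contra hne
  refine generic_notMem_inter (hT.1 V hV) (hT.1 W hW) hne hg ?_
  rw [← hT.2.1 V hV W hW]; exact ⟨hgV, hgW⟩

theorem IsPrimitiveTriangulation.latticeHull_subset {P : Set (ℝ × ℝ)}
    {T : Finset (Finset (ℤ × ℤ))} (hT : IsPrimitiveTriangulation P T) {V : Finset (ℤ × ℤ)}
    (hV : V ∈ T) : latticeHull V ⊆ closure (interior P) := by
  rw [← hT.2.2]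
  exact subset_biUnion_of_mem (u := fun V => latticeHull V) (Finset.mem_coe.2 hV)

/-- From right to left, triangles without a common generic point meet face to face, and the equality
of closed sets follows from equality on the dense set of generic points. It replaces the topology in
the definition by a partition, which is stable under adding and deleting tiles. -/
theorem isPrimitiveTriangulation_iff {P : Set (ℝ × ℝ)} (hcl : IsClosed P)
    (hgen : ∀ g ∈ genericPts, g ∈ P → g ∈ interior P) (T : Finset (Finset (ℤ × ℤ))) :
    IsPrimitiveTriangulation P T ↔ IsGenericTiling P T := by
  constructor
  · intro hT
    refine ⟨hT.1, fun V hV g _ hgV => ?_, fun g hg hgP => ?_,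
      fun V hV W hW g hg hgV hgW => hT.eq_of_generic hV hW hg hgV hgW⟩
    · exact closure_minimal interior_subset hcl (hT.latticeHull_subset hV hgV)
    · have := subset_closure (hgen g hg hgP)
      rw [← hT.2.2] at this
      simpa using this
  · intro hT
    refine ⟨hT.primitive, fun V hV W hW => ?_, Subset.antisymm ?_ ?_⟩
    · by_cases h : V = W
      · subst h; simp
      · exact latticeHull_inter_eq (hT.primitive V hV) (hT.primitive W hW)
          fun g hg h1 h2 => h (hT.unique V hV W hW g hg h1 h2)
    · refine iUnion₂_subset fun V hV => ?_
      refine (latticeHull_subset_closure (hT.primitive V hV)).trans (closure_mono ?_)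
      exact fun g hg => hgen g hg.1 (hT.subset V hV g hg.1 hg.2)
    · have hc : IsClosed (⋃ V ∈ T, latticeHull V) :=
        T.finite_toSet.isClosed_biUnion fun V _ => isClosed_latticeHull V
      refine closure_minimal ?_ hc
      refine (dense_genericPts.open_subset_closure_inter isOpen_interior).trans
        (closure_minimal ?_ hc)
      rintro g ⟨h1, h2⟩
      obtain ⟨V, hV, hgV⟩ := hT.cover g h2 (interior_subset h1)
      exact mem_biUnion (t := fun V => latticeHull V) (Finset.mem_coe.2 hV) hgV

/-! ### Primitive triangles as regions between graphs -/

/-- `Q` is the region over `[l, r]` between the graphs of the lattice functions `lo` and `up`,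
which may meet only at the ends. -/
structure IsLatticeRegion (Q : Set (ℝ × ℝ)) (l r : ℤ) (lo up : ℝ → ℝ) : Prop where
  lt : l < r
  lower : IsLatticePL l r lo
  upper : IsLatticePL l r up
  lower_lt_upper : ∀ x ∈ Ioo (l : ℝ) r, lo x < up x
  lower_le_upper : ∀ x ∈ Icc (l : ℝ) r, lo x ≤ up x
  eq : Q = regionBetweenGraphs l r lo up

theorem isLatticePL_lineThrough {a c : ℤ × ℤ} (h : a.1 < c.1) :
    IsLatticePL a.1 c.1 (lineThrough a c) :=
  ⟨fun _ _ _ => ⟨a, c, h, fun _ _ => rfl⟩,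
    fun k _ _ => Or.inr (by simp only [lineThrough]; ring),
    ⟨a.2, lineThrough_left a c⟩, ⟨c.2, lineThrough_right h⟩⟩

theorem lineThrough_comm {a b : ℤ × ℤ} (h : a.1 < b.1) : lineThrough b a = lineThrough a b := by
  have h1 : (b.1 : ℝ) - a.1 ≠ 0 := by
    rw [sub_ne_zero]; exact_mod_cast h.ne'
  have h2 : (a.1 : ℝ) - b.1 ≠ 0 := by
    rw [sub_ne_zero]; exact_mod_cast h.ne
  funext x
  simp only [lineThrough]; field_simp; ring

/-- The function whose graph is the path `a b c`. -/
noncomputable def bentLine (a b c : ℤ × ℤ) (x : ℝ) : ℝ :=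
  if x ≤ b.1 then lineThrough b a x else lineThrough b c x

theorem bentLine_of_le {a b c : ℤ × ℤ} {x : ℝ} (h : x ≤ b.1) :
    bentLine a b c x = lineThrough b a x := if_pos h

theorem bentLine_of_ge {a b c : ℤ × ℤ} {x : ℝ} (h : (b.1 : ℝ) ≤ x) :
    bentLine a b c x = lineThrough b c x := by
  rcases h.eq_or_lt with rfl | h
  · rw [bentLine_of_le le_rfl, lineThrough_left, lineThrough_left]
  · exact if_neg (not_le.2 h)

theorem bentLine_left {a b c : ℤ × ℤ} (h : a.1 < b.1) : bentLine a b c a.1 = a.2 := by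
  rw [bentLine_of_le (by exact_mod_cast h.le), lineThrough_comm h, lineThrough_left]

theorem bentLine_mid {a b c : ℤ × ℤ} : bentLine a b c b.1 = b.2 := by
  rw [bentLine_of_le le_rfl, lineThrough_left]

theorem bentLine_right {a b c : ℤ × ℤ} (h : b.1 < c.1) : bentLine a b c c.1 = c.2 := by
  rw [bentLine_of_ge (by exact_mod_cast h.le), lineThrough_right h]

/-- Equal abscissas are allowed so as to cover triangles with a vertical side. On the interval, a
degenerate branch then matters at most at `b.1`, where `lineThrough` has height `b.2` despite the
zero denominator. -/
theorem isLatticePL_bentLine {a b c : ℤ × ℤ} (hab : a.1 ≤ b.1) (hbc : b.1 ≤ c.1) :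
    IsLatticePL a.1 c.1 (bentLine a b c) := by
  refine ⟨fun k h1 h2 => ?_, fun k h1 h2 => ?_, ?_, ?_⟩
  · rcases lt_or_ge k b.1 with hk | hk
    · have hk' : (k : ℝ) + 1 ≤ b.1 := by exact_mod_cast hk
      have h : a.1 < b.1 := by omega
      exact ⟨a, b, h, fun x hx => by
        rw [bentLine_of_le (hx.2.trans hk'), lineThrough_comm h]⟩
    · have hk' : (b.1 : ℝ) ≤ k := by exact_mod_cast hk
      exact ⟨b, c, by omega, fun x hx => bentLine_of_ge (hk'.trans hx.1)⟩
  · rcases lt_trichotomy k b.1 with hk | rfl | hk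
    · right
      have hk' : (k : ℝ) + 1 ≤ b.1 := by exact_mod_cast hk
      rw [bentLine_of_le hk', bentLine_of_le (by linarith), bentLine_of_le (by linarith)]
      simp only [lineThrough]; ring
    · exact Or.inl ⟨b.2, bentLine_mid⟩
    · right
      have hk' : (b.1 : ℝ) ≤ k - 1 := by exact_mod_cast (by omega : b.1 ≤ k - 1)
      rw [bentLine_of_ge hk', bentLine_of_ge (by linarith), bentLine_of_ge (by linarith)]
      simp only [lineThrough]; ring
  · rcases hab.eq_or_lt with h | h
    · rw [h]; exact ⟨b.2, bentLine_mid⟩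
    · exact ⟨a.2, bentLine_left h⟩
  · rcases hbc.eq_or_lt with h | h
    · rw [← h]; exact ⟨b.2, bentLine_mid⟩
    · exact ⟨c.2, bentLine_right h⟩

/-- With vertices ordered by abscissa, the triangle lies between the chord `a c` and the path `a b
c`; the sign of the determinant tells which of them is on top. -/
theorem mem_latticeHull_iff_bentLine {a b c : ℤ × ℤ} (h : |det3 a b c| = 1) (hab : a.1 ≤ b.1)
    (hbc : b.1 ≤ c.1) (w : ℝ × ℝ) : w ∈ latticeHull {a, b, c} ↔ (a.1 : ℝ) ≤ w.1 ∧ w.1 ≤ c.1 ∧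
      0 ≤ (det3 a b c : ℝ) * (w.2 - bentLine a b c w.1) ∧
      0 ≤ (det3 a b c : ℝ) * (lineThrough a c w.1 - w.2) := by
  have hac : a.1 < c.1 := by
    refine lt_of_le_of_ne (hab.trans hbc) fun he => ?_
    have : b.1 = a.1 := by omega
    simp [det3, this, he] at h
  rw [mem_latticeHull_iff h]
  have hab' : (0 : ℝ) ≤ b.1 - a.1 := by rw [sub_nonneg]; exact_mod_cast hab
  have hbc' : (0 : ℝ) ≤ c.1 - b.1 := by rw [sub_nonneg]; exact_mod_cast hbc
  have hac' : (0 : ℝ) < c.1 - a.1 := by rw [sub_pos]; exact_mod_cast hac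
  have hDD := sq_det_cast h
  have hbary := congrArg Prod.fst (side_barycentric a b c w)
  have hsum := side_sum a b c w
  simp only [Prod.fst_add, Prod.smul_fst, smul_eq_mul, latticePt] at hbary
  set D : ℝ := (det3 a b c : ℝ) with hD
  have hDval : D = ((b.1 : ℝ) - a.1) * (c.2 - a.2) - ((b.2 : ℝ) - a.2) * (c.1 - a.1) := by
    rw [hD, det3]; push_cast; ring
  have hchord : D * side c a w = ((c.1 : ℝ) - a.1) * (D * (lineThrough a c w.1 - w.2)) := by
    rw [side_swap, side_eq_lineThrough hac]; ring
  have hleft : a.1 < b.1 →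
      D * side a b w = ((b.1 : ℝ) - a.1) * (D * (w.2 - lineThrough b a w.1)) := by
    intro h; rw [lineThrough_comm h, side_eq_lineThrough h]; ring
  have hright : b.1 < c.1 →
      D * side b c w = ((c.1 : ℝ) - b.1) * (D * (w.2 - lineThrough b c w.1)) := by
    intro h; rw [side_eq_lineThrough h]; ring
  -- On either side of `b` only one branch of the path is tested; this identity recovers the sign of
  -- the other `side`.
  have hid : ((b.1 : ℝ) - a.1) * side b c w = (c.1 - b.1) * side a b w + (b.1 - w.1) * D := by
    rw [hDval]; simp only [side]; ring
  constructor
  · rintro ⟨h1, h2, h3⟩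
    have hx1 : (a.1 : ℝ) ≤ w.1 := by
      -- The first coordinate of the barycentric expansion, measured from `a`.
      have : w.1 - a.1 = (D * side c a w) * (b.1 - a.1) + (D * side a b w) * (c.1 - a.1) := by
        linear_combination (-w.1 + a.1) * hDD - D * hbary + D * a.1 * hsum
      nlinarith [mul_nonneg h2 hab', mul_nonneg h3 hac'.le]
    have hx2 : w.1 ≤ c.1 := by
      have : c.1 - w.1 = (D * side b c w) * (c.1 - a.1) + (D * side c a w) * (c.1 - b.1) := by
        linear_combination (w.1 - c.1) * hDD + D * hbary - D * c.1 * hsum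
      nlinarith [mul_nonneg h1 hac'.le, mul_nonneg h2 hbc']
    refine ⟨hx1, hx2, ?_, ?_⟩
    · rcases le_or_gt w.1 b.1 with hxb | hxb
      · rcases hab.eq_or_lt with e | e
        · have e' : (b.1 : ℝ) = w.1 := le_antisymm (by rw [← e]; exact hx1) hxb
          rw [bentLine_of_ge e'.le]
          rw [hright (by omega)] at h1
          exact nonneg_of_mul_nonneg_right h1
            (by rw [sub_pos]; exact_mod_cast (by omega : b.1 < c.1))
        · rw [bentLine_of_le hxb]
          rw [hleft e] at h3
          exact nonneg_of_mul_nonneg_right h3 (by rw [sub_pos]; exact_mod_cast e)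
      · have e : b.1 < c.1 := by exact_mod_cast hxb.trans_le hx2
        rw [bentLine_of_ge hxb.le]
        rw [hright e] at h1
        exact nonneg_of_mul_nonneg_right h1 (by rw [sub_pos]; exact_mod_cast e)
    · rw [hchord] at h2
      exact nonneg_of_mul_nonneg_right h2 hac'
  · rintro ⟨hx1, hx2, h1, h2⟩
    rcases le_or_gt w.1 b.1 with hxb | hxb
    · rcases hab.eq_or_lt with e | e
      · have e' : (b.1 : ℝ) = w.1 := le_antisymm (by rw [← e]; exact hx1) hxb
        rw [bentLine_of_ge e'.le] at h1
        refine ⟨?_, ?_, ?_⟩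
        · rw [hright (by omega)]; exact mul_nonneg hbc' h1
        · rw [hchord]; exact mul_nonneg hac'.le h2
        · have : side a b w = 0 := by
            simp only [side]; rw [← e', e]; ring
          rw [this, mul_zero]
      · rw [bentLine_of_le hxb] at h1
        have e3 : 0 ≤ D * side a b w := by rw [hleft e]; exact mul_nonneg hab' h1
        refine ⟨?_, ?_, e3⟩
        · have e' : (0 : ℝ) < b.1 - a.1 := by rw [sub_pos]; exact_mod_cast e
          refine nonneg_of_mul_nonneg_right (a := (b.1 : ℝ) - a.1) ?_ e'
          have : ((b.1 : ℝ) - a.1) * (D * side b c w) =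
              (c.1 - b.1) * (D * side a b w) + (b.1 - w.1) := by
            linear_combination D * hid + (b.1 - w.1) * hDD
          rw [this]
          exact add_nonneg (mul_nonneg hbc' e3) (by linarith)
        · rw [hchord]; exact mul_nonneg hac'.le h2
    · have e : b.1 < c.1 := by exact_mod_cast hxb.trans_le hx2
      rw [bentLine_of_ge hxb.le] at h1
      have e1 : 0 ≤ D * side b c w := by rw [hright e]; exact mul_nonneg hbc' h1
      refine ⟨e1, ?_, ?_⟩
      · rw [hchord]; exact mul_nonneg hac'.le h2
      · have e' : (0 : ℝ) < c.1 - b.1 := by rw [sub_pos]; exact_mod_cast e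
        refine nonneg_of_mul_nonneg_right (a := (c.1 : ℝ) - b.1) ?_ e'
        have : ((c.1 : ℝ) - b.1) * (D * side a b w) =
            (b.1 - a.1) * (D * side b c w) + (w.1 - b.1) := by
          linear_combination - D * hid + (w.1 - b.1) * hDD
        rw [this]
        exact add_nonneg (mul_nonneg hab' e1) (by linarith)

theorem det_mul_bentLine_pos {a b c : ℤ × ℤ} (h : |det3 a b c| = 1) {x : ℝ}
    (h1 : (a.1 : ℝ) < x) (h2 : x < c.1) :
    0 < (det3 a b c : ℝ) * (lineThrough a c x - bentLine a b c x) := by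
  have hac' : (0 : ℝ) < c.1 - a.1 := by linarith
  have hDD := sq_det_cast h
  have hDval : (det3 a b c : ℝ) =
      ((b.1 : ℝ) - a.1) * (c.2 - a.2) - ((b.2 : ℝ) - a.2) * (c.1 - a.1) := by
    rw [det3]; push_cast; ring
  rcases le_or_gt x b.1 with hx | hx
  · have e : a.1 < b.1 := by exact_mod_cast h1.trans_le hx
    have e' : (0 : ℝ) < b.1 - a.1 := by linarith
    rw [bentLine_of_le hx, lineThrough_comm e]
    have : lineThrough a c x - lineThrough a b x =
        (x - a.1) * (det3 a b c : ℝ) / ((c.1 - a.1) * (b.1 - a.1)) := by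
      rw [hDval]; simp only [lineThrough]; field_simp; ring
    rw [this, mul_div_assoc', mul_left_comm, hDD, mul_one]
    exact div_pos (by linarith) (mul_pos hac' e')
  · have e : b.1 < c.1 := by exact_mod_cast hx.trans h2
    have e' : (0 : ℝ) < c.1 - b.1 := by linarith
    rw [bentLine_of_ge hx.le]
    have : lineThrough a c x - lineThrough b c x =
        (c.1 - x) * (det3 a b c : ℝ) / ((c.1 - a.1) * (c.1 - b.1)) := by
      rw [hDval]; simp only [lineThrough]; field_simp; ring
    rw [this, mul_div_assoc', mul_left_comm, hDD, mul_one]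
    exact div_pos (by linarith) (mul_pos hac' e')

theorem le_of_lt_on_Ioo {l r : ℝ} (hlr : l < r) {f g : ℝ → ℝ} (hf : ContinuousOn f (Icc l r))
    (hg : ContinuousOn g (Icc l r)) (h : ∀ x ∈ Ioo l r, f x < g x) : ∀ x ∈ Icc l r, f x ≤ g x := by
  intro x hx
  rw [← closure_Ioo hlr.ne] at hx
  exact ContinuousWithinAt.closure_le hx
    ((hf x (by rwa [closure_Ioo hlr.ne] at hx)).mono Ioo_subset_Icc_self)
    ((hg x (by rwa [closure_Ioo hlr.ne] at hx)).mono Ioo_subset_Icc_self) fun y hy => (h y hy).le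

theorem IsPrimitiveTriangle.exists_sorted {V : Finset (ℤ × ℤ)} (hV : IsPrimitiveTriangle V) :
    ∃ a b c, V = {a, b, c} ∧ |det3 a b c| = 1 ∧ a.1 ≤ b.1 ∧ b.1 ≤ c.1 := by
  obtain ⟨a, b, c, rfl, h⟩ := hV.exists_det
  have h1 := abs_det3_rotate h
  have h2 := abs_det3_rotate h1
  rcases le_total a.1 b.1 with ab | ab <;> rcases le_total b.1 c.1 with bc | bc <;>
    rcases le_total a.1 c.1 with ac | ac
  · exact ⟨a, b, c, rfl, h, ab, bc⟩
  · exact ⟨a, b, c, rfl, h, ab, bc⟩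
  · exact ⟨a, c, b, by ext; simp; tauto, abs_det3_swap h2, ac, bc⟩
  · exact ⟨c, a, b, by ext; simp; tauto, h2, ac, ab⟩
  · exact ⟨b, a, c, by ext; simp; tauto, abs_det3_swap h, ab, ac⟩
  · exact ⟨b, c, a, by ext; simp; tauto, h1, bc, ac⟩
  · exact ⟨c, b, a, by ext; simp; tauto, abs_det3_swap h1, bc, ab⟩
  · exact ⟨c, b, a, by ext; simp; tauto, abs_det3_swap h1, bc, ab⟩

/-- The two end clauses record that the boundary functions meet at an end unless there is a vertical
side; this is what later ties the ends of tiles to the strip. -/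
theorem IsPrimitiveTriangle.exists_region {V : Finset (ℤ × ℤ)} (hV : IsPrimitiveTriangle V) :
    ∃ l r lo up, IsLatticeRegion (latticeHull V) l r lo up ∧
      (lo l = up l ∨ ∃ p ∈ V, ∃ q ∈ V, p ≠ q ∧ p.1 = l ∧ q.1 = l) ∧
      (lo r = up r ∨ ∃ p ∈ V, ∃ q ∈ V, p ≠ q ∧ p.1 = r ∧ q.1 = r) := by
  obtain ⟨a, b, c, rfl, h, hab, hbc⟩ := hV.exists_sorted
  have hac : a.1 < c.1 := by
    refine lt_of_le_of_ne (hab.trans hbc) fun he => ?_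
    have : b.1 = a.1 := by omega
    simp [det3, this, he] at h
  obtain ⟨n1, n2, n3⟩ := det3_ne h
  have hac' : (a.1 : ℝ) < c.1 := by exact_mod_cast hac
  have pl1 := isLatticePL_lineThrough hac
  have pl2 := isLatticePL_bentLine hab hbc
  have c1 := pl1.isSlabAffine.continuousOn hac.le
  have c2 := pl2.isSlabAffine.continuousOn hac.le
  have hl : bentLine a b c a.1 = lineThrough a c a.1 ∨
      ∃ p ∈ ({a, b, c} : Finset (ℤ × ℤ)), ∃ q ∈ ({a, b, c} : Finset (ℤ × ℤ)),
        p ≠ q ∧ p.1 = a.1 ∧ q.1 = a.1 := by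
    rcases hab.eq_or_lt with e | e
    · exact Or.inr ⟨a, by simp, b, by simp, n1, rfl, e.symm⟩
    · left; rw [bentLine_left e, lineThrough_left]
  have hr : bentLine a b c c.1 = lineThrough a c c.1 ∨
      ∃ p ∈ ({a, b, c} : Finset (ℤ × ℤ)), ∃ q ∈ ({a, b, c} : Finset (ℤ × ℤ)),
        p ≠ q ∧ p.1 = c.1 ∧ q.1 = c.1 := by
    rcases hbc.eq_or_lt with e | e
    · exact Or.inr ⟨b, by simp, c, by simp, n2, e, rfl⟩
    · left; rw [bentLine_right e, lineThrough_right hac]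
  have hmem := mem_latticeHull_iff_bentLine h hab hbc
  have hpos : ∀ x : ℝ, (a.1 : ℝ) < x → x < c.1 →
      0 < (det3 a b c : ℝ) * (lineThrough a c x - bentLine a b c x) :=
    fun x => det_mul_bentLine_pos h
  rcases eq_or_eq_neg_of_abs_eq h with hD | hD
  · rw [hD] at hmem hpos
    have hlt : ∀ x ∈ Ioo (a.1 : ℝ) c.1, bentLine a b c x < lineThrough a c x := by
      intro x hx
      have := hpos x hx.1 hx.2
      push_cast at this; linarith
    refine ⟨a.1, c.1, bentLine a b c, lineThrough a c, ⟨hac, pl2, pl1, hlt,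
      le_of_lt_on_Ioo hac' c2 c1 hlt, ?_⟩, hl, hr⟩
    ext w
    rw [hmem]; simp [regionBetweenGraphs]
  · rw [hD] at hmem hpos
    have hlt : ∀ x ∈ Ioo (a.1 : ℝ) c.1, lineThrough a c x < bentLine a b c x := by
      intro x hx
      have := hpos x hx.1 hx.2
      push_cast at this; linarith
    refine ⟨a.1, c.1, lineThrough a c, bentLine a b c, ⟨hac, pl1, pl2, hlt,
      le_of_lt_on_Ioo hac' c1 c2 hlt, ?_⟩, hl.imp_left Eq.symm, hr.imp_left Eq.symm⟩
    ext w
    rw [hmem]; simp [regionBetweenGraphs]; tauto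

/-! ### Primitive tiles and their triangles -/

theorem det3_vertical_left (k y a : ℤ) : det3 (k, y) (k, y + 1) (k - 1, a) = 1 := by
  simp [det3]

theorem det3_vertical_right (k y b : ℤ) : det3 (k, y) (k, y + 1) (k + 1, b) = -1 := by
  simp [det3]

/-- `D` is the set of triangles of a primitive lattice tile. -/
def IsTileTriangles (m : ℕ) (D : Finset (Finset (ℤ × ℤ))) : Prop :=
  (∃ V, D = {V} ∧ IsPrimitiveTriangle V ∧
    ∀ p ∈ V, ∀ q ∈ V, p.1 = q.1 → p ≠ q → p.1 = 0 ∨ p.1 = (m : ℤ)) ∨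
  ∃ k y a b : ℤ, D = {{(k, y), (k, y + 1), (k - 1, a)}, {(k, y), (k, y + 1), (k + 1, b)}}

/-- The union of the triangles in `D`. -/
def unionOfHulls (D : Finset (Finset (ℤ × ℤ))) : Set (ℝ × ℝ) := ⋃ V ∈ D, latticeHull V

theorem mem_unionOfHulls {D : Finset (Finset (ℤ × ℤ))} {w : ℝ × ℝ} :
    w ∈ unionOfHulls D ↔ ∃ V ∈ D, w ∈ latticeHull V := by simp [unionOfHulls]

theorem unionOfHulls_singleton (V : Finset (ℤ × ℤ)) : unionOfHulls {V} = latticeHull V := by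
  ext; simp [mem_unionOfHulls]

theorem unionOfHulls_pair (V W : Finset (ℤ × ℤ)) :
    unionOfHulls {V, W} = latticeHull V ∪ latticeHull W := by
  ext; simp [mem_unionOfHulls]

theorem IsTileTriangles.primitive {m : ℕ} {D : Finset (Finset (ℤ × ℤ))}
    (hD : IsTileTriangles m D) {V : Finset (ℤ × ℤ)} (hV : V ∈ D) : IsPrimitiveTriangle V := by
  rcases hD with ⟨V', rfl, h, -⟩ | ⟨k, y, a, b, rfl⟩
  · rw [Finset.mem_singleton] at hV; rwa [hV]
  · simp only [Finset.mem_insert, Finset.mem_singleton] at hV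
    rcases hV with rfl | rfl
    · exact .of_det (by rw [det3_vertical_left]; rfl)
    · exact .of_det (by rw [det3_vertical_right]; rfl)

theorem mem_latticeHull_vertical_left {k y a : ℤ} {w : ℝ × ℝ} :
    w ∈ latticeHull {(k, y), (k, y + 1), (k - 1, a)} ↔ ((k - 1 : ℤ) : ℝ) ≤ w.1 ∧ w.1 ≤ k ∧
      lineThrough (k, y) (k - 1, a) w.1 ≤ w.2 ∧ w.2 ≤ lineThrough (k, y + 1) (k - 1, a) w.1 := by
  have hd : det3 (k - 1, a) (k, y) (k, y + 1) = 1 := by simp [det3]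
  have e : ({(k, y), (k, y + 1), (k - 1, a)} : Finset (ℤ × ℤ)) =
      {(k - 1, a), (k, y), (k, y + 1)} := by ext; simp; tauto
  rw [e, mem_latticeHull_iff_bentLine (by rw [hd]; rfl) (by simp) (by simp), hd,
    ← lineThrough_comm (show ((k - 1, a) : ℤ × ℤ).1 < ((k, y + 1) : ℤ × ℤ).1 by simp)]
  refine and_congr_right fun h1 => and_congr_right fun h2 => ?_
  rw [bentLine_of_le (b := (k, y)) h2]
  simp

theorem mem_latticeHull_vertical_right {k y b : ℤ} {w : ℝ × ℝ} :
    w ∈ latticeHull {(k, y), (k, y + 1), (k + 1, b)} ↔ (k : ℝ) ≤ w.1 ∧ w.1 ≤ ((k + 1 : ℤ) : ℝ) ∧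
      lineThrough (k, y) (k + 1, b) w.1 ≤ w.2 ∧ w.2 ≤ lineThrough (k, y + 1) (k + 1, b) w.1 := by
  have hd : det3 (k, y) (k, y + 1) (k + 1, b) = -1 := det3_vertical_right k y b
  rw [mem_latticeHull_iff_bentLine (by rw [hd]; rfl) (by simp) (by simp), hd]
  refine and_congr_right fun h1 => and_congr_right fun h2 => ?_
  rw [bentLine_of_ge (b := (k, y + 1)) h1]
  simp; tauto

theorem IsTileTriangles.eq_of_generic {m : ℕ} {D : Finset (Finset (ℤ × ℤ))}
    (hD : IsTileTriangles m D) {V W : Finset (ℤ × ℤ)} (hV : V ∈ D) (hW : W ∈ D) {g : ℝ × ℝ}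
    (hg : g ∈ genericPts) (hgV : g ∈ latticeHull V) (hgW : g ∈ latticeHull W) : V = W := by
  rcases hD with ⟨V', rfl, h, -⟩ | ⟨k, y, a, b, rfl⟩
  · rw [Finset.mem_singleton] at hV hW; rw [hV, hW]
  · have hk := generic_fst_ne hg k
    simp only [Finset.mem_insert, Finset.mem_singleton] at hV hW
    rcases hV with rfl | rfl <;> rcases hW with rfl | rfl
    · rfl
    · exact absurd (le_antisymm (mem_latticeHull_vertical_left.1 hgV).2.1
        (mem_latticeHull_vertical_right.1 hgW).1) hk
    · exact absurd (le_antisymm (mem_latticeHull_vertical_left.1 hgW).2.1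
        (mem_latticeHull_vertical_right.1 hgV).1) hk
    · rfl

/-- The lattice region of a tile in the strip. Its ends are points or lie on the boundary of the
strip. -/
structure IsTileRegion (m : ℕ) (Q : Set (ℝ × ℝ)) (l r : ℤ) (lo up : ℝ → ℝ) : Prop
    extends IsLatticeRegion Q l r lo up where
  zero_le : 0 ≤ l
  le_width : r ≤ m
  left_end : l = 0 ∨ lo l = up l
  right_end : r = m ∨ lo r = up r

theorem IsLatticeRegion.left_mem {Q : Set (ℝ × ℝ)} {l r : ℤ} {lo up : ℝ → ℝ}
    (h : IsLatticeRegion Q l r lo up) : ((l : ℝ), lo l) ∈ Q := by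
  have : (l : ℝ) ≤ r := by exact_mod_cast h.lt.le
  rw [h.eq]; exact ⟨le_rfl, this, le_rfl, h.lower_le_upper _ ⟨le_rfl, this⟩⟩

theorem IsLatticeRegion.right_mem {Q : Set (ℝ × ℝ)} {l r : ℤ} {lo up : ℝ → ℝ}
    (h : IsLatticeRegion Q l r lo up) : ((r : ℝ), lo r) ∈ Q := by
  have : (l : ℝ) ≤ r := by exact_mod_cast h.lt.le
  rw [h.eq]; exact ⟨this, le_rfl, le_rfl, h.lower_le_upper _ ⟨this, le_rfl⟩⟩

theorem isLatticeRegion_pair (k y a b : ℤ) :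
    IsLatticeRegion (unionOfHulls
      {{(k, y), (k, y + 1), (k - 1, a)}, {(k, y), (k, y + 1), (k + 1, b)}}) (k - 1) (k + 1)
      (bentLine (k - 1, a) (k, y) (k + 1, b)) (bentLine (k - 1, a) (k, y + 1) (k + 1, b)) := by
  have pl1 : IsLatticePL (k - 1) (k + 1) (bentLine (k - 1, a) (k, y) (k + 1, b)) :=
    isLatticePL_bentLine (a := (k - 1, a)) (b := (k, y)) (c := (k + 1, b)) (by simp) (by simp)
  have pl2 : IsLatticePL (k - 1) (k + 1) (bentLine (k - 1, a) (k, y + 1) (k + 1, b)) :=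
    isLatticePL_bentLine (a := (k - 1, a)) (b := (k, y + 1)) (c := (k + 1, b)) (by simp) (by simp)
  have hlr : k - 1 < k + 1 := by omega
  have hlr' : ((k - 1 : ℤ) : ℝ) < ((k + 1 : ℤ) : ℝ) := by exact_mod_cast hlr
  have hlt : ∀ x ∈ Ioo ((k - 1 : ℤ) : ℝ) ((k + 1 : ℤ) : ℝ),
      bentLine (k - 1, a) (k, y) (k + 1, b) x < bentLine (k - 1, a) (k, y + 1) (k + 1, b) x := by
    intro x hx
    push_cast at hx
    rcases le_total x k with hxk | hxk
    · rw [bentLine_of_le hxk, bentLine_of_le hxk]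
      simp only [lineThrough]; push_cast
      rw [show (k : ℝ) - 1 - k = -1 by ring]
      have := hx.1
      linarith
    · rw [bentLine_of_ge hxk, bentLine_of_ge hxk]
      simp only [lineThrough]; push_cast
      rw [show (k : ℝ) + 1 - k = 1 by ring]
      have := hx.2
      linarith
  refine ⟨hlr, pl1, pl2, hlt, le_of_lt_on_Ioo hlr' (pl1.isSlabAffine.continuousOn hlr.le)
    (pl2.isSlabAffine.continuousOn hlr.le) hlt, ?_⟩
  ext w
  have hk1 : ((k - 1 : ℤ) : ℝ) ≤ k := by push_cast; linarith
  have hk2 : (k : ℝ) ≤ ((k + 1 : ℤ) : ℝ) := by push_cast; linarith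
  rw [unionOfHulls_pair, mem_union, mem_latticeHull_vertical_left, mem_latticeHull_vertical_right]
  constructor
  · rintro (⟨h1, h2, h3, h4⟩ | ⟨h1, h2, h3, h4⟩)
    · refine ⟨h1, h2.trans hk2, ?_, ?_⟩
      · rwa [bentLine_of_le h2]
      · rwa [bentLine_of_le h2]
    · refine ⟨hk1.trans h1, h2, ?_, ?_⟩
      · rwa [bentLine_of_ge h1]
      · rwa [bentLine_of_ge h1]
  · rintro ⟨h1, h2, h3, h4⟩
    rcases le_total w.1 k with hxk | hxk
    · rw [bentLine_of_le hxk] at h3 h4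
      exact Or.inl ⟨h1, hxk, h3, h4⟩
    · rw [bentLine_of_ge hxk] at h3 h4
      exact Or.inr ⟨hxk, h2, h3, h4⟩

/-- The vertical side of a single triangle lies on the boundary of the strip, and that of a pair
lies in the middle of the tile. At an end inside the strip the tile is therefore pinched to a point.
-/
theorem IsTileTriangles.exists_region {m : ℕ} {D : Finset (Finset (ℤ × ℤ))}
    (hD : IsTileTriangles m D) (hs : ∀ w ∈ unionOfHulls D, 0 ≤ w.1 ∧ w.1 ≤ m) :
    ∃ l r lo up, IsTileRegion m (unionOfHulls D) l r lo up := by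
  rcases hD with ⟨V, rfl, hV, hvert⟩ | ⟨k, y, a, b, rfl⟩
  · obtain ⟨l, r, lo, up, h, hl, hr⟩ := hV.exists_region
    rw [← unionOfHulls_singleton] at h
    have l0 : 0 ≤ l := by exact_mod_cast show (0 : ℝ) ≤ (l : ℝ) from (hs _ h.left_mem).1
    have rm : r ≤ m := by exact_mod_cast show (r : ℝ) ≤ m from (hs _ h.right_mem).2
    have hlt := h.lt
    refine ⟨l, r, lo, up, h, l0, rm, ?_, ?_⟩
    · rcases hl with hl | ⟨p, hp, q, hq, hne, h1, h2⟩
      · exact Or.inr hl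
      · have := hvert p hp q hq (h1.trans h2.symm) hne
        left; omega
    · rcases hr with hr | ⟨p, hp, q, hq, hne, h1, h2⟩
      · exact Or.inr hr
      · have := hvert p hp q hq (h1.trans h2.symm) hne
        left; omega
  · have h := isLatticeRegion_pair k y a b
    have l0 : 0 ≤ k - 1 := by
      exact_mod_cast show (0 : ℝ) ≤ ((k - 1 : ℤ) : ℝ) from (hs _ h.left_mem).1
    have rm : k + 1 ≤ m := by
      exact_mod_cast show ((k + 1 : ℤ) : ℝ) ≤ m from (hs _ h.right_mem).2
    refine ⟨_, _, _, _, h, l0, rm, Or.inr ?_, Or.inr ?_⟩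
    · rw [bentLine_left (a := (k - 1, a)) (by simp), bentLine_left (a := (k - 1, a)) (by simp)]
    · rw [bentLine_right (c := (k + 1, b)) (by simp), bentLine_right (c := (k + 1, b)) (by simp)]

theorem IsTileTriangles.isPrimitiveTile {m : ℕ} {D : Finset (Finset (ℤ × ℤ))}
    (hD : IsTileTriangles m D) : IsPrimitiveTile m (unionOfHulls D) := by
  have hprim := fun V (hV : V ∈ D) => hD.primitive hV
  have hgen := fun V W (hV : V ∈ D) (hW : W ∈ D) g hg => hD.eq_of_generic hV hW (g := g) hg
  rcases hD with ⟨V, rfl, hV, hvert⟩ | ⟨k, y, a, b, rfl⟩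
  · rw [unionOfHulls_singleton]
    by_cases h : ∀ p ∈ V, ∀ q ∈ V, p.1 = q.1 → p = q
    · exact Or.inl ⟨V, hV, h, rfl⟩
    · push Not at h
      obtain ⟨p, hp, q, hq, h1, h2⟩ := h
      exact Or.inr (Or.inl ⟨V, hV, ⟨p, hp, q, hq, h2, h1, hvert p hp q hq h1 h2⟩, rfl⟩)
  · refine Or.inr (Or.inr ⟨_, _, hprim _ (by simp), hprim _ (by simp),
      ⟨(k, y), (k, y + 1), by simp, by simp, by simp, by simp, by simp, rfl, ?_⟩,
      unionOfHulls_pair _ _⟩)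
    rw [latticeHull_inter_eq (hprim _ (by simp)) (hprim _ (by simp)), ← latticeHull_pair]
    · congr 1
      ext ⟨i, j⟩
      simp only [Finset.mem_inter, Finset.mem_insert, Finset.mem_singleton, Prod.mk.injEq]
      omega
    · intro g hg h1 h2
      have := hgen _ _ (by simp) (by simp) g hg h1 h2
      have h3 : ((k - 1, a) : ℤ × ℤ) ∈ ({(k, y), (k, y + 1), (k - 1, a)} : Finset (ℤ × ℤ)) := by
        simp
      rw [this] at h3
      simp only [Finset.mem_insert, Finset.mem_singleton, Prod.mk.injEq] at h3
      omega

/-- Here the determinant is, up to sign, the product of the length of the vertical side and the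
width of the triangle, so both are `1`. -/
theorem det3_of_vertical {p q c : ℤ × ℤ} (h : p.1 = q.1) (hd : |det3 p q c| = 1) :
    (q.2 = p.2 + 1 ∨ p.2 = q.2 + 1) ∧ (c.1 = p.1 - 1 ∨ c.1 = p.1 + 1) := by
  have : |q.2 - p.2| * |c.1 - p.1| = 1 := by
    rw [← hd, ← abs_mul, det3, h, sub_self, zero_mul, zero_sub, abs_neg]
  have h1 := Int.eq_one_or_neg_one_of_mul_eq_one this
  have h2 : |c.1 - p.1| = 1 := by
    rcases h1 with h1 | h1
    · rwa [h1, one_mul] at this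
    · have := abs_nonneg (q.2 - p.2); omega
  have h3 : |q.2 - p.2| = 1 := by rwa [h2, mul_one] at this
  rcases eq_or_eq_neg_of_abs_eq h2 with h2 | h2 <;>
    rcases eq_or_eq_neg_of_abs_eq h3 with h3 | h3 <;> omega

/-- Two triangles on the same side of a common edge overlap. -/
theorem exists_generic_of_same_side {p q c c' : ℤ × ℤ} (h : |det3 p q c| = 1)
    (h' : |det3 p q c'| = 1) (hs : det3 p q c = det3 p q c') :
    ∃ g ∈ genericPts, g ∈ latticeHull {p, q, c} ∧ g ∈ latticeHull {p, q, c'} := by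
  have hx : (2⁻¹ : ℝ) • latticePt p + (2⁻¹ : ℝ) • latticePt q ∈
      openSegment ℝ (latticePt p) (latticePt q) :=
    ⟨2⁻¹, 2⁻¹, by norm_num, by norm_num, by norm_num, rfl⟩
  have hv : 0 < (det3 p q c : ℝ) * side p q
      ((2⁻¹ : ℝ) • latticePt p + (2⁻¹ : ℝ) • latticePt q + (latticePt c - latticePt p)) := by
    have : side p q ((2⁻¹ : ℝ) • latticePt p + (2⁻¹ : ℝ) • latticePt q +
        (latticePt c - latticePt p)) = det3 p q c := by
      simp only [side, det3, latticePt, Prod.fst_add, Prod.snd_add, Prod.smul_fst, Prod.smul_snd,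
        Prod.fst_sub, Prod.snd_sub, smul_eq_mul]
      push_cast; ring
    rw [this, sq_det_cast h]; norm_num
  exact exists_generic_of_half_planes h h' hx hx hv (by rwa [← hs])

theorem IsPrimitiveTile.exists_triangles {m : ℕ} {Q : Set (ℝ × ℝ)} (hQ : IsPrimitiveTile m Q) :
    ∃ D, IsTileTriangles m D ∧ Q = unionOfHulls D := by
  rcases hQ with ⟨V, hV, h, rfl⟩ | ⟨V, hV, ⟨p, hp, q, hq, hne, h1, h2⟩, rfl⟩ |
    ⟨V, W, hV, hW, ⟨p, q, hpV, hqV, hpW, hqW, hne, h1, h2⟩, rfl⟩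
  · exact ⟨{V}, Or.inl ⟨V, rfl, hV, fun p hp q hq h1 h2 => absurd (h p hp q hq h1) h2⟩,
      (unionOfHulls_singleton V).symm⟩
  · refine ⟨{V}, Or.inl ⟨V, rfl, hV, fun p' hp' q' hq' h1' h2' => ?_⟩,
      (unionOfHulls_singleton V).symm⟩
    obtain ⟨c, rfl, hd⟩ := hV.exists_third hp hq hne
    -- The third vertex has another abscissa, so any two vertices on a common vertical line are `p`
    -- and `q`.
    have := (det3_of_vertical h1 hd).2
    have : p'.1 = p.1 := by
      simp only [Finset.mem_insert, Finset.mem_singleton] at hp' hq'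
      rcases hp' with rfl | rfl | rfl <;> rcases hq' with rfl | rfl | rfl <;>
        first | rfl | exact absurd rfl h2' | omega
    rwa [this]
  · have key : ∀ p q : ℤ × ℤ, q.2 = p.2 + 1 → p ∈ V → q ∈ V → p ∈ W → q ∈ W → p ≠ q →
        p.1 = q.1 → latticeHull V ∩ latticeHull W = segment ℝ (latticePt p) (latticePt q) →
        ∃ D, IsTileTriangles m D ∧ latticeHull V ∪ latticeHull W = unionOfHulls D := by
      intro p q hy hpV hqV hpW hqW hne h1 h2
      obtain ⟨c, rfl, hd⟩ := hV.exists_third hpV hqV hne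
      obtain ⟨c', rfl, hd'⟩ := hW.exists_third hpW hqW hne
      have e := (det3_of_vertical h1 hd).2
      have e' := (det3_of_vertical h1 hd').2
      -- On the same side of the common edge the triangles would overlap in a generic point, but
      -- their intersection is only a segment.
      have hside : c.1 ≠ c'.1 := by
        intro hcc
        have hs : det3 p q c = det3 p q c' := by simp only [det3, hcc, h1]; ring
        obtain ⟨g, hg, hg1, hg2⟩ := exists_generic_of_same_side hd hd' hs
        refine generic_notMem_latticeHull_pair hg hne ?_
        rw [latticeHull_pair, ← h2]; exact ⟨hg1, hg2⟩
      obtain ⟨k, y⟩ := p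
      obtain ⟨k', y'⟩ := q
      obtain ⟨i, a⟩ := c
      obtain ⟨i', b⟩ := c'
      simp only at h1 hy e e' hside
      subst h1 hy
      rcases e with rfl | rfl
      · obtain rfl : i' = k + 1 := by omega
        exact ⟨_, Or.inr ⟨k, y, a, b, rfl⟩, (unionOfHulls_pair _ _).symm⟩
      · obtain rfl : i' = k - 1 := by omega
        exact ⟨_, Or.inr ⟨k, y, b, a, rfl⟩, by rw [unionOfHulls_pair, union_comm]⟩
    obtain ⟨c, -, hd⟩ := hV.exists_third hpV hqV hne
    rcases (det3_of_vertical h1 hd).1 with e | e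
    · exact key p q e hpV hqV hpW hqW hne h1 h2
    · exact key q p e hqV hpV hqW hpW hne.symm h1.symm (by rw [segment_symm]; exact h2)

theorem IsTileTriangles.mem_iff {m : ℕ} {D : Finset (Finset (ℤ × ℤ))} (hD : IsTileTriangles m D)
    (p : ℤ × ℤ) : latticePt p ∈ unionOfHulls D ↔ ∃ V ∈ D, p ∈ V := by
  rw [mem_unionOfHulls]
  exact ⟨fun ⟨V, hV, h⟩ => ⟨V, hV, (hD.primitive hV).mem_of_latticePt_mem h⟩,
    fun ⟨V, hV, h⟩ => ⟨V, hV, latticePt_mem_latticeHull h⟩⟩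

/-- A tile determines its triangles. -/
theorem IsTileTriangles.injective {m : ℕ} {D D' : Finset (Finset (ℤ × ℤ))}
    (hD : IsTileTriangles m D) (hD' : IsTileTriangles m D')
    (h : unionOfHulls D = unionOfHulls D') : D = D' := by
  have hmem : ∀ p, (∃ V ∈ D, p ∈ V) ↔ ∃ V ∈ D', p ∈ V := by
    intro p; rw [← hD.mem_iff, ← hD'.mem_iff, h]
  -- A single triangle contains three lattice points and a pair contains four, so the two kinds of
  -- tile cannot coincide.
  have hcard : ∀ (V : Finset (ℤ × ℤ)) (k y a b : ℤ), IsPrimitiveTriangle V →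
      ¬ ∀ p, p ∈ V ↔ p ∈ ({(k, y), (k, y + 1), (k - 1, a)} : Finset (ℤ × ℤ)) ∨
        p ∈ ({(k, y), (k, y + 1), (k + 1, b)} : Finset (ℤ × ℤ)) := by
    intro V k y a b hV hp
    have h4 : ({(k, y), (k, y + 1), (k - 1, a), (k + 1, b)} : Finset (ℤ × ℤ)) ⊆ V := by
      intro p hpm
      rw [hp]
      simp only [Finset.mem_insert, Finset.mem_singleton] at hpm ⊢
      tauto
    have := Finset.card_le_card h4
    rw [hV.card_eq, Finset.card_insert_of_notMem (by simp; omega),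
      Finset.card_insert_of_notMem (by simp; omega),
      Finset.card_insert_of_notMem (by simp; omega), Finset.card_singleton] at this
    omega
  rcases hD with ⟨V, rfl, hV, -⟩ | ⟨k, y, a, b, rfl⟩ <;>
    rcases hD' with ⟨V', rfl, hV', -⟩ | ⟨k', y', a', b', rfl⟩
  · congr 1; ext p; simpa using hmem p
  · exact absurd (by simpa only [Finset.mem_singleton, Finset.mem_insert, exists_eq_left,
      exists_eq_or_imp] using hmem) (hcard V k' y' a' b' hV)
  · refine absurd ?_ (hcard V' k y a b hV')
    intro p
    simpa only [Finset.mem_singleton, Finset.mem_insert, exists_eq_left,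
      exists_eq_or_imp] using (hmem p).symm
  · simp only [Finset.mem_singleton, Finset.mem_insert, exists_eq_left, exists_eq_or_imp,
      Prod.forall, Prod.mk.injEq] at hmem
    have t1 := (hmem (k - 1) a).1 (by simp)
    have t2 := (hmem k y).1 (by simp)
    have t3 := (hmem k (y + 1)).1 (by simp)
    have t4 := (hmem (k + 1) b).1 (by simp)
    obtain rfl : k = k' := by omega
    obtain rfl : y = y' := by omega
    obtain rfl : a = a' := by omega
    obtain rfl : b = b' := by omega
    rfl

/-- A pair inside the strip needs width at least `2`, while each of its triangles has width `1` and
cannot reach both boundary lines. -/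
theorem IsTileTriangles.eq_singleton {m : ℕ} {D : Finset (Finset (ℤ × ℤ))}
    (hD : IsTileTriangles m D) (hs : ∀ w ∈ unionOfHulls D, 0 ≤ w.1 ∧ w.1 ≤ m)
    {V : Finset (ℤ × ℤ)} (hV : V ∈ D) {p q : ℤ × ℤ} (hp : p ∈ V) (hq : q ∈ V) (hp0 : p.1 = 0)
    (hqm : q.1 = m) : D = {V} := by
  have hD2 := hD
  rcases hD with ⟨V', rfl, hV', -⟩ | ⟨k, y, a, b, rfl⟩
  · rw [Finset.mem_singleton] at hV; rw [hV]
  · exfalso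
    have h1 := (hs (latticePt (k - 1, a)) ((hD2.mem_iff _).2 (by simp))).1
    have h2 := (hs (latticePt (k + 1, b)) ((hD2.mem_iff _).2 (by simp))).2
    have h1' : 0 ≤ k - 1 := by simp only [latticePt] at h1; exact_mod_cast h1
    have h2' : k + 1 ≤ m := by simp only [latticePt] at h2; exact_mod_cast h2
    obtain ⟨p1, p2⟩ := p
    obtain ⟨q1, q2⟩ := q
    simp only [Finset.mem_insert, Finset.mem_singleton] at hV
    rcases hV with rfl | rfl <;>
      simp only [Finset.mem_insert, Finset.mem_singleton, Prod.mk.injEq] at hp hq <;> omega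

theorem IsGenericTiling.eq_of_same_side {P : Set (ℝ × ℝ)} {T : Finset (Finset (ℤ × ℤ))}
    (hT : IsGenericTiling P T) {p q c c' : ℤ × ℤ} (h : |det3 p q c| = 1)
    (h' : |det3 p q c'| = 1) (hs : det3 p q c = det3 p q c') (hc : {p, q, c} ∈ T)
    (hc' : {p, q, c'} ∈ T) : ({p, q, c} : Finset (ℤ × ℤ)) = {p, q, c'} := by
  obtain ⟨g, hg, h1, h2⟩ := exists_generic_of_same_side h h' hs
  exact hT.unique _ hc _ hc' g hg h1 h2

/-- Different tiles of a triangulation have no common triangle. -/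
theorem IsTileTriangles.eq_of_mem {m : ℕ} {D D' : Finset (Finset (ℤ × ℤ))}
    (hD : IsTileTriangles m D) (hD' : IsTileTriangles m D')
    (hs : ∀ w ∈ unionOfHulls D, 0 ≤ w.1 ∧ w.1 ≤ m)
    (hs' : ∀ w ∈ unionOfHulls D', 0 ≤ w.1 ∧ w.1 ≤ m) {P : Set (ℝ × ℝ)}
    {T : Finset (Finset (ℤ × ℤ))} (hT : IsGenericTiling P T) (hDT : D ⊆ T) (hDT' : D' ⊆ T)
    {V : Finset (ℤ × ℤ)} (hV : V ∈ D) (hV' : V ∈ D') : D = D' := by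
  have key : ∀ (V : Finset (ℤ × ℤ)) (k y a b : ℤ), V ∈ ({{(k, y), (k, y + 1), (k - 1, a)},
      {(k, y), (k, y + 1), (k + 1, b)}} : Finset (Finset (ℤ × ℤ))) →
      (∀ w ∈ unionOfHulls {{(k, y), (k, y + 1), (k - 1, a)}, {(k, y), (k, y + 1), (k + 1, b)}},
        0 ≤ w.1 ∧ w.1 ≤ m) →
      ¬ ∀ p ∈ V, ∀ q ∈ V, p.1 = q.1 → p ≠ q → p.1 = 0 ∨ p.1 = (m : ℤ) := by
    intro V k y a b hV hs hv
    have hD2 : IsTileTriangles m {{(k, y), (k, y + 1), (k - 1, a)},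
      {(k, y), (k, y + 1), (k + 1, b)}} := Or.inr ⟨k, y, a, b, rfl⟩
    have h1 := (hs (latticePt (k - 1, a)) ((hD2.mem_iff _).2 (by simp))).1
    have h2 := (hs (latticePt (k + 1, b)) ((hD2.mem_iff _).2 (by simp))).2
    have h1' : 0 ≤ k - 1 := by simp only [latticePt] at h1; exact_mod_cast h1
    have h2' : k + 1 ≤ m := by simp only [latticePt] at h2; exact_mod_cast h2
    have h3 : (k, y) ∈ V ∧ (k, y + 1) ∈ V := by
      simp only [Finset.mem_insert, Finset.mem_singleton] at hV
      rcases hV with rfl | rfl <;> simp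
    have := hv _ h3.1 _ h3.2 rfl (by simp)
    simp only at this
    omega
  rcases hD with ⟨W, rfl, hW, hv⟩ | ⟨k, y, a, b, rfl⟩ <;>
    rcases hD' with ⟨W', rfl, hW', hv'⟩ | ⟨k', y', a', b', rfl⟩
  · rw [Finset.mem_singleton] at hV hV'; rw [← hV, ← hV']
  · rw [Finset.mem_singleton] at hV; subst hV
    exact absurd hv (key _ _ _ _ _ hV' hs')
  · rw [Finset.mem_singleton] at hV'; subst hV'
    exact absurd hv' (key _ _ _ _ _ hV hs)
  · have hl : ∀ k y a : ℤ, |det3 (k, y) (k, y + 1) (k - 1, a)| = 1 := by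
      intro k y a; rw [det3_vertical_left]; rfl
    have hr : ∀ k y b : ℤ, |det3 (k, y) (k, y + 1) (k + 1, b)| = 1 := by
      intro k y b; rw [det3_vertical_right]; rfl
    have hparam : k = k' ∧ y = y' := by
      have m1 : (k, y) ∈ V ∧ (k, y + 1) ∈ V := by
        simp only [Finset.mem_insert, Finset.mem_singleton] at hV
        rcases hV with rfl | rfl <;> simp
      obtain ⟨m1, m2⟩ := m1
      simp only [Finset.mem_insert, Finset.mem_singleton] at hV'
      rcases hV' with rfl | rfl <;>
        simp only [Finset.mem_insert, Finset.mem_singleton, Prod.mk.injEq] at m1 m2 <;> omega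
    -- Both pairs are built on the same vertical side, and a tiling has at most one triangle on each
    -- side of it.
    obtain ⟨rfl, rfl⟩ := hparam
    rw [hT.eq_of_same_side (hl k y a) (hl k y a') (by rw [det3_vertical_left, det3_vertical_left])
      (hDT (by simp)) (hDT' (by simp)),
      hT.eq_of_same_side (hr k y b) (hr k y b') (by rw [det3_vertical_right, det3_vertical_right])
      (hDT (by simp)) (hDT' (by simp))]

/-! ### Maximal tiles and the function left after their removal -/

theorem IsLatticeRegion.continuousOn_lower {Q : Set (ℝ × ℝ)} {l r : ℤ} {lo up : ℝ → ℝ}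
    (h : IsLatticeRegion Q l r lo up) : ContinuousOn lo (Icc (l : ℝ) r) :=
  h.lower.isSlabAffine.continuousOn h.lt.le

theorem IsLatticeRegion.continuousOn_upper {Q : Set (ℝ × ℝ)} {l r : ℤ} {lo up : ℝ → ℝ}
    (h : IsLatticeRegion Q l r lo up) : ContinuousOn up (Icc (l : ℝ) r) :=
  h.upper.isSlabAffine.continuousOn h.lt.le

theorem IsLatticeRegion.mem_iff {Q : Set (ℝ × ℝ)} {l r : ℤ} {lo up : ℝ → ℝ}
    (h : IsLatticeRegion Q l r lo up) (w : ℝ × ℝ) :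
    w ∈ Q ↔ (l : ℝ) ≤ w.1 ∧ w.1 ≤ r ∧ lo w.1 ≤ w.2 ∧ w.2 ≤ up w.1 := by
  rw [h.eq]; rfl

theorem IsLatticeRegion.mem_interior {Q : Set (ℝ × ℝ)} {l r : ℤ} {lo up : ℝ → ℝ}
    (h : IsLatticeRegion Q l r lo up) {w : ℝ × ℝ} (h1 : (l : ℝ) < w.1) (h2 : w.1 < r)
    (h3 : lo w.1 < w.2) (h4 : w.2 < up w.1) : w ∈ interior Q := by
  rw [h.eq]
  exact mem_interior_regionBetweenGraphs h.continuousOn_lower h.continuousOn_upper h1 h2 h3 h4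

/-- Regions with the same top over a common inner abscissa overlap. -/
theorem IsLatticeRegion.overlap {Q Q' : Set (ℝ × ℝ)} {l r l' r' : ℤ} {lo up lo' up' : ℝ → ℝ}
    (h : IsLatticeRegion Q l r lo up) (h' : IsLatticeRegion Q' l' r' lo' up') {x : ℝ}
    (hx : x ∈ Ioo (l : ℝ) r) (hx' : x ∈ Ioo (l' : ℝ) r') (hup : up x = up' x) :
    (interior Q ∩ interior Q').Nonempty := by
  have h1 := h.lower_lt_upper x hx
  have h2 := h'.lower_lt_upper x hx'
  obtain ⟨y, hy1, hy2⟩ := exists_between (max_lt h1 (by rwa [hup] : lo' x < up x))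
  exact ⟨(x, y), h.mem_interior hx.1 hx.2 ((le_max_left _ _).trans_lt hy1) hy2,
    h'.mem_interior hx'.1 hx'.2 ((le_max_right _ _).trans_lt hy1) (hup ▸ hy2)⟩

/-- The data of the `stripRegion m φ₀ φ`-maximal tiles. -/
structure MaximalTileData (m : ℕ) (φ₀ φ : ℝ → ℝ) where
  /-- the left end of the projection -/
  left : Set (ℝ × ℝ) → ℤ
  /-- the right end of the projection -/
  right : Set (ℝ × ℝ) → ℤ
  /-- the lower boundary function -/
  lower : Set (ℝ × ℝ) → ℝ → ℝ
  /-- the upper boundary function -/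
  upper : Set (ℝ × ℝ) → ℝ → ℝ
  /-- the triangles of a tile -/
  triangles : Set (ℝ × ℝ) → Finset (Finset (ℤ × ℤ))
  region : ∀ {Q}, IsMaximalTile m (stripRegion m φ₀ φ) Q →
    IsTileRegion m Q (left Q) (right Q) (lower Q) (upper Q)
  isTile : ∀ {Q}, IsMaximalTile m (stripRegion m φ₀ φ) Q → IsTileTriangles m (triangles Q)
  union_eq : ∀ {Q}, IsMaximalTile m (stripRegion m φ₀ φ) Q → unionOfHulls (triangles Q) = Q
  upper_eq : ∀ {Q}, IsMaximalTile m (stripRegion m φ₀ φ) Q →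
    ∀ x ∈ Icc (left Q : ℝ) (right Q), upper Q x = φ x
  le_lower : ∀ {Q}, IsMaximalTile m (stripRegion m φ₀ φ) Q →
    ∀ x ∈ Icc (left Q : ℝ) (right Q), φ₀ x ≤ lower Q x

/-- The condition on upper parts becomes the equation of boundary functions `up = φ`: a top point of
the tile below `φ` would not be a top point of the shape. -/
theorem IsMaximalTile.exists_data {m : ℕ} {φ₀ φ : ℝ → ℝ} (hle : ∀ x ∈ Icc (0 : ℝ) m, φ₀ x ≤ φ x)
    {Q : Set (ℝ × ℝ)} (hQ : IsMaximalTile m (stripRegion m φ₀ φ) Q) :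
    ∃ (D : Finset (Finset (ℤ × ℤ))) (l r : ℤ) (lo up : ℝ → ℝ), IsTileRegion m Q l r lo up ∧
      IsTileTriangles m D ∧ unionOfHulls D = Q ∧ (∀ x ∈ Icc (l : ℝ) r, up x = φ x) ∧
      ∀ x ∈ Icc (l : ℝ) r, φ₀ x ≤ lo x := by
  obtain ⟨hT, hsub, hup⟩ := hQ
  obtain ⟨D, hD, rfl⟩ := hT.exists_triangles
  obtain ⟨l, r, lo, up, h⟩ := hD.exists_region fun w hw => ⟨(hsub hw).1, (hsub hw).2.1⟩
  refine ⟨D, l, r, lo, up, h, hD, rfl, fun x hx => ?_, fun x hx => ?_⟩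
  · have hm : (x, up x) ∈ unionOfHulls D :=
      (h.mem_iff _).2 ⟨hx.1, hx.2, h.lower_le_upper x hx, le_rfl⟩
    have hm' := hsub hm
    refine le_antisymm hm'.2.2.2 ?_
    have : (x, up x) ∈ upperPart (stripRegion m φ₀ φ) := by
      refine hup ⟨hm, fun y' hy' hmem => ?_⟩
      exact absurd ((h.mem_iff _).1 hmem).2.2.2 (not_le.2 hy')
    by_contra hlt
    refine this.2 (φ x) (not_le.1 hlt) ⟨hm'.1, hm'.2.1, hle x ⟨hm'.1, hm'.2.1⟩, le_rfl⟩
  · exact (hsub ((h.mem_iff (x, lo x)).2 ⟨hx.1, hx.2, le_rfl, h.lower_le_upper x hx⟩)).2.2.1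

theorem exists_maximalTileData {m : ℕ} {φ₀ φ : ℝ → ℝ} (hle : ∀ x ∈ Icc (0 : ℝ) m, φ₀ x ≤ φ x) :
    Nonempty (MaximalTileData m φ₀ φ) := by
  have := fun Q (hQ : IsMaximalTile m (stripRegion m φ₀ φ) Q) => hQ.exists_data hle
  choose! D l r lo up h1 h2 h3 h4 h5 using this
  exact ⟨⟨l, r, lo, up, D, h1 _, h2 _, h3 _, h4 _, h5 _⟩⟩

namespace MaximalTileData

variable {m : ℕ} {φ₀ φ : ℝ → ℝ} (τ : MaximalTileData m φ₀ φ)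

/-- `F` is a set of maximal tiles with pairwise disjoint interiors. -/
structure IsRemovable (m : ℕ) (φ₀ φ : ℝ → ℝ) (F : Finset (Set (ℝ × ℝ))) : Prop where
  maximal : ∀ Q ∈ F, IsMaximalTile m (stripRegion m φ₀ φ) Q
  disjoint : ∀ Q ∈ F, ∀ R ∈ F, Q ≠ R → Disjoint (interior Q) (interior R)

open Classical in
/-- The upper boundary function of what is left after removing the tiles in `F`. -/
noncomputable def lowered (F : Finset (Set (ℝ × ℝ))) (x : ℝ) : ℝ :=
  if h : ∃ Q ∈ F, x ∈ Icc (τ.left Q : ℝ) (τ.right Q) then τ.lower h.choose x else φ x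

variable {τ} {F : Finset (Set (ℝ × ℝ))}

/-- Two maximal tiles over a common inner abscissa both contain the points just below `φ`, so their
interiors meet. -/
theorem eq_of_mem_Ioo (hF : IsRemovable m φ₀ φ F) {Q R : Set (ℝ × ℝ)} (hQ : Q ∈ F) (hR : R ∈ F)
    {x : ℝ} (hxQ : x ∈ Ioo (τ.left Q : ℝ) (τ.right Q)) (hxR : x ∈ Ioo (τ.left R : ℝ) (τ.right R)) :
    Q = R := by
  by_contra hne
  have h1 := τ.region (hF.maximal Q hQ)
  have h2 := τ.region (hF.maximal R hR)
  refine Set.not_disjoint_iff_nonempty_inter.2 ?_ (hF.disjoint Q hQ R hR hne)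
  refine h1.overlap h2.toIsLatticeRegion hxQ hxR ?_
  rw [τ.upper_eq (hF.maximal Q hQ) x (Ioo_subset_Icc_self hxQ),
    τ.upper_eq (hF.maximal R hR) x (Ioo_subset_Icc_self hxR)]

theorem lower_left {Q : Set (ℝ × ℝ)} (hQ : IsMaximalTile m (stripRegion m φ₀ φ) Q)
    (h : τ.left Q ≠ 0) : τ.lower Q (τ.left Q) = φ (τ.left Q) := by
  have h1 := τ.region hQ
  have h2 : (τ.left Q : ℝ) ≤ τ.right Q := by exact_mod_cast h1.lt.le
  rw [h1.left_end.resolve_left h, τ.upper_eq hQ _ ⟨le_rfl, h2⟩]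

theorem lower_right {Q : Set (ℝ × ℝ)} (hQ : IsMaximalTile m (stripRegion m φ₀ φ) Q)
    (h : τ.right Q ≠ m) : τ.lower Q (τ.right Q) = φ (τ.right Q) := by
  have h1 := τ.region hQ
  have h2 : (τ.left Q : ℝ) ≤ τ.right Q := by exact_mod_cast h1.lt.le
  rw [h1.right_end.resolve_left h, τ.upper_eq hQ _ ⟨h2, le_rfl⟩]

theorem lower_lt {Q : Set (ℝ × ℝ)} (hQ : IsMaximalTile m (stripRegion m φ₀ φ) Q) {x : ℝ}
    (hx : x ∈ Ioo (τ.left Q : ℝ) (τ.right Q)) : τ.lower Q x < φ x := by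
  rw [← τ.upper_eq hQ x (Ioo_subset_Icc_self hx)]
  exact (τ.region hQ).lower_lt_upper x hx

theorem lower_le {Q : Set (ℝ × ℝ)} (hQ : IsMaximalTile m (stripRegion m φ₀ φ) Q) {x : ℝ}
    (hx : x ∈ Icc (τ.left Q : ℝ) (τ.right Q)) : τ.lower Q x ≤ φ x := by
  rw [← τ.upper_eq hQ x hx]
  exact (τ.region hQ).lower_le_upper x hx

/-- This makes the choice in `lowered` immaterial. Different tiles share at most an end abscissa,
which lies inside the strip, where both are pinched to `φ`. -/
theorem lower_eq_lower (hF : IsRemovable m φ₀ φ F) {Q R : Set (ℝ × ℝ)} (hQ : Q ∈ F) (hR : R ∈ F)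
    {x : ℝ} (hxQ : x ∈ Icc (τ.left Q : ℝ) (τ.right Q)) (hxR : x ∈ Icc (τ.left R : ℝ) (τ.right R)) :
    τ.lower Q x = τ.lower R x := by
  by_cases hne : Q = R
  · rw [hne]
  have mQ := hF.maximal Q hQ
  have mR := hF.maximal R hR
  have h1 := τ.region mQ
  have h2 := τ.region mR
  have := h1.lt
  have := h2.lt
  have := h1.zero_le
  have := h2.zero_le
  have := h1.le_width
  have := h2.le_width
  have hends : τ.right Q ≤ τ.left R ∨ τ.right R ≤ τ.left Q := by
    by_contra! hcon
    obtain ⟨k, hk1, hk2, hk3, hk4⟩ : ∃ k, τ.left Q ≤ k ∧ τ.left R ≤ k ∧ k + 1 ≤ τ.right Q ∧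
        k + 1 ≤ τ.right R := by
      rcases le_total (τ.left Q) (τ.left R) with h | h
      · exact ⟨τ.left R, by omega, by omega, by omega, by omega⟩
      · exact ⟨τ.left Q, by omega, by omega, by omega, by omega⟩
    have g1 : (τ.left Q : ℝ) ≤ k := by exact_mod_cast hk1
    have g2 : (τ.left R : ℝ) ≤ k := by exact_mod_cast hk2
    have g3 : (k : ℝ) + 1 ≤ τ.right Q := by exact_mod_cast hk3
    have g4 : (k : ℝ) + 1 ≤ τ.right R := by exact_mod_cast hk4
    exact hne (eq_of_mem_Ioo (τ := τ) hF hQ hR (x := k + 1 / 2) ⟨by linarith, by linarith⟩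
      ⟨by linarith, by linarith⟩)
  rcases hends with h | h
  · have h' : (τ.right Q : ℝ) ≤ τ.left R := by exact_mod_cast h
    have e1 : x = τ.right Q := le_antisymm hxQ.2 (h'.trans hxR.1)
    have e2 : x = τ.left R := le_antisymm (hxQ.2.trans h') hxR.1
    nth_rw 1 [e1]
    rw [lower_right mQ (by omega), ← e1, e2, lower_left mR (by omega)]
  · have h' : (τ.right R : ℝ) ≤ τ.left Q := by exact_mod_cast h
    have e1 : x = τ.right R := le_antisymm hxR.2 (h'.trans hxQ.1)
    have e2 : x = τ.left Q := le_antisymm (hxR.2.trans h') hxQ.1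
    nth_rw 1 [e2]
    rw [lower_left mQ (by omega), ← e2, e1, lower_right mR (by omega)]

theorem lowered_of_mem (hF : IsRemovable m φ₀ φ F) {Q : Set (ℝ × ℝ)} (hQ : Q ∈ F) {x : ℝ}
    (hx : x ∈ Icc (τ.left Q : ℝ) (τ.right Q)) : τ.lowered F x = τ.lower Q x := by
  have h : ∃ Q ∈ F, x ∈ Icc (τ.left Q : ℝ) (τ.right Q) := ⟨Q, hQ, hx⟩
  rw [lowered, dif_pos h]
  exact lower_eq_lower hF h.choose_spec.1 hQ h.choose_spec.2 hx

theorem lowered_of_notMem {x : ℝ} (h : ∀ Q ∈ F, x ∉ Icc (τ.left Q : ℝ) (τ.right Q)) :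
    τ.lowered F x = φ x := by
  rw [lowered, dif_neg]
  rintro ⟨Q, hQ, hx⟩
  exact h Q hQ hx

theorem lowered_le (hF : IsRemovable m φ₀ φ F) (x : ℝ) : τ.lowered F x ≤ φ x := by
  by_cases h : ∃ Q ∈ F, x ∈ Icc (τ.left Q : ℝ) (τ.right Q)
  · obtain ⟨Q, hQ, hx⟩ := h
    rw [lowered_of_mem hF hQ hx]; exact lower_le (hF.maximal Q hQ) hx
  · rw [lowered_of_notMem fun Q hQ hx => h ⟨Q, hQ, hx⟩]

theorem le_lowered (hF : IsRemovable m φ₀ φ F) (hle : ∀ x ∈ Icc (0 : ℝ) m, φ₀ x ≤ φ x) {x : ℝ}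
    (hx : x ∈ Icc (0 : ℝ) m) : φ₀ x ≤ τ.lowered F x := by
  by_cases h : ∃ Q ∈ F, x ∈ Icc (τ.left Q : ℝ) (τ.right Q)
  · obtain ⟨Q, hQ, hx⟩ := h
    rw [lowered_of_mem hF hQ hx]; exact τ.le_lower (hF.maximal Q hQ) x hx
  · rw [lowered_of_notMem fun Q hQ hx => h ⟨Q, hQ, hx⟩]; exact hle x hx

/-- Over each slab, the function after removal is the one of a tile, or the old one. -/
theorem lowered_slab (hF : IsRemovable m φ₀ φ F) {k : ℤ} (h0 : 0 ≤ k) (hm : k < m) :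
    (∃ Q ∈ F, τ.left Q ≤ k ∧ k < τ.right Q) ∨
      ∀ x ∈ Icc (k : ℝ) (k + 1), τ.lowered F x = φ x := by
  by_cases h : ∃ Q ∈ F, τ.left Q ≤ k ∧ k < τ.right Q
  · exact Or.inl h
  right
  intro x hx
  by_cases hQ : ∃ Q ∈ F, x ∈ Icc (τ.left Q : ℝ) (τ.right Q)
  swap
  · exact lowered_of_notMem fun Q hQF hx => hQ ⟨Q, hQF, hx⟩
  obtain ⟨Q, hQF, hxQ⟩ := hQ
  have mQ := hF.maximal Q hQF
  have hr := τ.region mQ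
  rw [lowered_of_mem hF hQF hxQ]
  have hl : τ.left Q ≤ k + 1 := by
    have := hxQ.1.trans hx.2
    exact_mod_cast this
  have hk : k ≤ τ.right Q := by
    have := hx.1.trans hxQ.2
    exact_mod_cast this
  have hno : ¬(τ.left Q ≤ k ∧ k < τ.right Q) := fun hh => h ⟨Q, hQF, hh⟩
  have := hr.lt
  -- A tile not covering the slab touches it only at an end, where its lower function equals `φ`.
  rcases le_or_gt (τ.left Q) k with hlk | hlk
  · have e : τ.right Q = k := by omega
    have e' : (τ.right Q : ℝ) = k := by exact_mod_cast e
    have ex : x = τ.right Q := le_antisymm hxQ.2 (by rw [e']; exact hx.1)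
    rw [ex]; exact lower_right mQ (by omega)
  · have e : τ.left Q = k + 1 := by omega
    have e' : (τ.left Q : ℝ) = k + 1 := by exact_mod_cast e
    have ex : x = τ.left Q := le_antisymm (by rw [e']; exact hx.2) hxQ.1
    rw [ex]; exact lower_left mQ (by omega)

theorem Icc_slab_subset {l r k : ℤ} (h1 : l ≤ k) (h2 : k < r) :
    Icc (k : ℝ) (k + 1) ⊆ Icc (l : ℝ) r :=
  Icc_subset_Icc (by exact_mod_cast h1) (by exact_mod_cast h2)

/-- At an end of a tile the value is an integer; at any other inner integer, both adjacent slabs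
belong to the same tile or are untouched, and the property is inherited. -/
theorem isLatticePL_lowered (hF : IsRemovable m φ₀ φ F) (hφ : IsLatticePL 0 m φ) (hm : 0 < m) :
    IsLatticePL 0 m (τ.lowered F) := by
  refine ⟨fun k h0 hk => ?_, fun k h0 hk => ?_, ?_, ?_⟩
  · rcases lowered_slab (τ := τ) hF h0 hk with ⟨Q, hQ, h1, h2⟩ | h
    · obtain ⟨p, q, hpq, h⟩ := (τ.region (hF.maximal Q hQ)).lower.slab k h1 h2
      refine ⟨p, q, hpq, fun x hx => ?_⟩
      rw [lowered_of_mem hF hQ (Icc_slab_subset h1 h2 hx), h x hx]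
    · obtain ⟨p, q, hpq, h'⟩ := hφ.slab k h0 hk
      exact ⟨p, q, hpq, fun x hx => by rw [h x hx, h' x hx]⟩
  · by_cases hex : ∃ Q ∈ F, (k : ℝ) ∈ Icc (τ.left Q : ℝ) (τ.right Q)
    · obtain ⟨Q, hQ, hkQ⟩ := hex
      have hreg := τ.region (hF.maximal Q hQ)
      have h1 : τ.left Q ≤ k := by exact_mod_cast hkQ.1
      have h2 : k ≤ τ.right Q := by exact_mod_cast hkQ.2
      rw [lowered_of_mem hF hQ hkQ]
      rcases h1.eq_or_lt with e | h1
      · rw [← e]; exact Or.inl hreg.lower.left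
      rcases h2.eq_or_lt with e | h2
      · rw [e]; exact Or.inl hreg.lower.right
      have h1' : (τ.left Q : ℝ) ≤ k - 1 := by exact_mod_cast (by omega : τ.left Q ≤ k - 1)
      have h2' : (k : ℝ) + 1 ≤ τ.right Q := by exact_mod_cast h2
      rw [lowered_of_mem hF hQ (x := k - 1) ⟨h1', by linarith⟩,
        lowered_of_mem hF hQ (x := k + 1) ⟨by linarith, h2'⟩]
      exact hreg.lower.inner k h1 h2
    · have noQ : ∀ j, j = k - 1 ∨ j = k → ¬∃ Q ∈ F, τ.left Q ≤ j ∧ j < τ.right Q := by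
        rintro j hj ⟨Q, hQ, h1, h2⟩
        refine hex ⟨Q, hQ, ?_, ?_⟩
        · exact_mod_cast (by omega : τ.left Q ≤ k)
        · exact_mod_cast (by omega : k ≤ τ.right Q)
      have s1 := (lowered_slab (τ := τ) hF (k := k - 1) (by omega) (by omega)).resolve_left
        (noQ _ (Or.inl rfl))
      have s2 := (lowered_slab (τ := τ) hF h0.le hk).resolve_left (noQ _ (Or.inr rfl))
      have e1 := s1 (k - 1) (by push_cast; constructor <;> linarith)
      have e2 := s2 k ⟨le_rfl, by linarith⟩
      have e3 := s2 (k + 1) ⟨by linarith, le_rfl⟩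
      rw [e1, e2, e3]
      exact hφ.inner k h0 hk
  · rcases lowered_slab (τ := τ) hF (k := 0) le_rfl (by exact_mod_cast hm) with ⟨Q, hQ, h1, h2⟩ | h
    · have hreg := τ.region (hF.maximal Q hQ)
      have e : τ.left Q = 0 := le_antisymm h1 hreg.zero_le
      obtain ⟨n, hn⟩ := hreg.lower.left
      rw [e] at hn
      refine ⟨n, ?_⟩
      rw [lowered_of_mem hF hQ (Icc_slab_subset h1 h2 ⟨le_rfl, by linarith⟩), hn]
    · obtain ⟨n, hn⟩ := hφ.left
      exact ⟨n, by rw [h _ ⟨le_rfl, by linarith⟩, hn]⟩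
  · rcases lowered_slab (τ := τ) hF (k := m - 1) (by omega) (by omega) with ⟨Q, hQ, h1, h2⟩ | h
    · have hreg := τ.region (hF.maximal Q hQ)
      have e : τ.right Q = m := le_antisymm hreg.le_width (by omega)
      obtain ⟨n, hn⟩ := hreg.lower.right
      rw [e] at hn
      refine ⟨n, ?_⟩
      rw [lowered_of_mem hF hQ (Icc_slab_subset h1 h2 (by push_cast; constructor <;> linarith)), hn]
    · obtain ⟨n, hn⟩ := hφ.right
      exact ⟨n, by rw [h _ (by push_cast; constructor <;> linarith), hn]⟩

/-- The subshape left after removing tiles is the region below the lowered function. -/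
theorem subshape_eq (hF : IsRemovable m φ₀ φ F) (hφ₀ : IsLatticePL 0 m φ₀)
    (hφ : IsLatticePL 0 m φ) (hm : 0 < m) (hle : ∀ x ∈ Icc (0 : ℝ) m, φ₀ x ≤ φ x) :
    closure (stripRegion m φ₀ φ \ ⋃ Q ∈ F, Q) ∪ graphOver m φ₀ =
      stripRegion m φ₀ (τ.lowered F) := by
  have hm' : (0 : ℤ) ≤ m := by omega
  apply Subset.antisymm
  · refine union_subset (closure_minimal ?_ ?_) ?_
    · rintro w ⟨⟨h1, h2, h3, h4⟩, hw⟩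
      refine ⟨h1, h2, h3, ?_⟩
      by_cases h : ∃ Q ∈ F, w.1 ∈ Icc (τ.left Q : ℝ) (τ.right Q)
      · obtain ⟨Q, hQ, hx⟩ := h
        rw [lowered_of_mem hF hQ hx]
        by_contra hlt
        apply hw
        have mQ := hF.maximal Q hQ
        simp only [mem_iUnion]
        refine ⟨Q, hQ, ((τ.region mQ).mem_iff w).2 ⟨hx.1, hx.2, (not_le.1 hlt).le, ?_⟩⟩
        rwa [τ.upper_eq mQ _ hx]
      · rwa [lowered_of_notMem fun Q hQ hx => h ⟨Q, hQ, hx⟩]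
    · rw [stripRegion_eq]
      exact isClosed_regionBetweenGraphs (hφ₀.isSlabAffine.continuousOn hm')
        ((isLatticePL_lowered hF hφ hm).isSlabAffine.continuousOn hm')
    · rintro w ⟨h1, h2, h3⟩
      exact ⟨h1, h2, h3.ge, h3 ▸ le_lowered hF hle ⟨h1, h2⟩⟩
  · rintro ⟨x, y⟩ ⟨h1, h2, h3, h4⟩
    simp only at h1 h2 h3 h4
    rcases h3.eq_or_lt with e | h3
    · exact Or.inr ⟨h1, h2, e.symm⟩
    left
    -- The point itself may lie on the bottom of a removed tile, but points strictly below it on its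
    -- vertical line avoid all tiles and converge to it.
    have hmem : ∀ y' ∈ Ioo (φ₀ x) y, (x, y') ∈ stripRegion m φ₀ φ \ ⋃ Q ∈ F, Q := by
      intro y' hy'
      refine ⟨⟨h1, h2, hy'.1.le, (hy'.2.le.trans h4).trans (lowered_le hF x)⟩, ?_⟩
      simp only [mem_iUnion, not_exists]
      intro Q hQ hmem
      have := ((τ.region (hF.maximal Q hQ)).mem_iff _).1 hmem
      rw [lowered_of_mem hF hQ ⟨this.1, this.2.1⟩] at h4
      exact absurd (h4.trans this.2.2.1) (not_le.2 hy'.2)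
    have hy : y ∈ closure (Ioo (φ₀ x) y) := by
      rw [closure_Ioo h3.ne]; exact ⟨h3.le, le_rfl⟩
    have hc : Continuous fun y' : ℝ => (x, y') := by fun_prop
    exact closure_mono (image_subset_iff.2 hmem)
      (image_closure_subset_closure_image hc ⟨y, hy, rfl⟩)

/-- The tiles can be read off the lowered function: it is strictly below `φ` inside the projection
of a tile and returns to `φ` at each end inside the strip. This fixes the projection, and then the
lower boundary. -/
theorem subset_of_lowered_eq {F' : Finset (Set (ℝ × ℝ))} (hF : IsRemovable m φ₀ φ F)
    (hF' : IsRemovable m φ₀ φ F')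
    (h : ∀ x ∈ Icc (0 : ℝ) m, τ.lowered F x = τ.lowered F' x) : F ⊆ F' := by
  intro Q hQ
  have mQ := hF.maximal Q hQ
  have hreg := τ.region mQ
  have i1 := hreg.lt
  have i2 := hreg.zero_le
  have i3 := hreg.le_width
  have hI : ∀ k : ℤ, 0 ≤ k → k ≤ m → (k : ℝ) ∈ Icc (0 : ℝ) m := fun k h0 h1 =>
    ⟨by exact_mod_cast h0, by exact_mod_cast h1⟩
  -- The midpoint of the first slab of `Q`: the function is lowered here, so some tile of `F'` must
  -- lie over it.
  set x : ℝ := τ.left Q + 1 / 2 with hx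
  have hr : (τ.left Q : ℝ) + 1 ≤ τ.right Q := by exact_mod_cast i1
  have hxQ : x ∈ Ioo (τ.left Q : ℝ) (τ.right Q) := ⟨by linarith, by linarith⟩
  have hx0 : x ∈ Icc (0 : ℝ) m :=
    ⟨(hI (τ.left Q) (by omega) (by omega)).1.trans hxQ.1.le,
      hxQ.2.le.trans (hI (τ.right Q) (by omega) (by omega)).2⟩
  obtain ⟨R, hR, hxR⟩ : ∃ R ∈ F', x ∈ Icc (τ.left R : ℝ) (τ.right R) := by
    by_contra hcon
    have h2 := lowered_of_notMem (τ := τ) (F := F') (x := x) fun R hR hxR => hcon ⟨R, hR, hxR⟩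
    rw [← h x hx0, lowered_of_mem hF hQ (Ioo_subset_Icc_self hxQ)] at h2
    exact (lower_lt mQ hxQ).ne h2
  have mR := hF'.maximal R hR
  have hregR := τ.region mR
  have j1 := hregR.lt
  have j2 := hregR.zero_le
  have j3 := hregR.le_width
  have k1 : τ.left R < τ.left Q + 1 := by
    have : (τ.left R : ℝ) < τ.left Q + 1 := by linarith [hxR.1]
    exact_mod_cast this
  have k2 : τ.left Q < τ.right R := by
    have : (τ.left Q : ℝ) < τ.right R := by linarith [hxR.2]
    exact_mod_cast this
  have strict : ∀ {Q : Set (ℝ × ℝ)} {F : Finset (Set (ℝ × ℝ))}, IsRemovable m φ₀ φ F → Q ∈ F →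
      ∀ k : ℤ, τ.left Q < k → k < τ.right Q → τ.lowered F k < φ k := by
    intro Q F hF hQ k g1 g2
    have hk : (k : ℝ) ∈ Ioo (τ.left Q : ℝ) (τ.right Q) :=
      ⟨by exact_mod_cast g1, by exact_mod_cast g2⟩
    rw [lowered_of_mem hF hQ (Ioo_subset_Icc_self hk)]
    exact lower_lt (hF.maximal Q hQ) hk
  have atLeft : ∀ {Q : Set (ℝ × ℝ)} {F : Finset (Set (ℝ × ℝ))}, IsRemovable m φ₀ φ F → Q ∈ F →
      τ.left Q ≠ 0 → τ.lowered F (τ.left Q) = φ (τ.left Q) := by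
    intro Q F hF hQ h0
    have : (τ.left Q : ℝ) ≤ τ.right Q := by exact_mod_cast (τ.region (hF.maximal Q hQ)).lt.le
    rw [lowered_of_mem hF hQ ⟨le_rfl, this⟩]
    exact lower_left (hF.maximal Q hQ) h0
  have atRight : ∀ {Q : Set (ℝ × ℝ)} {F : Finset (Set (ℝ × ℝ))}, IsRemovable m φ₀ φ F → Q ∈ F →
      τ.right Q ≠ m → τ.lowered F (τ.right Q) = φ (τ.right Q) := by
    intro Q F hF hQ h0
    have : (τ.left Q : ℝ) ≤ τ.right Q := by exact_mod_cast (τ.region (hF.maximal Q hQ)).lt.le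
    rw [lowered_of_mem hF hQ ⟨this, le_rfl⟩]
    exact lower_right (hF.maximal Q hQ) h0
  have el : τ.left R = τ.left Q := by
    by_contra hne
    have s := strict hF' hR (τ.left Q) (by omega) k2
    rw [← h _ (hI _ (by omega) (by omega)), atLeft hF hQ (by omega)] at s
    exact lt_irrefl _ s
  have er : τ.right R = τ.right Q := by
    rcases lt_trichotomy (τ.right R) (τ.right Q) with hlt | he | hlt
    · have s := strict hF hQ (τ.right R) (by omega) hlt
      rw [h _ (hI _ (by omega) (by omega)), atRight hF' hR (by omega)] at s
      exact absurd s (lt_irrefl _)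
    · exact he
    · have s := strict hF' hR (τ.right Q) (by omega) hlt
      rw [← h _ (hI _ (by omega) (by omega)), atRight hF hQ (by omega)] at s
      exact absurd s (lt_irrefl _)
  have : Q = R := by
    ext w
    rw [hreg.mem_iff, hregR.mem_iff, el, er]
    refine and_congr_right fun h1 => and_congr_right fun h2 => ?_
    have hw : w.1 ∈ Icc (0 : ℝ) m :=
      ⟨(hI (τ.left Q) (by omega) (by omega)).1.trans h1,
        h2.trans (hI (τ.right Q) (by omega) (by omega)).2⟩
    rw [τ.upper_eq mQ _ ⟨h1, h2⟩, τ.upper_eq mR _ (by rw [el, er]; exact ⟨h1, h2⟩),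
      ← lowered_of_mem hF hQ ⟨h1, h2⟩, h _ hw,
      lowered_of_mem hF' hR (by rw [el, er]; exact ⟨h1, h2⟩)]
  rwa [this]

theorem stripRegion_injective {f g : ℝ → ℝ} (hf : ∀ x ∈ Icc (0 : ℝ) m, φ₀ x ≤ f x)
    (hg : ∀ x ∈ Icc (0 : ℝ) m, φ₀ x ≤ g x) (h : stripRegion m φ₀ f = stripRegion m φ₀ g) :
    ∀ x ∈ Icc (0 : ℝ) m, f x = g x := by
  intro x hx
  have h1 : (x, f x) ∈ stripRegion m φ₀ g := by
    rw [← h]; exact ⟨hx.1, hx.2, hf x hx, le_rfl⟩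
  have h2 : (x, g x) ∈ stripRegion m φ₀ f := by
    rw [h]; exact ⟨hx.1, hx.2, hg x hx, le_rfl⟩
  exact le_antisymm h1.2.2.2 h2.2.2.2

/-- The removed tiles are determined by the subshape. -/
theorem eq_of_subshape_eq {F' : Finset (Set (ℝ × ℝ))} (hF : IsRemovable m φ₀ φ F)
    (hF' : IsRemovable m φ₀ φ F') (hle : ∀ x ∈ Icc (0 : ℝ) m, φ₀ x ≤ φ x)
    (h : stripRegion m φ₀ (τ.lowered F) = stripRegion m φ₀ (τ.lowered F')) : F = F' := by
  have := stripRegion_injective (fun x hx => le_lowered hF hle hx)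
    (fun x hx => le_lowered hF' hle hx) h
  exact Finset.Subset.antisymm (subset_of_lowered_eq hF hF' this)
    (subset_of_lowered_eq hF' hF fun x hx => (this x hx).symm)

end MaximalTileData

/-! ### Neighbouring triangles and the existence of a maximal tile -/

/-- A point inside the edge `p q` lies in the hull of a set of vertices only if the latter contains
`p`. -/
theorem mem_of_openSegment_mem {p q c : ℤ × ℤ} (h : |det3 p q c| = 1) {X : Finset (ℤ × ℤ)}
    (hX : X ⊆ {p, q, c}) {z : ℝ × ℝ} (hz : z ∈ openSegment ℝ (latticePt p) (latticePt q))
    (hzX : z ∈ latticeHull X) : p ∈ X := by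
  by_contra hp
  have hsub : X ⊆ {q, c} := by
    intro x hx
    have := hX hx
    simp only [Finset.mem_insert, Finset.mem_singleton] at this ⊢
    rcases this with rfl | h | h
    · exact absurd hx hp
    · exact Or.inl h
    · exact Or.inr h
  have h1 := latticeHull_mono hsub hzX
  rw [latticeHull_pair] at h1
  have z1 : ∀ u v : ℤ × ℤ, det3 u v u = 0 := by intro u v; simp [det3]
  have z2 : ∀ u v : ℤ × ℤ, det3 u v v = 0 := by intro u v; simp [det3]; ring
  have s0 : side q c z = 0 := by
    obtain ⟨s, t, -, -, hst, rfl⟩ := h1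
    rw [side_combination hst, z1, z2]; simp
  obtain ⟨s, t, hs, ht, hst, rfl⟩ := hz
  rw [side_combination hst, z1, det3_rotate] at s0
  have hD := sq_det_cast h
  simp only [Int.cast_zero, mul_zero, add_zero, mul_eq_zero] at s0
  rcases s0 with s0 | s0
  · exact hs.ne' s0
  · rw [s0] at hD; simp at hD

/-- Across an edge which passes through the interior there is another triangle. -/
theorem IsPrimitiveTriangulation.exists_neighbour {P : Set (ℝ × ℝ)} {T : Finset (Finset (ℤ × ℤ))}
    (hT : IsPrimitiveTriangulation P T) {p q c : ℤ × ℤ} (h : |det3 p q c| = 1)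
    (hV : {p, q, c} ∈ T) {z : ℝ × ℝ} (hz : z ∈ openSegment ℝ (latticePt p) (latticePt q))
    (hzi : z ∈ interior P) :
    ∃ d, {p, q, d} ∈ T ∧ |det3 p q d| = 1 ∧ det3 p q d = -det3 p q c := by
  classical
  -- By finiteness, a neighbourhood of `z` meets only triangles that contain `z`.
  have hC : IsClosed (⋃ W ∈ T.filter (fun W => z ∉ latticeHull W), latticeHull W) :=
    (Finset.finite_toSet _).isClosed_biUnion fun V _ => isClosed_latticeHull V
  have hH : IsOpen {w | (det3 p q c : ℝ) * side p q w < 0} :=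
    isOpen_lt (continuous_const.mul (continuous_side _ _)) continuous_const
  have hU := isOpen_interior (s := P) |>.inter hC.isOpen_compl
  have hzU : z ∈ interior P ∩ (⋃ W ∈ T.filter (fun W => z ∉ latticeHull W), latticeHull W)ᶜ := by
    refine ⟨hzi, ?_⟩
    simp only [mem_compl_iff, mem_iUnion, Finset.mem_filter, not_exists]
    exact fun W hW hzW => hW.2 hzW
  -- Moving from `z` in the direction away from `c` crosses to the other side of the edge.
  obtain ⟨t, ht, hmem⟩ := exists_pos_add_smul_mem hU hzU (latticePt p - latticePt c)
  have hneg : (det3 p q c : ℝ) * side p q (z + t • (latticePt p - latticePt c)) < 0 := by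
    have e := side_eq_zero_of_mem_openSegment hz
    have : side p q (z + t • (latticePt p - latticePt c)) = side p q z - t * det3 p q c := by
      simp only [side, det3, latticePt, Prod.fst_add, Prod.snd_add, Prod.smul_fst, Prod.smul_snd,
        Prod.fst_sub, Prod.snd_sub, smul_eq_mul]
      push_cast; ring
    have hD := sq_det_cast h
    rw [this, e]
    nlinarith
  obtain ⟨g, hg, ⟨hgP, hgC⟩, hgH⟩ := exists_generic_mem (hU.inter hH) ⟨_, hmem, hneg⟩
  have hgH : (det3 p q c : ℝ) * side p q g < 0 := hgH
  have hgT := subset_closure hgP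
  rw [← hT.2.2] at hgT
  simp only [mem_iUnion, exists_prop] at hgT
  obtain ⟨W, hW, hgW⟩ := hgT
  have hzW : z ∈ latticeHull W := by
    by_contra hzW
    apply hgC
    simp only [mem_iUnion, Finset.mem_filter, exists_prop]
    exact ⟨W, ⟨hW, hzW⟩, hgW⟩
  have hzV := segment_subset_latticeHull (V := {p, q, c}) (by simp) (by simp)
    (openSegment_subset_segment ℝ _ _ hz)
  -- As the triangles meet face to face and `z` is inside the edge, both `p` and `q` are vertices of
  -- `W`.
  have hzI : z ∈ latticeHull ({p, q, c} ∩ W) := by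
    rw [← hT.2.1 _ hV _ hW]; exact ⟨hzV, hzW⟩
  have hpW : p ∈ W :=
    (Finset.mem_inter.1 (mem_of_openSegment_mem h Finset.inter_subset_left hz hzI)).2
  have hqW : q ∈ W := by
    rw [openSegment_symm] at hz
    refine (Finset.mem_inter.1 (mem_of_openSegment_mem (abs_det3_swap h) ?_ hz hzI)).2
    rw [Finset.insert_comm]; exact Finset.inter_subset_left
  obtain ⟨d, rfl, hd⟩ := (hT.1 W hW).exists_third hpW hqW (det3_ne h).1
  refine ⟨d, hW, hd, ?_⟩
  have h3 := ((mem_latticeHull_iff hd g).1 hgW).2.2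
  by_contra hcon
  have : det3 p q d = det3 p q c := by
    rcases eq_or_eq_neg_of_abs_eq hd with e | e <;>
      rcases eq_or_eq_neg_of_abs_eq h with e' | e' <;> omega
  rw [this] at h3
  exact absurd hgH (not_lt.2 h3)

/-- The situation of a shape: two lattice functions on `[0, m]`, the second above the first. -/
structure IsLatticeStrip (m : ℕ) (φ₀ φ : ℝ → ℝ) : Prop where
  pos : 0 < m
  lower : IsLatticePL 0 m φ₀
  upper : IsLatticePL 0 m φ
  le : ∀ x ∈ Icc (0 : ℝ) m, φ₀ x ≤ φ x

namespace IsLatticeStrip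

variable {m : ℕ} {φ₀ φ : ℝ → ℝ} (hS : IsLatticeStrip m φ₀ φ)
include hS

theorem isClosed : IsClosed (stripRegion m φ₀ φ) := by
  have hm : (0 : ℤ) ≤ m := by omega
  rw [stripRegion_eq]
  exact isClosed_regionBetweenGraphs (hS.lower.isSlabAffine.continuousOn hm)
    (hS.upper.isSlabAffine.continuousOn hm)

theorem generic_mem_interior {g : ℝ × ℝ} (hg : g ∈ genericPts) (h : g ∈ stripRegion m φ₀ φ) :
    g ∈ interior (stripRegion m φ₀ φ) := by
  have := hS.pos
  rw [stripRegion_eq] at h ⊢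
  exact generic_mem_interior_regionBetweenGraphs (by omega) hS.lower hS.upper hg h

theorem triangulation_iff (T : Finset (Finset (ℤ × ℤ))) :
    IsPrimitiveTriangulation (stripRegion m φ₀ φ) T ↔ IsGenericTiling (stripRegion m φ₀ φ) T :=
  isPrimitiveTriangulation_iff hS.isClosed (fun _ hg h => hS.generic_mem_interior hg h) T

theorem mem_interior {x y : ℝ} (hx : x ∈ Ioo (0 : ℝ) m) (h1 : φ₀ x < y) (h2 : y < φ x) :
    (x, y) ∈ interior (stripRegion m φ₀ φ) := by
  have hm : (0 : ℤ) ≤ m := by omega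
  rw [stripRegion_eq]
  exact mem_interior_regionBetweenGraphs (hS.lower.isSlabAffine.continuousOn hm)
    (hS.upper.isSlabAffine.continuousOn hm) (by simpa using hx.1) (by simpa using hx.2) h1 h2

theorem mem_closure_interior {x y : ℝ} (hx : x ∈ Ioo (0 : ℝ) m) (h : φ₀ x < φ x)
    (hy : y ∈ Icc (φ₀ x) (φ x)) : (x, y) ∈ closure (interior (stripRegion m φ₀ φ)) := by
  rw [← closure_Ioo h.ne] at hy
  have hc : Continuous fun y' : ℝ => (x, y') := by fun_prop
  refine closure_mono (image_subset_iff.2 fun y' hy' => ?_)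
    (image_closure_subset_closure_image hc ⟨y, hy, rfl⟩)
  exact hS.mem_interior hx hy'.1 hy'.2

theorem closure_interior_subset :
    closure (interior (stripRegion m φ₀ φ)) ⊆ stripRegion m φ₀ φ :=
  closure_minimal interior_subset hS.isClosed

variable {T : Finset (Finset (ℤ × ℤ))} (hT : IsPrimitiveTriangulation (stripRegion m φ₀ φ) T)
include hT

theorem latticeHull_subset {V : Finset (ℤ × ℤ)} (hV : V ∈ T) :
    latticeHull V ⊆ stripRegion m φ₀ φ :=
  (hT.latticeHull_subset hV).trans hS.closure_interior_subset

theorem unionOfHulls_subset {D : Finset (Finset (ℤ × ℤ))} (hD : D ⊆ T) :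
    unionOfHulls D ⊆ stripRegion m φ₀ φ :=
  iUnion₂_subset fun _ hV => hS.latticeHull_subset hT (hD hV)

theorem exists_mem_of_mem_Icc {x y : ℝ} (hx : x ∈ Ioo (0 : ℝ) m) (h : φ₀ x < φ x)
    (hy : y ∈ Icc (φ₀ x) (φ x)) : ∃ V ∈ T, (x, y) ∈ latticeHull V := by
  have := hS.mem_closure_interior hx h hy
  rw [← hT.2.2] at this
  simpa using this

/-- Every triangle of a triangulation belongs to a tile made of triangles of the triangulation. -/
theorem exists_tile_of_mem {V : Finset (ℤ × ℤ)} (hV : V ∈ T) :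
    ∃ D, IsTileTriangles m D ∧ V ∈ D ∧ D ⊆ T := by
  by_cases hv : ∀ p ∈ V, ∀ q ∈ V, p.1 = q.1 → p ≠ q → p.1 = 0 ∨ p.1 = (m : ℤ)
  · exact ⟨{V}, Or.inl ⟨V, rfl, hT.1 V hV, hv⟩, by simp, by simpa using hV⟩
  push Not at hv
  have key : ∀ p q : ℤ × ℤ, q.2 = p.2 + 1 → p ∈ V → q ∈ V → p.1 = q.1 → p ≠ q → p.1 ≠ 0 →
      p.1 ≠ m → ∃ D, IsTileTriangles m D ∧ V ∈ D ∧ D ⊆ T := by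
    intro p q hy hp hq h1 hne h0 hm
    have pS := hS.latticeHull_subset hT hV (latticePt_mem_latticeHull hp)
    have qS := hS.latticeHull_subset hT hV (latticePt_mem_latticeHull hq)
    obtain ⟨c, rfl, hd⟩ := (hT.1 V hV).exists_third hp hq hne
    have p0 : (0 : ℝ) < p.1 := by
      refine lt_of_le_of_ne pS.1 fun e => h0 ?_
      have e' : ((0 : ℤ) : ℝ) = (p.1 : ℝ) := by push_cast; exact e
      exact_mod_cast e'.symm
    have pm : (p.1 : ℝ) < m := by
      refine lt_of_le_of_ne pS.2.1 fun e => hm ?_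
      have e' : (p.1 : ℝ) = ((m : ℤ) : ℝ) := by push_cast; exact e
      exact_mod_cast e'
    have hq1 : (q.1 : ℝ) = p.1 := by rw [h1]
    have hq2 : (q.2 : ℝ) = p.2 + 1 := by rw [hy]; push_cast; rfl
    have hlo : φ₀ p.1 ≤ p.2 := pS.2.2.1
    have hhi : (p.2 : ℝ) + 1 ≤ φ p.1 := by
      have : (q.2 : ℝ) ≤ φ q.1 := qS.2.2.2
      rwa [hq1, hq2] at this
    -- The midpoint of the unit vertical side is interior to the shape, so there is a triangle
    -- across this side.
    have hz : ((p.1 : ℝ), (p.2 : ℝ) + 1 / 2) ∈ openSegment ℝ (latticePt p) (latticePt q) := by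
      refine ⟨2⁻¹, 2⁻¹, by norm_num, by norm_num, by norm_num, ?_⟩
      ext
      · simp only [latticePt, Prod.fst_add, Prod.smul_fst, smul_eq_mul, hq1]; ring
      · simp only [latticePt, Prod.snd_add, Prod.smul_snd, smul_eq_mul, hq2]; ring
    obtain ⟨d, hdT, hd', hdc⟩ := hT.exists_neighbour hd hV hz
      (hS.mem_interior ⟨p0, pm⟩ (by linarith) (by linarith))
    have e := (det3_of_vertical h1 hd).2
    have e' := (det3_of_vertical h1 hd').2
    have hside : d.1 - p.1 = -(c.1 - p.1) := by
      simp only [det3, h1, hy] at hdc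
      rw [h1]; linarith
    obtain ⟨k, y⟩ := p
    obtain ⟨k', y'⟩ := q
    obtain ⟨i, a⟩ := c
    obtain ⟨i', b⟩ := d
    simp only at h1 hy e e' hside
    subst h1 hy
    rcases e with rfl | rfl
    · obtain rfl : i' = k + 1 := by omega
      exact ⟨_, Or.inr ⟨k, y, a, b, rfl⟩, by simp, Finset.insert_subset hV (by simpa using hdT)⟩
    · obtain rfl : i' = k - 1 := by omega
      exact ⟨_, Or.inr ⟨k, y, b, a, rfl⟩, by simp, Finset.insert_subset hdT (by simpa using hV)⟩
  obtain ⟨p, hp, q, hq, h1, hne, h0, hm⟩ := hv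
  obtain ⟨c, -, hd⟩ := (hT.1 V hV).exists_third hp hq hne
  rcases (det3_of_vertical h1 hd).1 with e | e
  · exact key p q e hp hq h1 hne h0 hm
  · exact key q p e hq hp h1.symm hne.symm (h1 ▸ h0) (h1 ▸ hm)

omit hS hT in
theorem isMaximalTile_of_upper_eq {D : Finset (Finset (ℤ × ℤ))} (hD : IsTileTriangles m D)
    (hsub : unionOfHulls D ⊆ stripRegion m φ₀ φ) {l r : ℤ} {lo up : ℝ → ℝ}
    (hreg : IsLatticeRegion (unionOfHulls D) l r lo up)
    (h : ∀ x ∈ Icc (l : ℝ) r, up x = φ x) :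
    IsMaximalTile m (stripRegion m φ₀ φ) (unionOfHulls D) := by
  refine ⟨hD.isPrimitiveTile, hsub, fun w hw => ⟨hsub hw.1, fun y' hy' hmem => ?_⟩⟩
  obtain ⟨h1, h2, h3, h4⟩ := (hreg.mem_iff w).1 hw.1
  refine hw.2 y' hy' ((hreg.mem_iff _).2 ⟨h1, h2, h3.trans hy'.le, ?_⟩)
  rw [h _ ⟨h1, h2⟩]
  exact hmem.2.2.2

omit hT in
-- On a slab the nonnegative affine function `φ - φ₀` vanishes identically as soon as it vanishes at
-- the midpoint, so positive height can be tested at midpoints.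
theorem exists_slab_lt (hne : stripRegion m φ₀ φ ≠ graphOver m φ₀) :
    ∃ k : ℤ, 0 ≤ k ∧ k < m ∧ φ₀ (k + 1 / 2) < φ (k + 1 / 2) := by
  by_contra! hcon
  apply hne
  have hpos := hS.pos
  have heq : ∀ x ∈ Icc (0 : ℝ) m, φ x - φ₀ x = 0 := by
    intro x hx
    obtain ⟨k, k1, k2, k3⟩ := exists_slab (l := 0) (r := m) (x := x) (by omega)
      (by simpa using hx.1) (by simpa using hx.2)
    have hsub : Icc (k : ℝ) (k + 1) ⊆ Icc (0 : ℝ) m := by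
      have := MaximalTileData.Icc_slab_subset k1 k2
      simpa using this
    refine (hS.upper.isSlabAffine.sub hS.lower.isSlabAffine).eq_zero_on_slab k1 k2
      (fun y hy => sub_nonneg.2 (hS.le y (hsub hy))) (x₀ := k + 1 / 2)
      ⟨by linarith, by linarith⟩ ?_ x k3
    exact sub_eq_zero.2 (le_antisymm (hcon k k1 k2)
      (hS.le _ (hsub ⟨by linarith, by linarith⟩)))
  ext w
  constructor
  · rintro ⟨h1, h2, h3, h4⟩
    refine ⟨h1, h2, le_antisymm ?_ h3⟩
    have := heq w.1 ⟨h1, h2⟩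
    linarith
  · rintro ⟨h1, h2, h3⟩
    exact ⟨h1, h2, h3.ge, h3.le.trans (hS.le _ ⟨h1, h2⟩)⟩

/-- Every triangulation contains a maximal tile. -/
theorem exists_maximalTile (hne : stripRegion m φ₀ φ ≠ graphOver m φ₀) :
    ∃ D, IsTileTriangles m D ∧ D ⊆ T ∧
      IsMaximalTile m (stripRegion m φ₀ φ) (unionOfHulls D) := by
  have hstrip : ∀ {D}, D ⊆ T → ∀ w ∈ unionOfHulls D, 0 ≤ w.1 ∧ w.1 ≤ m := fun hD w hw =>
    ⟨(hS.unionOfHulls_subset hT hD hw).1, (hS.unionOfHulls_subset hT hD hw).2.1⟩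
  have hbound : ∀ {D l r lo up}, D ⊆ T → IsTileRegion m (unionOfHulls D) l r lo up →
      ∀ x ∈ Icc (l : ℝ) r, φ₀ x ≤ lo x ∧ up x ≤ φ x := by
    intro D l r lo up hD h x hx
    have h1 := hS.unionOfHulls_subset hT hD
      ((h.mem_iff (x, lo x)).2 ⟨hx.1, hx.2, le_rfl, h.lower_le_upper x hx⟩)
    have h2 := hS.unionOfHulls_subset hT hD
      ((h.mem_iff (x, up x)).2 ⟨hx.1, hx.2, h.lower_le_upper x hx, le_rfl⟩)
    exact ⟨h1.2.2.1, h2.2.2.2⟩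
  -- the top tile over a slab
  have htop : ∀ k : ℤ, 0 ≤ k → k < m → φ₀ (k + 1 / 2) < φ (k + 1 / 2) →
      ∃ D l r lo up, IsTileTriangles m D ∧ D ⊆ T ∧ IsTileRegion m (unionOfHulls D) l r lo up ∧
        l ≤ k ∧ k < r ∧ up (k + 1 / 2) = φ (k + 1 / 2) := by
    intro k k0 km hlt
    have k0' : (0 : ℝ) ≤ k := by exact_mod_cast k0
    have km' : (k : ℝ) + 1 ≤ m := by exact_mod_cast km
    obtain ⟨V, hV, hzV⟩ := hS.exists_mem_of_mem_Icc hT (x := k + 1 / 2)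
      ⟨by linarith, by linarith⟩ hlt ⟨hlt.le, le_rfl⟩
    obtain ⟨D, hD, hVD, hDT⟩ := hS.exists_tile_of_mem hT hV
    obtain ⟨l, r, lo, up, h⟩ := hD.exists_region (hstrip hDT)
    have hz := (h.mem_iff _).1 (mem_unionOfHulls.2 ⟨V, hVD, hzV⟩)
    have hl : l < k + 1 := by
      have : (l : ℝ) < k + 1 := by linarith [hz.1]
      exact_mod_cast this
    have hr : k < r := by
      have : (k : ℝ) < r := by linarith [hz.2.1]
      exact_mod_cast this
    exact ⟨D, l, r, lo, up, hD, hDT, h, by omega, hr,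
      le_antisymm (hbound hDT h _ ⟨hz.1, hz.2.1⟩).2 hz.2.2.2⟩
  have hslab : ∀ {D l r lo up}, D ⊆ T → IsTileRegion m (unionOfHulls D) l r lo up →
      ∀ k, l ≤ k → k < r → up (k + 1 / 2) = φ (k + 1 / 2) →
      ∀ x ∈ Icc (k : ℝ) (k + 1), up x = φ x := by
    intro D l r lo up hD h k h1 h2 h3 x hx
    have := ((hS.upper.isSlabAffine.mono h.zero_le h.le_width).sub
      h.upper.isSlabAffine).eq_zero_on_slab h1 h2 (fun y hy => sub_nonneg.2
        (hbound hD h y (MaximalTileData.Icc_slab_subset h1 h2 hy)).2) (x₀ := k + 1 / 2)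
        ⟨by linarith, by linarith⟩ (sub_eq_zero.2 h3.symm) x hx
    linarith
  have hmid : ∀ {D l r lo up}, D ⊆ T → IsTileRegion m (unionOfHulls D) l r lo up →
      ∀ k : ℤ, l ≤ k → k < r → φ₀ (k + 1 / 2) < φ (k + 1 / 2) := by
    intro D l r lo up hD h k h1 h2
    have h1' : (l : ℝ) ≤ k := by exact_mod_cast h1
    have h2' : (k : ℝ) + 1 ≤ r := by exact_mod_cast h2
    have hx : (k : ℝ) + 1 / 2 ∈ Ioo (l : ℝ) r := ⟨by linarith, by linarith⟩
    have hb := hbound hD h _ (Ioo_subset_Icc_self hx)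
    exact (hb.1.trans_lt (h.lower_lt_upper _ hx)).trans_le hb.2
  -- Over the leftmost slab of positive height, the top tile cannot begin earlier: a tile has
  -- positive height over each of its slabs.
  have hstart : ∃ k : ℤ, ∃ D r lo up, IsTileTriangles m D ∧ D ⊆ T ∧
      IsTileRegion m (unionOfHulls D) k r lo up ∧ up (k + 1 / 2) = φ (k + 1 / 2) := by
    obtain ⟨k, ⟨k0, km, hk⟩, hmin⟩ := Int.exists_least_of_bdd
      (P := fun k : ℤ => 0 ≤ k ∧ k < m ∧ φ₀ (k + 1 / 2) < φ (k + 1 / 2))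
      ⟨0, fun z hz => hz.1⟩ (hS.exists_slab_lt hne)
    obtain ⟨D, l, r, lo, up, hD, hDT, h, hl, hr, hup⟩ := htop k k0 km hk
    have := h.zero_le
    have := hmin l ⟨h.zero_le, by omega, hmid hDT h l le_rfl h.lt⟩
    obtain rfl : l = k := by omega
    exact ⟨l, D, r, lo, up, hD, hDT, h, hup⟩
  -- Among the tiles reaching `φ` over their own first slab, one whose left end is as far right as
  -- possible.
  obtain ⟨l, ⟨D, r, lo, up, hD, hDT, h, hup⟩, hmax⟩ := Int.exists_greatest_of_bdd
    ⟨m, fun z hz => by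
      obtain ⟨D, r, lo, up, hD, hDT, h, hup⟩ := hz
      have := h.lt
      have := h.le_width
      omega⟩ hstart
  refine ⟨D, hD, hDT, ?_⟩
  have hall : ∀ k, l ≤ k → k < r → up (k + 1 / 2) = φ (k + 1 / 2) := by
    intro k hk
    induction k, hk using Int.leInduction with
    | base => intro _; exact hup
    | succ k hk ih =>
      intro hkr
      have hkm := h.le_width
      have hk0 := h.zero_le
      obtain ⟨D', l', r', lo', up', hD', hDT', h', hl', hr', hup'⟩ := htop (k + 1) (by omega)
        (by omega) (hmid hDT h (k + 1) (by omega) hkr)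
      -- A top tile beginning at `k + 1` contradicts the choice of `l`; otherwise `k + 1` is an
      -- inner abscissa of both tiles and both reach `φ` there.
      rcases hl'.eq_or_lt with e | hl'
      · subst e
        have := hmax (k + 1) ⟨D', r', lo', up', hD', hDT', h', hup'⟩
        omega
      have e1 := hslab hDT h k hk (by omega) (ih (by omega)) (k + 1) ⟨by linarith, le_rfl⟩
      have e2 := hslab hDT' h' (k + 1) hl'.le hr' hup' (k + 1)
        (by push_cast; constructor <;> linarith)
      have x1 : (k : ℝ) + 1 ∈ Ioo (l : ℝ) r :=
        ⟨by exact_mod_cast (by omega : l < k + 1), by exact_mod_cast hkr⟩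
      have x2 : (k : ℝ) + 1 ∈ Ioo (l' : ℝ) r' := ⟨by exact_mod_cast hl', by exact_mod_cast hr'⟩
      obtain ⟨g, hg, hg1, hg2⟩ := exists_generic_mem (isOpen_interior.inter isOpen_interior)
        (h.overlap h'.toIsLatticeRegion x1 x2 (e1.trans e2.symm))
      obtain ⟨V, hV, hgV⟩ := mem_unionOfHulls.1 (interior_subset hg1)
      obtain ⟨W, hW, hgW⟩ := mem_unionOfHulls.1 (interior_subset hg2)
      have hVW := hT.eq_of_generic (hDT hV) (hDT' hW) hg hgV hgW
      have : D = D' := hD.eq_of_mem hD' (hstrip hDT) (hstrip hDT')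
        ((hS.triangulation_iff T).1 hT) hDT hDT' hV (hVW ▸ hW)
      subst this
      -- The functions `up` and `up'` were chosen separately for the same set, so they are compared
      -- through membership.
      refine le_antisymm (hbound hDT h _ ?_).2 ?_
      · refine MaximalTileData.Icc_slab_subset (by omega : l ≤ k + 1) hkr ⟨?_, ?_⟩ <;> linarith
      · have hx2 : ((k + 1 : ℤ) : ℝ) + 1 / 2 ∈ Icc (l' : ℝ) r' :=
          MaximalTileData.Icc_slab_subset hl'.le hr' ⟨by linarith, by linarith⟩
        rw [← hup']
        exact ((h.mem_iff _).1 ((h'.mem_iff (((k + 1 : ℤ) : ℝ) + 1 / 2, _)).2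
          ⟨hx2.1, hx2.2, h'.lower_le_upper _ hx2, le_rfl⟩)).2.2.2
  refine isMaximalTile_of_upper_eq hD (hS.unionOfHulls_subset hT hDT) h.toIsLatticeRegion ?_
  intro x hx
  obtain ⟨k, k1, k2, k3⟩ := exists_slab h.lt hx.1 hx.2
  exact hslab hDT h k k1 k2 (hall k k1 k2) x k3

end IsLatticeStrip

/-! ### Triangulations of a shape and of its subshapes -/

namespace MaximalTileData

variable {m : ℕ} {φ₀ φ : ℝ → ℝ} {τ : MaximalTileData m φ₀ φ} {F : Finset (Set (ℝ × ℝ))}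

theorem isLatticeStrip_lowered (hS : IsLatticeStrip m φ₀ φ) (hF : IsRemovable m φ₀ φ F) :
    IsLatticeStrip m φ₀ (τ.lowered F) :=
  ⟨hS.pos, hS.lower, isLatticePL_lowered hF hS.upper hS.pos, fun _ hx => le_lowered hF hS.le hx⟩

theorem stripRegion_lowered_subset (hF : IsRemovable m φ₀ φ F) :
    stripRegion m φ₀ (τ.lowered F) ⊆ stripRegion m φ₀ φ :=
  fun w hw => ⟨hw.1, hw.2.1, hw.2.2.1, hw.2.2.2.trans (lowered_le hF w.1)⟩

/-- A generic point is never on the common boundary of a tile and the remainder, so on generic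
points the subshape is the plain set difference, without closures. -/
theorem generic_mem_lowered_iff (hF : IsRemovable m φ₀ φ F) {g : ℝ × ℝ} (hg : g ∈ genericPts) :
    g ∈ stripRegion m φ₀ (τ.lowered F) ↔ g ∈ stripRegion m φ₀ φ ∧ ∀ Q ∈ F, g ∉ Q := by
  constructor
  · intro h
    refine ⟨stripRegion_lowered_subset hF h, fun Q hQ hgQ => ?_⟩
    have hreg := τ.region (hF.maximal Q hQ)
    obtain ⟨h1, h2, h3, h4⟩ := (hreg.mem_iff g).1 hgQ
    have := h.2.2.2
    rw [lowered_of_mem hF hQ ⟨h1, h2⟩] at this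
    exact hreg.lower.generic_ne hreg.lt hg h1 h2 (le_antisymm this h3)
  · rintro ⟨⟨h1, h2, h3, h4⟩, hno⟩
    refine ⟨h1, h2, h3, ?_⟩
    by_cases h : ∃ Q ∈ F, g.1 ∈ Icc (τ.left Q : ℝ) (τ.right Q)
    · obtain ⟨Q, hQ, hx⟩ := h
      rw [lowered_of_mem hF hQ hx]
      by_contra hlt
      have hreg := τ.region (hF.maximal Q hQ)
      refine hno Q hQ ((hreg.mem_iff g).2 ⟨hx.1, hx.2, (not_le.1 hlt).le, ?_⟩)
      rwa [τ.upper_eq (hF.maximal Q hQ) _ hx]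
    · rwa [lowered_of_notMem fun Q hQ hx => h ⟨Q, hQ, hx⟩]

variable (τ) in
/-- The triangles of the tiles in `F`. -/
def removedTriangles (F : Finset (Set (ℝ × ℝ))) : Finset (Finset (ℤ × ℤ)) :=
  F.biUnion τ.triangles

theorem mem_removedTriangles {V : Finset (ℤ × ℤ)} :
    V ∈ τ.removedTriangles F ↔ ∃ Q ∈ F, V ∈ τ.triangles Q := by
  simp [removedTriangles]

theorem latticeHull_subset_tile {Q : Set (ℝ × ℝ)}
    (hQ : IsMaximalTile m (stripRegion m φ₀ φ) Q) {V : Finset (ℤ × ℤ)} (hV : V ∈ τ.triangles Q) :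
    latticeHull V ⊆ Q := by
  intro w hw
  rw [← τ.union_eq hQ]
  exact mem_unionOfHulls.2 ⟨V, hV, hw⟩

theorem strip_of_maximal {Q : Set (ℝ × ℝ)} (hQ : IsMaximalTile m (stripRegion m φ₀ φ) Q) :
    ∀ w ∈ unionOfHulls (τ.triangles Q), 0 ≤ w.1 ∧ w.1 ≤ m := by
  rw [τ.union_eq hQ]
  exact fun w hw => ⟨(hQ.2.1 hw).1, (hQ.2.1 hw).2.1⟩

/-- A tiling of the subshape and the removed tiles give a tiling of the shape. -/
theorem isGenericTiling_union (hF : IsRemovable m φ₀ φ F) {T : Finset (Finset (ℤ × ℤ))}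
    (hT : IsGenericTiling (stripRegion m φ₀ (τ.lowered F)) T) :
    IsGenericTiling (stripRegion m φ₀ φ) (T ∪ τ.removedTriangles F) := by
  have hcross : ∀ V ∈ T, ∀ W ∈ τ.removedTriangles F, ∀ g ∈ genericPts, g ∈ latticeHull V →
      g ∉ latticeHull W := by
    intro V hV W hW g hg hgV hgW
    obtain ⟨Q, hQ, hWQ⟩ := mem_removedTriangles.1 hW
    exact ((generic_mem_lowered_iff hF hg).1 (hT.subset V hV g hg hgV)).2 Q hQ
      (latticeHull_subset_tile (hF.maximal Q hQ) hWQ hgW)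
  refine ⟨fun V hV => ?_, fun V hV g hg hgV => ?_, fun g hg hgS => ?_,
    fun V hV W hW g hg hgV hgW => ?_⟩
  · rcases Finset.mem_union.1 hV with hV | hV
    · exact hT.primitive V hV
    · obtain ⟨Q, hQ, hVQ⟩ := mem_removedTriangles.1 hV
      exact (τ.isTile (hF.maximal Q hQ)).primitive hVQ
  · rcases Finset.mem_union.1 hV with hV | hV
    · exact stripRegion_lowered_subset hF (hT.subset V hV g hg hgV)
    · obtain ⟨Q, hQ, hVQ⟩ := mem_removedTriangles.1 hV
      exact (hF.maximal Q hQ).2.1 (latticeHull_subset_tile (hF.maximal Q hQ) hVQ hgV)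
  · by_cases h : ∃ Q ∈ F, g ∈ Q
    · obtain ⟨Q, hQ, hgQ⟩ := h
      rw [← τ.union_eq (hF.maximal Q hQ)] at hgQ
      obtain ⟨V, hV, hgV⟩ := mem_unionOfHulls.1 hgQ
      exact ⟨V, Finset.mem_union_right _ (mem_removedTriangles.2 ⟨Q, hQ, hV⟩), hgV⟩
    · obtain ⟨V, hV, hgV⟩ := hT.cover g hg
        ((generic_mem_lowered_iff hF hg).2 ⟨hgS, fun Q hQ hgQ => h ⟨Q, hQ, hgQ⟩⟩)
      exact ⟨V, Finset.mem_union_left _ hV, hgV⟩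
  · rcases Finset.mem_union.1 hV with hV | hV <;> rcases Finset.mem_union.1 hW with hW | hW
    · exact hT.unique V hV W hW g hg hgV hgW
    · exact absurd hgW (hcross V hV W hW g hg hgV)
    · exact absurd hgV (hcross W hW V hV g hg hgW)
    · obtain ⟨Q, hQ, hVQ⟩ := mem_removedTriangles.1 hV
      obtain ⟨R, hR, hWR⟩ := mem_removedTriangles.1 hW
      have mQ := hF.maximal Q hQ
      have mR := hF.maximal R hR
      have hQR : Q = R := by
        by_contra hne
        refine Set.disjoint_left.1 (hF.disjoint Q hQ R hR hne)
          (interior_mono (latticeHull_subset_tile mQ hVQ)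
            (generic_mem_interior ((τ.isTile mQ).primitive hVQ) hg hgV))
          (interior_mono (latticeHull_subset_tile mR hWR)
            (generic_mem_interior ((τ.isTile mR).primitive hWR) hg hgW))
      subst hQR
      exact (τ.isTile mQ).eq_of_generic hVQ hWR hg hgV hgW

theorem disjoint_removedTriangles (hF : IsRemovable m φ₀ φ F) {T : Finset (Finset (ℤ × ℤ))}
    (hT : IsGenericTiling (stripRegion m φ₀ (τ.lowered F)) T) :
    Disjoint T (τ.removedTriangles F) := by
  rw [Finset.disjoint_left]
  intro V hV hV'
  obtain ⟨Q, hQ, hVQ⟩ := mem_removedTriangles.1 hV'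
  obtain ⟨g, hg, hgV⟩ := exists_generic_mem_latticeHull (hT.primitive V hV)
  exact ((generic_mem_lowered_iff hF hg).1 (hT.subset V hV g hg hgV)).2 Q hQ
    (latticeHull_subset_tile (hF.maximal Q hQ) hVQ hgV)

/-- Removing tiles from a tiling of the shape gives a tiling of the subshape. -/
theorem isGenericTiling_sdiff (hF : IsRemovable m φ₀ φ F) {T : Finset (Finset (ℤ × ℤ))}
    (hT : IsGenericTiling (stripRegion m φ₀ φ) T) (hFT : τ.removedTriangles F ⊆ T) :
    IsGenericTiling (stripRegion m φ₀ (τ.lowered F)) (T \ τ.removedTriangles F) := by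
  refine ⟨fun V hV => hT.primitive V (Finset.mem_sdiff.1 hV).1, fun V hV g hg hgV => ?_,
    fun g hg hgS => ?_, fun V hV W hW => hT.unique V (Finset.mem_sdiff.1 hV).1 W
      (Finset.mem_sdiff.1 hW).1⟩
  · obtain ⟨hV, hVF⟩ := Finset.mem_sdiff.1 hV
    refine (generic_mem_lowered_iff hF hg).2 ⟨hT.subset V hV g hg hgV, fun Q hQ hgQ => hVF ?_⟩
    rw [← τ.union_eq (hF.maximal Q hQ)] at hgQ
    obtain ⟨W, hW, hgW⟩ := mem_unionOfHulls.1 hgQ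
    have hWF : W ∈ τ.removedTriangles F := mem_removedTriangles.2 ⟨Q, hQ, hW⟩
    rwa [hT.unique V hV W (hFT hWF) g hg hgV hgW]
  · obtain ⟨hgS, hno⟩ := (generic_mem_lowered_iff hF hg).1 hgS
    obtain ⟨V, hV, hgV⟩ := hT.cover g hg hgS
    refine ⟨V, Finset.mem_sdiff.2 ⟨hV, fun hVF => ?_⟩, hgV⟩
    obtain ⟨Q, hQ, hVQ⟩ := mem_removedTriangles.1 hVF
    exact hno Q hQ (latticeHull_subset_tile (hF.maximal Q hQ) hVQ hgV)

/-- Maximal tiles which occur in the same triangulation do not overlap. -/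
theorem isRemovable_of_subset {T : Finset (Finset (ℤ × ℤ))}
    (hT : IsGenericTiling (stripRegion m φ₀ φ) T)
    (hF : ∀ Q ∈ F, IsMaximalTile m (stripRegion m φ₀ φ) Q) (hFT : ∀ Q ∈ F, τ.triangles Q ⊆ T) :
    IsRemovable m φ₀ φ F := by
  refine ⟨hF, fun Q hQ R hR hne => ?_⟩
  by_contra hdis
  obtain ⟨g, hg, hgQ, hgR⟩ := exists_generic_mem (isOpen_interior.inter isOpen_interior)
    (Set.not_disjoint_iff_nonempty_inter.1 hdis)
  have hgQ := interior_subset hgQ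
  have hgR := interior_subset hgR
  rw [← τ.union_eq (hF Q hQ)] at hgQ
  rw [← τ.union_eq (hF R hR)] at hgR
  obtain ⟨V, hV, hgV⟩ := mem_unionOfHulls.1 hgQ
  obtain ⟨W, hW, hgW⟩ := mem_unionOfHulls.1 hgR
  have hVW := hT.unique V (hFT Q hQ hV) W (hFT R hR hW) g hg hgV hgW
  have := (τ.isTile (hF Q hQ)).eq_of_mem (τ.isTile (hF R hR)) (strip_of_maximal (hF Q hQ))
    (strip_of_maximal (hF R hR)) hT (hFT Q hQ) (hFT R hR) hV (hVW ▸ hW)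
  exact hne (by rw [← τ.union_eq (hF Q hQ), ← τ.union_eq (hF R hR), this])

end MaximalTileData

/-! ### Full interior edges -/

theorem fst_image_segment_eq_Icc_iff {m : ℕ} (hm : 0 < m) (p q : ℤ × ℤ) :
    Prod.fst '' segment ℝ (latticePt p) (latticePt q) = Icc (0 : ℝ) m ↔
      (p.1 = 0 ∧ q.1 = m) ∨ (q.1 = 0 ∧ p.1 = m) := by
  have hm' : (0 : ℝ) < m := by exact_mod_cast hm
  have lt_case : ∀ p q : ℤ × ℤ, p.1 < q.1 →
      Prod.fst '' segment ℝ (latticePt p) (latticePt q) = Icc (p.1 : ℝ) q.1 := by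
    intro p q h
    ext x
    constructor
    · rintro ⟨w, hw, rfl⟩
      obtain ⟨h1, h2, -⟩ := (mem_segment_iff_lineThrough h w).1 hw
      exact ⟨h1, h2⟩
    · rintro ⟨h1, h2⟩
      exact ⟨(x, lineThrough p q x), (mem_segment_iff_lineThrough h _).2 ⟨h1, h2, rfl⟩, rfl⟩
  have Icc_case : ∀ p q : ℤ × ℤ, p.1 < q.1 →
      (Icc (p.1 : ℝ) q.1 = Icc (0 : ℝ) m ↔ p.1 = 0 ∧ q.1 = m) := by
    intro p q h
    constructor
    · intro he
      have := (Icc_eq_Icc_iff (by exact_mod_cast h.le : (p.1 : ℝ) ≤ q.1)).1 he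
      exact ⟨by exact_mod_cast this.1, by exact_mod_cast this.2⟩
    · rintro ⟨h1, h2⟩
      rw [h1, h2]; simp
  rcases lt_trichotomy p.1 q.1 with h | h | h
  · rw [lt_case p q h, Icc_case p q h]
    omega
  · constructor
    · intro he
      exfalso
      have hconst : ∀ w ∈ segment ℝ (latticePt p) (latticePt q), w.1 = p.1 := by
        rintro w ⟨s, t, -, -, hst, rfl⟩
        simp only [latticePt, Prod.fst_add, Prod.smul_fst, smul_eq_mul, ← h]
        rw [← add_mul, hst, one_mul]
      have h0 : (0 : ℝ) ∈ Icc (0 : ℝ) m := ⟨le_rfl, hm'.le⟩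
      have h1 : (m : ℝ) ∈ Icc (0 : ℝ) m := ⟨hm'.le, le_rfl⟩
      rw [← he] at h0 h1
      obtain ⟨w, hw, e⟩ := h0
      obtain ⟨w', hw', e'⟩ := h1
      rw [hconst w hw] at e
      rw [hconst w' hw', e] at e'
      exact hm'.ne e'
    · omega
  · rw [segment_symm, lt_case q p h, Icc_case q p h]
    omega

/-- Edges lie in `P`, so a point of an edge outside the frontier is an interior point of `P`. The
edge can also be oriented from the left boundary line to the right one. -/
theorem hasFullInteriorEdge_iff {m : ℕ} (hm : 0 < m) {P : Set (ℝ × ℝ)}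
    {T : Finset (Finset (ℤ × ℤ))} (hT : ∀ V ∈ T, latticeHull V ⊆ P) :
    HasFullInteriorEdge m P T ↔ ∃ V ∈ T, ∃ p ∈ V, ∃ q ∈ V, p.1 = 0 ∧ q.1 = m ∧
      ∃ z ∈ segment ℝ (latticePt p) (latticePt q), z ∈ interior P := by
  have key : ∀ V ∈ T, ∀ p ∈ V, ∀ q ∈ V, ¬segment ℝ (latticePt p) (latticePt q) ⊆ frontier P →
      ∃ z ∈ segment ℝ (latticePt p) (latticePt q), z ∈ interior P := by
    intro V hV p hp q hq h
    obtain ⟨z, hz, hzf⟩ := Set.not_subset.1 h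
    refine ⟨z, hz, ?_⟩
    by_contra hzi
    exact hzf ⟨subset_closure (hT V hV (segment_subset_latticeHull hp hq hz)), hzi⟩
  constructor
  · rintro ⟨V, hV, p, hp, q, hq, h1, h2⟩
    rcases (fst_image_segment_eq_Icc_iff hm p q).1 h1 with ⟨e1, e2⟩ | ⟨e1, e2⟩
    · exact ⟨V, hV, p, hp, q, hq, e1, e2, key V hV p hp q hq h2⟩
    · rw [segment_symm] at h2
      exact ⟨V, hV, q, hq, p, hp, e1, e2, key V hV q hq p hp h2⟩
  · rintro ⟨V, hV, p, hp, q, hq, e1, e2, z, hz, hzi⟩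
    exact ⟨V, hV, p, hp, q, hq, (fst_image_segment_eq_Icc_iff hm p q).2 (Or.inl ⟨e1, e2⟩),
      fun h => (h hz).2 hzi⟩

theorem exists_openSegment_mem {p q : ℤ × ℤ} {U : Set (ℝ × ℝ)} (hU : IsOpen U) {z : ℝ × ℝ}
    (hz : z ∈ segment ℝ (latticePt p) (latticePt q)) (hzU : z ∈ U) :
    ∃ z ∈ openSegment ℝ (latticePt p) (latticePt q), z ∈ U := by
  obtain ⟨y, hy, hy'⟩ := mem_closure_iff.1 (segment_subset_closure_openSegment hz) U hU hzU
  exact ⟨y, hy', hy⟩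

namespace MaximalTileData

variable {m : ℕ} {φ₀ φ : ℝ → ℝ} {τ : MaximalTileData m φ₀ φ} {F : Finset (Set (ℝ × ℝ))}

theorem hasFullInteriorEdge_of_subshape (hS : IsLatticeStrip m φ₀ φ) (hF : IsRemovable m φ₀ φ F)
    {T T' : Finset (Finset (ℤ × ℤ))} (hT : IsPrimitiveTriangulation (stripRegion m φ₀ φ) T)
    (hT' : IsPrimitiveTriangulation (stripRegion m φ₀ (τ.lowered F)) T') (hsub : T' ⊆ T)
    (h : HasFullInteriorEdge m (stripRegion m φ₀ (τ.lowered F)) T') :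
    HasFullInteriorEdge m (stripRegion m φ₀ φ) T := by
  have hS' := isLatticeStrip_lowered (τ := τ) hS hF
  rw [hasFullInteriorEdge_iff hS.pos fun V hV => hS'.latticeHull_subset hT' hV] at h
  rw [hasFullInteriorEdge_iff hS.pos fun V hV => hS.latticeHull_subset hT hV]
  obtain ⟨V, hV, p, hp, q, hq, e1, e2, z, hz, hzi⟩ := h
  exact ⟨V, hsub hV, p, hp, q, hq, e1, e2, z, hz,
    interior_mono (stripRegion_lowered_subset hF) hzi⟩

/-- A tile lying below an edge which passes through the interior is not maximal. -/
theorem notMem_triangles_of_below {p q d : ℤ × ℤ} (hd : det3 p q d = -1) (hpq : p.1 < q.1)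
    (hp : p.1 = 0) (hq : q.1 = m) {z : ℝ × ℝ}
    (hz : z ∈ openSegment ℝ (latticePt p) (latticePt q))
    (hzi : z ∈ interior (stripRegion m φ₀ φ)) {Q : Set (ℝ × ℝ)}
    (hQ : IsMaximalTile m (stripRegion m φ₀ φ) Q) : {p, q, d} ∉ τ.triangles Q := by
  intro hL
  -- An edge spanning the strip forces the tile to be this one triangle, whose top contains `z`; but
  -- `z` is interior to the shape and has points of it above.
  have hsing := (τ.isTile hQ).eq_singleton (strip_of_maximal hQ) hL (p := p) (q := q) (by simp)
    (by simp) hp hq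
  have hQe : Q = latticeHull {p, q, d} := by
    rw [← τ.union_eq hQ, hsing, unionOfHulls_singleton]
  have hd' : |det3 p q d| = 1 := by rw [hd]; rfl
  have hup : z ∈ upperPart Q := by
    rw [hQe]
    refine ⟨segment_subset_latticeHull (by simp) (by simp) (openSegment_subset_segment ℝ _ _ hz),
      fun y' hy' hmem => ?_⟩
    have h3 := ((mem_latticeHull_iff hd' _).1 hmem).2.2
    have h0 := side_eq_zero_of_mem_openSegment hz
    rw [hd] at h3
    have hpq' : (0 : ℝ) < q.1 - p.1 := by rw [sub_pos]; exact_mod_cast hpq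
    have : side p q (z.1, y') = side p q z + ((q.1 : ℝ) - p.1) * (y' - z.2) := by
      simp only [side]; ring
    rw [this, h0] at h3
    push_cast at h3
    nlinarith
  have hupS := hQ.2.2 hup
  obtain ⟨t, ht, hmem⟩ := exists_pos_add_smul_mem isOpen_interior hzi ((0 : ℝ), (1 : ℝ))
  refine hupS.2 (z.2 + t) (by linarith) ?_
  have e : z + t • ((0 : ℝ), (1 : ℝ)) = (z.1, z.2 + t) := by ext <;> simp
  rw [← e]; exact interior_subset hmem

/-- The edge has a triangle on each side. The lower one is never removed, and removing the upper one
would leave a top without inner lattice points; so both remain and the edge stays interior. -/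
theorem hasFullInteriorEdge_sdiff (hS : IsLatticeStrip m φ₀ φ) (hF : IsRemovable m φ₀ φ F)
    {T : Finset (Finset (ℤ × ℤ))} (hT : IsPrimitiveTriangulation (stripRegion m φ₀ φ) T)
    (hFT : τ.removedTriangles F ⊆ T)
    (hin : HasInnerLatticePoint m (upperPart (stripRegion m φ₀ (τ.lowered F))))
    (h : HasFullInteriorEdge m (stripRegion m φ₀ φ) T) :
    HasFullInteriorEdge m (stripRegion m φ₀ (τ.lowered F)) (T \ τ.removedTriangles F) := by
  have hS' := isLatticeStrip_lowered (τ := τ) hS hF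
  have hT' : IsPrimitiveTriangulation (stripRegion m φ₀ (τ.lowered F))
      (T \ τ.removedTriangles F) :=
    (hS'.triangulation_iff _).2 (isGenericTiling_sdiff hF ((hS.triangulation_iff T).1 hT) hFT)
  have hpos := hS.pos
  rw [hasFullInteriorEdge_iff hS.pos fun V hV => hS.latticeHull_subset hT hV] at h
  rw [hasFullInteriorEdge_iff hS.pos fun V hV => hS'.latticeHull_subset hT' hV]
  obtain ⟨V, hV, p, hp, q, hq, e1, e2, z, hz, hzi⟩ := h
  have hpq : p.1 < q.1 := by omega
  obtain ⟨z, hz, hzi⟩ := exists_openSegment_mem isOpen_interior hz hzi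
  obtain ⟨a, rfl, ha⟩ := (hT.1 V hV).exists_third hp hq (fun h => by rw [h] at hpq; omega)
  obtain ⟨b, hb, hb', hab⟩ := hT.exists_neighbour ha hV hz hzi
  obtain ⟨c, d, hc, hd, hcT, hdT⟩ : ∃ c d, det3 p q c = 1 ∧ det3 p q d = -1 ∧
      {p, q, c} ∈ T ∧ {p, q, d} ∈ T := by
    rcases eq_or_eq_neg_of_abs_eq ha with e | e
    · exact ⟨a, b, e, by omega, hV, hb⟩
    · exact ⟨b, a, by omega, e, hb, hV⟩
  have hdT' : {p, q, d} ∈ T \ τ.removedTriangles F := by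
    refine Finset.mem_sdiff.2 ⟨hdT, fun hmem => ?_⟩
    obtain ⟨Q, hQ, hVQ⟩ := mem_removedTriangles.1 hmem
    exact notMem_triangles_of_below hd hpq e1 e2 hz hzi (hF.maximal Q hQ) hVQ
  -- If the upper triangle is removed, an inner lattice point of the new top is on its lower
  -- boundary and must be the vertex `c`; but `c` lies strictly above the line `p q`.
  by_cases hcF : {p, q, c} ∈ τ.removedTriangles F
  · exfalso
    obtain ⟨Q, hQ, hVQ⟩ := mem_removedTriangles.1 hcF
    have mQ := hF.maximal Q hQ
    have hsing := (τ.isTile mQ).eq_singleton (strip_of_maximal mQ) hVQ (p := p) (q := q) (by simp)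
      (by simp) e1 e2
    have hQe : Q = latticeHull {p, q, c} := by
      rw [← τ.union_eq mQ, hsing, unionOfHulls_singleton]
    have hreg := τ.region mQ
    have hprim : IsPrimitiveTriangle {p, q, c} := .of_det (by rw [hc]; rfl)
    have pQ := (hreg.mem_iff (latticePt p)).1 (hQe ▸ latticePt_mem_latticeHull (by simp))
    have qQ := (hreg.mem_iff (latticePt q)).1 (hQe ▸ latticePt_mem_latticeHull (by simp))
    obtain ⟨i, hi0, him, hiU⟩ := hin
    have hp1 : (p.1 : ℝ) < i.1 := by rw [e1]; exact_mod_cast hi0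
    have hq1 : (i.1 : ℝ) < q.1 := by rw [e2]; exact_mod_cast him
    have hiI : (i.1 : ℝ) ∈ Icc (τ.left Q : ℝ) (τ.right Q) :=
      ⟨pQ.1.trans hp1.le, hq1.le.trans qQ.2.1⟩
    have hilow : (i.2 : ℝ) = τ.lower Q i.1 := by
      rw [← lowered_of_mem hF hQ hiI]
      refine le_antisymm hiU.1.2.2.2 ?_
      by_contra hlt
      refine hiU.2 _ (not_le.1 hlt) ⟨hiU.1.1, hiU.1.2.1, ?_, le_rfl⟩
      exact hS'.le _ ⟨hiU.1.1, hiU.1.2.1⟩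
    have hiQ : latticePt i ∈ Q := (hreg.mem_iff _).2 ⟨hiI.1, hiI.2, hilow.ge, by
      have := hreg.lower_le_upper _ hiI
      rw [← hilow] at this; exact this⟩
    have hi := hprim.mem_of_latticePt_mem (hQe ▸ hiQ)
    have hic : i = c := by
      simp only [Finset.mem_insert, Finset.mem_singleton] at hi
      rcases hi with rfl | rfl | rfl
      · omega
      · omega
      · rfl
    have hline : ((i.1 : ℝ), lineThrough p q i.1) ∈ Q := by
      rw [hQe]
      exact segment_subset_latticeHull (by simp) (by simp)
        ((mem_segment_iff_lineThrough hpq _).2 ⟨hp1.le, hq1.le, rfl⟩)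
    have hle : τ.lower Q i.1 ≤ lineThrough p q i.1 := ((hreg.mem_iff _).1 hline).2.2.1
    have hs : side p q (latticePt c) = 1 := by rw [side_latticePt, hc]; simp
    rw [side_eq_lineThrough hpq, ← hic] at hs
    have hneg : (latticePt i).2 - lineThrough p q (latticePt i).1 ≤ 0 := by
      simp only [latticePt]; rw [hilow]; linarith
    have : (0 : ℝ) < q.1 - p.1 := by linarith
    nlinarith
  · have hcT' : {p, q, c} ∈ T \ τ.removedTriangles F := Finset.mem_sdiff.2 ⟨hcT, hcF⟩
    refine ⟨_, hcT', p, by simp, q, by simp, e1, e2, z, openSegment_subset_segment ℝ _ _ hz, ?_⟩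
    -- Near `z` the two triangles fill the half-planes on both sides of the edge.
    rw [mem_interior_iff_mem_nhds]
    filter_upwards [eventually_mem_latticeHull (by rw [hc]; rfl : |det3 p q c| = 1) hz,
      eventually_mem_latticeHull (by rw [hd]; rfl : |det3 p q d| = 1) hz] with w h1 h2
    rcases le_total 0 (side p q w) with hw | hw
    · exact hS'.latticeHull_subset hT' hcT' (h1 (by rw [hc]; simpa using hw))
    · exact hS'.latticeHull_subset hT' hdT' (h2 (by rw [hd]; simpa using hw))

end MaximalTileData

/-- A lattice function on one side of a line without inner lattice points is off this line in the
interior or runs along it. -/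
theorem IsLatticePL.touch_line {m : ℕ} {p q : ℤ × ℤ} (hp : p.1 = 0) (hq : q.1 = m)
    (hpq : p.1 < q.1) (hno : ∀ k : ℤ, 0 < k → k < m → ¬∃ n : ℤ, lineThrough p q k = n) {l r : ℤ}
    {g : ℝ → ℝ} (hg : IsLatticePL l r g) (hl : 0 ≤ l) (hr : r ≤ m) (hlr : l < r) {s : ℝ}
    (hs : s ≠ 0) (h0 : ∀ x ∈ Icc (l : ℝ) r, 0 ≤ s * (g x - lineThrough p q x)) :
    (∀ x ∈ Ioo (l : ℝ) r, g x ≠ lineThrough p q x) ∨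
      ∀ x ∈ Icc (l : ℝ) r, g x = lineThrough p q x := by
  have hline : IsSlabAffine l r (lineThrough p q) := by
    have := (isLatticePL_lineThrough hpq).isSlabAffine
    rw [hp, hq] at this
    exact this.mono hl hr
  have hh : IsSlabAffine l r (fun x => s * (g x - lineThrough p q x)) := by
    intro k h1 h2
    obtain ⟨α, β, h⟩ := hg.isSlabAffine.sub hline k h1 h2
    exact ⟨s * α, s * β, fun x hx => by simp only at h ⊢; rw [h x hx]; ring⟩
  have hz : ∀ x, s * (g x - lineThrough p q x) = 0 ↔ g x = lineThrough p q x := by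
    intro x; simp [hs, sub_eq_zero]
  have := hh.touch hlr h0 fun k h1 h2 h3 => ?_
  · simpa only [ne_eq, hz] using this
  · have e := (hz k).1 h3
    -- At an inner integer where `g` meets the line its value is not an integer, so `g` has no break
    -- there.
    have hb := (hg.inner k h1 h2).resolve_left (by rw [e]; exact hno k (by omega) (by omega))
    have hl2 : lineThrough p q (k - 1) + lineThrough p q (k + 1) = 2 * lineThrough p q k := by
      simp only [lineThrough]; ring
    linear_combination s * hb - s * hl2 + 2 * s * e

/-- Contact at `1/2`, inside the first slab, spreads over all of `[l, r]`. The value at `r` is then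
an integer height on the line, which for `0 < r` happens only at `r = m`. -/
theorem IsLatticePL.eq_line {m : ℕ} {p q : ℤ × ℤ} (hp : p.1 = 0) (hq : q.1 = m)
    (hpq : p.1 < q.1) (hno : ∀ k : ℤ, 0 < k → k < m → ¬∃ n : ℤ, lineThrough p q k = n) {l r : ℤ}
    {g : ℝ → ℝ} (hg : IsLatticePL l r g) (hl : 0 ≤ l) (hr : r ≤ m) {s : ℝ}
    (hs : s ≠ 0) (h0 : ∀ x ∈ Icc (l : ℝ) r, 0 ≤ s * (g x - lineThrough p q x))
    (hx1 : (l : ℝ) ≤ 1 / 2) (hx2 : 1 / 2 ≤ (r : ℝ)) (hx : g (1 / 2) = lineThrough p q (1 / 2)) :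
    l = 0 ∧ r = m ∧ ∀ x ∈ Icc (l : ℝ) r, g x = lineThrough p q x := by
  have l0 : l < 1 := by
    have : (l : ℝ) < 1 := by linarith
    exact_mod_cast this
  have r0 : 0 < r := by
    have : (0 : ℝ) < r := by linarith
    exact_mod_cast this
  obtain rfl : l = 0 := by omega
  have r1 : (1 : ℝ) ≤ r := by exact_mod_cast r0
  have hall := (hg.touch_line hp hq hpq hno hl hr r0 hs h0).resolve_left
    fun h => h (1 / 2) ⟨by norm_num, by linarith⟩ hx
  refine ⟨rfl, ?_, hall⟩
  by_contra hne
  obtain ⟨n, hn⟩ := hg.right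
  refine hno r r0 (by omega) ⟨n, ?_⟩
  rw [← hn, hall r ⟨by exact_mod_cast r0.le, le_rfl⟩]

theorem mem_of_boundary_eq_line {m : ℕ} {p q : ℤ × ℤ} (hp : p.1 = 0) (hq : q.1 = m)
    (hpq : p.1 < q.1) {V : Finset (ℤ × ℤ)} (hV : IsPrimitiveTriangle V)
    (h : ∀ x ∈ Icc (0 : ℝ) m, (x, lineThrough p q x) ∈ latticeHull V) : p ∈ V ∧ q ∈ V := by
  have hp' : (p.1 : ℝ) = 0 := by rw [hp]; simp
  have hq' : (q.1 : ℝ) = m := by rw [hq]; simp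
  constructor
  · refine hV.mem_of_latticePt_mem ?_
    have := h p.1 (by rw [hp']; exact ⟨le_rfl, by positivity⟩)
    rwa [lineThrough_left] at this
  · refine hV.mem_of_latticePt_mem ?_
    have := h q.1 (by rw [hq']; exact ⟨by positivity, le_rfl⟩)
    rwa [lineThrough_right hpq] at this

namespace MaximalTileData

variable {m : ℕ} {φ₀ φ : ℝ → ℝ} {τ : MaximalTileData m φ₀ φ} {F : Finset (Set (ℝ × ℝ))}

/-- If the top of a subshape has no inner lattice points, it is a full interior edge of the
triangulation, except when the shape is a single triangle. -/
theorem hasFullInteriorEdge_of_no_inner (hS : IsLatticeStrip m φ₀ φ) (hF : IsRemovable m φ₀ φ F)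
    (hne : F.Nonempty) {T : Finset (Finset (ℤ × ℤ))}
    (hT : IsPrimitiveTriangulation (stripRegion m φ₀ φ) T) (hFT : τ.removedTriangles F ⊆ T)
    (hin : ¬HasInnerLatticePoint m (upperPart (stripRegion m φ₀ (τ.lowered F)))) :
    HasFullInteriorEdge m (stripRegion m φ₀ φ) T ∨
      (¬HasInnerLatticePoint m (graphOver m φ₀) ∧
        ∃ V, IsPrimitiveTriangle V ∧ stripRegion m φ₀ φ = latticeHull V) := by
  have hS' := isLatticeStrip_lowered (τ := τ) hS hF
  have hTg := (hS.triangulation_iff T).1 hT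
  have hTg' := isGenericTiling_sdiff hF hTg hFT
  have hT' := (hS'.triangulation_iff _).2 hTg'
  have hpos := hS.pos
  have hm0 : (0 : ℝ) < m := by exact_mod_cast hpos
  have hm1 : (1 : ℝ) ≤ m := by exact_mod_cast hpos
  -- An integer value would be an inner lattice point of the top. Hence the lowered function has no
  -- breaks and its graph is a single segment `p q`.
  have hinner : ∀ k : ℤ, 0 < k → k < m → ¬∃ n : ℤ, τ.lowered F k = n := by
    rintro k h0 hm ⟨n, hn⟩
    have h0' : (0 : ℝ) ≤ k := by exact_mod_cast h0.le
    have hm' : (k : ℝ) ≤ m := by exact_mod_cast hm.le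
    refine hin ⟨(k, n), h0, hm, ⟨h0', hm', ?_, hn.ge⟩, fun y' hy' hmem => ?_⟩
    · have := hS'.le k ⟨h0', hm'⟩
      rw [hn] at this; exact this
    · have h1 : y' ≤ τ.lowered F k := hmem.2.2.2
      have h2 : (n : ℝ) < y' := hy'
      linarith
  obtain ⟨a, ha⟩ := hS'.upper.left
  obtain ⟨b, hb⟩ := hS'.upper.right
  obtain ⟨p, hpdef⟩ : ∃ p : ℤ × ℤ, p = (0, a) := ⟨_, rfl⟩
  obtain ⟨q, hqdef⟩ : ∃ q : ℤ × ℤ, q = ((m : ℤ), b) := ⟨_, rfl⟩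
  have hp : p.1 = 0 := by rw [hpdef]
  have hq : q.1 = m := by rw [hqdef]
  have hpq : p.1 < q.1 := by omega
  have hp' : (p.1 : ℝ) = 0 := by rw [hp]; simp
  have hq' : (q.1 : ℝ) = m := by rw [hq]; simp
  have hline : ∀ x ∈ Icc (0 : ℝ) m, τ.lowered F x = lineThrough p q x := by
    have haff : IsSlabAffine 0 m (lineThrough p q) := by
      have := (isLatticePL_lineThrough hpq).isSlabAffine
      rwa [hp, hq] at this
    have := (hS'.upper.isSlabAffine.sub haff).eq_zero_of_no_break hpos ?_ ?_ ?_
    · exact fun x hx => sub_eq_zero.1 (this x hx)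
    · intro k h0 hm
      have e := (hS'.upper.inner k h0 hm).resolve_left (hinner k h0 hm)
      have : lineThrough p q (k - 1) + lineThrough p q (k + 1) = 2 * lineThrough p q k := by
        simp only [lineThrough]; ring
      linear_combination e - this
    · have := lineThrough_left p q
      rw [hp'] at this
      rw [this, hpdef]
      simpa [sub_eq_zero] using ha
    · have := lineThrough_right hpq
      rw [hq'] at this
      rw [this, hqdef]
      simpa [sub_eq_zero] using hb
  have hno : ∀ k : ℤ, 0 < k → k < m → ¬∃ n : ℤ, lineThrough p q k = n := by
    intro k h0 hm
    rw [← hline k ⟨by exact_mod_cast h0.le, by exact_mod_cast hm.le⟩]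
    exact hinner k h0 hm
  have hZ : ∀ {x : ℝ}, x ∈ Icc ((0 : ℤ) : ℝ) ((m : ℤ) : ℝ) ↔ x ∈ Icc (0 : ℝ) m := by
    intro x; simp
  have hZo : ∀ {x : ℝ}, x ∈ Ioo ((0 : ℤ) : ℝ) ((m : ℤ) : ℝ) ↔ x ∈ Ioo (0 : ℝ) m := by
    intro x; simp
  -- If `φ` touched the line inside, it would coincide with it, and then no tile could have lowered
  -- it, although `F` is nonempty.
  have hupper : ∀ x ∈ Ioo (0 : ℝ) m, lineThrough p q x < φ x := by
    have htouch := hS.upper.touch_line hp hq hpq hno le_rfl le_rfl (by omega) (s := 1) one_ne_zero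
      fun x hx => by
        rw [← hline x (hZ.1 hx), one_mul]; exact sub_nonneg.2 (lowered_le hF x)
    rcases htouch with h | h
    · intro x hx
      refine lt_of_le_of_ne ?_ (h x (hZo.2 hx)).symm
      rw [← hline x (Ioo_subset_Icc_self hx)]
      exact lowered_le hF x
    · exfalso
      obtain ⟨Q, hQ⟩ := hne
      have mQ := hF.maximal Q hQ
      have hreg := τ.region mQ
      have g1 : (τ.left Q : ℝ) < τ.right Q := by exact_mod_cast hreg.lt
      have g2 : (0 : ℝ) ≤ τ.left Q := by exact_mod_cast hreg.zero_le
      have g3 : (τ.right Q : ℝ) ≤ m := by exact_mod_cast hreg.le_width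
      obtain ⟨x, hx1, hx2⟩ := exists_between g1
      have hx : x ∈ Icc (0 : ℝ) m := ⟨by linarith, by linarith⟩
      have e := h x (hZ.2 hx)
      rw [← hline x hx, lowered_of_mem hF hQ ⟨hx1.le, hx2.le⟩] at e
      exact (lower_lt mQ ⟨hx1, hx2⟩).ne' e
  have hhalf : (1 / 2 : ℝ) ∈ Ioo (0 : ℝ) m := ⟨by norm_num, by linarith⟩
  have hhalf' := Ioo_subset_Icc_self hhalf
  have hlower := hS.lower.touch_line hp hq hpq hno le_rfl le_rfl (by omega) (s := -1)
    (by norm_num) fun x hx => by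
      have := hS'.le x (hZ.1 hx)
      rw [hline x (hZ.1 hx)] at this
      linarith
  -- Either `φ₀` stays strictly below the segment, and the triangle under its point over `1/2` has
  -- the whole segment as an edge; or `φ₀` runs along the segment and the subshape is just its
  -- graph.
  rcases hlower with h | h
  · left
    have hlt : φ₀ (1 / 2) < lineThrough p q (1 / 2) := by
      refine lt_of_le_of_ne ?_ (h _ (hZo.2 hhalf))
      rw [← hline _ hhalf']; exact hS'.le _ hhalf'
    have hlt' : φ₀ (1 / 2) < τ.lowered F (1 / 2) := by rwa [hline _ hhalf']
    obtain ⟨V, hV, hzV⟩ := hS'.exists_mem_of_mem_Icc hT' hhalf hlt' ⟨hlt'.le, le_rfl⟩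
    have hVS := hS'.latticeHull_subset hT' hV
    have hprim := hTg'.primitive V hV
    obtain ⟨l, r, lo, up, hreg, -, -⟩ := hprim.exists_region
    have l0 : 0 ≤ l := by exact_mod_cast show (0 : ℝ) ≤ l from (hVS hreg.left_mem).1
    have rm : r ≤ m := by exact_mod_cast show (r : ℝ) ≤ m from (hVS hreg.right_mem).2.1
    have hzV' := (hreg.mem_iff _).1 hzV
    have hup : ∀ x ∈ Icc (l : ℝ) r, up x ≤ lineThrough p q x := by
      intro x hx
      have := hVS ((hreg.mem_iff (x, up x)).2 ⟨hx.1, hx.2, hreg.lower_le_upper x hx, le_rfl⟩)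
      rw [← hline x ⟨this.1, this.2.1⟩]
      exact this.2.2.2
    obtain ⟨rfl, rfl, heq⟩ := hreg.upper.eq_line hp hq hpq hno l0 rm (s := -1) (by norm_num)
      (fun x hx => by linarith [hup x hx]) hzV'.1 hzV'.2.1
      (le_antisymm (hup _ ⟨hzV'.1, hzV'.2.1⟩) (by rw [← hline _ hhalf']; exact hzV'.2.2.2))
    obtain ⟨hpV, hqV⟩ := mem_of_boundary_eq_line hp hq hpq hprim fun x hx => by
      refine (hreg.mem_iff _).2 ⟨(hZ.2 hx).1, (hZ.2 hx).2, ?_, ?_⟩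
      · rw [← heq x (hZ.2 hx)]; exact hreg.lower_le_upper x (hZ.2 hx)
      · exact (heq x (hZ.2 hx)).ge
    rw [hasFullInteriorEdge_iff hS.pos fun V hV => hS.latticeHull_subset hT hV]
    refine ⟨V, (Finset.mem_sdiff.1 hV).1, p, hpV, q, hqV, hp, hq, (1 / 2, lineThrough p q (1 / 2)),
      (mem_segment_iff_lineThrough hpq _).2 ⟨by rw [hp']; exact hhalf.1.le,
        by rw [hq']; exact hhalf.2.le, rfl⟩, hS.mem_interior hhalf hlt (hupper _ hhalf)⟩
  · right
    have heq0 : ∀ x ∈ Icc (0 : ℝ) m, φ₀ x = lineThrough p q x := fun x hx => h x (hZ.2 hx)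
    refine ⟨?_, ?_⟩
    · rintro ⟨i, h0, hm, hi⟩
      refine hno i.1 h0 hm ⟨i.2, ?_⟩
      have := heq0 (i.1 : ℝ) ⟨hi.1, hi.2.1⟩
      rw [← this]
      exact hi.2.2.symm
    have hlt : φ₀ (1 / 2) < φ (1 / 2) := by rw [heq0 _ hhalf']; exact hupper _ hhalf
    obtain ⟨V, hV, hzV⟩ := hS.exists_mem_of_mem_Icc hT hhalf hlt ⟨le_rfl, hlt.le⟩
    have hVS := hS.latticeHull_subset hT hV
    have hprim := hTg.primitive V hV
    obtain ⟨l, r, lo, up, hreg, -, -⟩ := hprim.exists_region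
    have l0 : 0 ≤ l := by exact_mod_cast show (0 : ℝ) ≤ l from (hVS hreg.left_mem).1
    have rm : r ≤ m := by exact_mod_cast show (r : ℝ) ≤ m from (hVS hreg.right_mem).2.1
    have hzV' := (hreg.mem_iff _).1 hzV
    have hlo : ∀ x ∈ Icc (l : ℝ) r, lineThrough p q x ≤ lo x := by
      intro x hx
      have := hVS ((hreg.mem_iff (x, lo x)).2 ⟨hx.1, hx.2, le_rfl, hreg.lower_le_upper x hx⟩)
      rw [← heq0 x ⟨this.1, this.2.1⟩]
      exact this.2.2.1
    obtain ⟨rfl, rfl, heq⟩ := hreg.lower.eq_line hp hq hpq hno l0 rm (s := 1) one_ne_zero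
      (fun x hx => by linarith [hlo x hx]) hzV'.1 hzV'.2.1
      (le_antisymm (by rw [← heq0 _ hhalf']; exact hzV'.2.2.1) (hlo _ ⟨hzV'.1, hzV'.2.1⟩))
    obtain ⟨hpV, hqV⟩ := mem_of_boundary_eq_line hp hq hpq hprim fun x hx => by
      refine (hreg.mem_iff _).2 ⟨(hZ.2 hx).1, (hZ.2 hx).2, (heq x (hZ.2 hx)).le, ?_⟩
      rw [← heq x (hZ.2 hx)]; exact hreg.lower_le_upper x (hZ.2 hx)
    -- The triangle standing on the segment must be removed, because the subshape is one-dimensional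
    -- and has no generic points. Its tile then fills the whole shape.
    have hVF : V ∈ τ.removedTriangles F := by
      by_contra hVF
      obtain ⟨g, hg, hgV⟩ := exists_generic_mem_latticeHull hprim
      have hgS := hTg'.subset V (Finset.mem_sdiff.2 ⟨hV, hVF⟩) g hg hgV
      have hx : g.1 ∈ Icc (0 : ℝ) m := ⟨hgS.1, hgS.2.1⟩
      refine hS.lower.generic_ne (by omega) hg (hZ.2 hx).1 (hZ.2 hx).2 (le_antisymm ?_ hgS.2.2.1)
      rw [heq0 _ hx, ← hline _ hx]; exact hgS.2.2.2
    obtain ⟨Q, hQ, hVQ⟩ := mem_removedTriangles.1 hVF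
    have mQ := hF.maximal Q hQ
    have hsing := (τ.isTile mQ).eq_singleton (strip_of_maximal mQ) hVQ hpV hqV hp hq
    have hQe : Q = latticeHull V := by
      rw [← τ.union_eq mQ, hsing, unionOfHulls_singleton]
    refine ⟨V, hprim, ?_⟩
    rw [← hQe]
    refine Subset.antisymm ?_ mQ.2.1
    have hregQ := τ.region mQ
    have pQ := (hregQ.mem_iff (latticePt p)).1 (hQe ▸ latticePt_mem_latticeHull hpV)
    have qQ := (hregQ.mem_iff (latticePt q)).1 (hQe ▸ latticePt_mem_latticeHull hqV)
    have pQ1 : (τ.left Q : ℝ) ≤ 0 := by rw [← hp']; exact pQ.1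
    have qQ1 : (m : ℝ) ≤ τ.right Q := by rw [← hq']; exact qQ.2.1
    rintro w ⟨h1, h2, h3, h4⟩
    have hw : w.1 ∈ Icc (τ.left Q : ℝ) (τ.right Q) := ⟨pQ1.trans h1, h2.trans qQ1⟩
    refine (hregQ.mem_iff w).2 ⟨hw.1, hw.2, ?_, ?_⟩
    · rw [← lowered_of_mem hF hQ hw, hline _ ⟨h1, h2⟩, ← heq0 _ ⟨h1, h2⟩]; exact h3
    · rw [τ.upper_eq mQ _ hw]; exact h4

end MaximalTileData

/-! ### Inclusion-exclusion and counting -/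

/-- For each `a`, the alternating sum over all subsets of the nonempty set of related `b` vanishes,
so its nonempty subsets contribute exactly `1` with the shifted sign. Summing over `a` and
exchanging the sums gives the formula. -/
theorem card_eq_sum_of_exists_rel {α β : Type*} (A : Finset α) (M : Finset β) (rel : α → β → Prop)
    [∀ a, DecidablePred (rel a)] [DecidableEq β] (h : ∀ a ∈ A, ∃ b ∈ M, rel a b) :
    (A.card : ℤ) = ∑ F ∈ M.powerset with F.Nonempty,
      (-1 : ℤ) ^ (F.card - 1) * ((A.filter fun a => ∀ b ∈ F, rel a b).card : ℤ) := by
  have hsum : ∀ a ∈ A, ∑ F ∈ M.powerset with F.Nonempty,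
      (-1 : ℤ) ^ (F.card - 1) * (if ∀ b ∈ F, rel a b then 1 else 0) = 1 := by
    intro a ha
    obtain ⟨b, hb, hab⟩ := h a ha
    have hne : (M.filter (rel a)).Nonempty := ⟨b, Finset.mem_filter.2 ⟨hb, hab⟩⟩
    have h0 := Finset.sum_powerset_neg_one_pow_card_of_nonempty hne
    have hset : ((M.powerset.filter Finset.Nonempty).filter fun F => ∀ b ∈ F, rel a b) =
        (M.filter (rel a)).powerset.erase ∅ := by
      ext F
      simp only [Finset.mem_filter, Finset.mem_powerset, Finset.mem_erase, Finset.subset_iff,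
        Finset.nonempty_iff_ne_empty]
      constructor
      · rintro ⟨⟨h1, h2⟩, h3⟩
        exact ⟨h2, fun x hx => ⟨h1 hx, h3 x hx⟩⟩
      · rintro ⟨h1, h2⟩
        exact ⟨⟨fun x hx => (h2 hx).1, h1⟩, fun x hx => (h2 hx).2⟩
    simp only [mul_ite, mul_one, mul_zero]
    rw [← Finset.sum_filter, hset]
    rw [← Finset.add_sum_erase _ _ (Finset.empty_mem_powerset _)] at h0
    have hneg : ∑ F ∈ (M.filter (rel a)).powerset.erase ∅, (-1 : ℤ) ^ (F.card - 1) =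
        -∑ F ∈ (M.filter (rel a)).powerset.erase ∅, (-1 : ℤ) ^ F.card := by
      rw [← Finset.sum_neg_distrib]
      refine Finset.sum_congr rfl fun F hF => ?_
      obtain ⟨n, hn⟩ := Nat.exists_eq_add_of_le' (Finset.card_pos.2
        (Finset.nonempty_iff_ne_empty.2 (Finset.mem_erase.1 hF).1))
      rw [hn, Nat.add_sub_cancel, pow_succ]; ring
    rw [hneg]
    simp only [Finset.card_empty, pow_zero] at h0
    linarith
  rw [Finset.card_eq_sum_ones, Nat.cast_sum, Nat.cast_one, ← Finset.sum_congr rfl hsum,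
    Finset.sum_comm]
  refine Finset.sum_congr rfl fun F _ => ?_
  rw [← Finset.mul_sum, Finset.sum_boole]

theorem finite_latticePts (m : ℕ) (φ₀ φ : ℝ → ℝ) :
    {p : ℤ × ℤ | latticePt p ∈ stripRegion m φ₀ φ}.Finite := by
  refine (((Finset.Icc (0 : ℤ) m).biUnion fun k =>
    (Finset.Icc ⌈φ₀ k⌉ ⌊φ k⌋).image fun j => (k, j)).finite_toSet).subset ?_
  rintro ⟨k, j⟩ ⟨h1, h2, h3, h4⟩
  simp only [latticePt] at h1 h2 h3 h4
  simp only [Finset.coe_biUnion, Finset.coe_image, mem_iUnion, Finset.mem_coe, Finset.mem_Icc,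
    mem_image, Prod.mk.injEq, exists_prop]
  exact ⟨k, ⟨by exact_mod_cast h1, by exact_mod_cast h2⟩, j,
    ⟨Int.ceil_le.2 h3, Int.le_floor.2 h4⟩, rfl, rfl⟩

/-- All vertices are among the finitely many lattice points of the shape. This bounds both the
triangulations and the maximal tiles. -/
theorem finite_triangleSets (m : ℕ) (φ₀ φ : ℝ → ℝ) :
    {D : Finset (Finset (ℤ × ℤ)) | unionOfHulls D ⊆ stripRegion m φ₀ φ}.Finite := by
  refine ((finite_latticePts m φ₀ φ).toFinset.powerset.powerset.finite_toSet).subset ?_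
  intro D hD
  simp only [Finset.mem_coe, Finset.mem_powerset]
  intro V hV
  rw [Finset.mem_powerset]
  intro p hp
  rw [Finite.mem_toFinset]
  exact hD (mem_unionOfHulls.2 ⟨V, hV, latticePt_mem_latticeHull hp⟩)

theorem IsLatticeStrip.finite_triangulations {m : ℕ} {φ₀ φ : ℝ → ℝ} (hS : IsLatticeStrip m φ₀ φ) :
    {T | IsPrimitiveTriangulation (stripRegion m φ₀ φ) T}.Finite :=
  (finite_triangleSets m φ₀ φ).subset fun _ hT => hS.unionOfHulls_subset hT Finset.Subset.rfl

namespace MaximalTileData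

variable {m : ℕ} {φ₀ φ : ℝ → ℝ} {τ : MaximalTileData m φ₀ φ} {F : Finset (Set (ℝ × ℝ))}

theorem finite_maximalTiles (τ : MaximalTileData m φ₀ φ) :
    {Q | IsMaximalTile m (stripRegion m φ₀ φ) Q}.Finite := by
  refine ((finite_triangleSets m φ₀ φ).image unionOfHulls).subset fun Q hQ => ?_
  refine ⟨τ.triangles Q, ?_, τ.union_eq hQ⟩
  simp only [mem_ofPred_eq]
  rw [τ.union_eq hQ]
  exact hQ.2.1

theorem lowered_empty (τ : MaximalTileData m φ₀ φ) : τ.lowered ∅ = φ := by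
  funext x; exact lowered_of_notMem (by simp)

theorem isRemovable_empty (m : ℕ) (φ₀ φ : ℝ → ℝ) : IsRemovable m φ₀ φ ∅ := ⟨by simp, by simp⟩

theorem isSubshapeWith_iff (hS : IsLatticeStrip m φ₀ φ) {S' : Set (ℝ × ℝ)} {n : ℕ} :
    IsSubshapeWith m φ₀ (stripRegion m φ₀ φ) S' n ↔ ∃ F, F.card = n ∧ IsRemovable m φ₀ φ F ∧
      S' = stripRegion m φ₀ (τ.lowered F) := by
  constructor
  · rintro ⟨F, hn, h1, h2, rfl⟩
    have hF : IsRemovable m φ₀ φ F := ⟨h1, h2⟩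
    exact ⟨F, hn, hF, subshape_eq hF hS.lower hS.upper hS.pos hS.le⟩
  · rintro ⟨F, hn, hF, rfl⟩
    exact ⟨F, hn, hF.maximal, hF.disjoint,
      (subshape_eq hF hS.lower hS.upper hS.pos hS.le).symm⟩

theorem isSubshapeWith_lowered_iff (hS : IsLatticeStrip m φ₀ φ) (hF : IsRemovable m φ₀ φ F)
    {n : ℕ} : IsSubshapeWith m φ₀ (stripRegion m φ₀ φ) (stripRegion m φ₀ (τ.lowered F)) n ↔
      F.card = n := by
  rw [isSubshapeWith_iff (τ := τ) hS]
  constructor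
  · rintro ⟨F', hn, hF', h⟩
    rw [eq_of_subshape_eq hF hF' hS.le h, hn]
  · exact fun h => ⟨F, h, hF, rfl⟩

theorem removedCount_lowered (hS : IsLatticeStrip m φ₀ φ) (hF : IsRemovable m φ₀ φ F) :
    removedCount m φ₀ (stripRegion m φ₀ φ) (stripRegion m φ₀ (τ.lowered F)) = F.card := by
  simp only [removedCount, isSubshapeWith_lowered_iff hS hF]
  rw [show {n | F.card = n} = {F.card} by ext n; simp [eq_comm]]
  exact csInf_singleton F.card

theorem mem_properSubshapes_iff (hS : IsLatticeStrip m φ₀ φ) {S' : Set (ℝ × ℝ)} :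
    S' ∈ properSubshapes m φ₀ (stripRegion m φ₀ φ) ↔ ∃ F : Finset (Set (ℝ × ℝ)), F.Nonempty ∧
      IsRemovable m φ₀ φ F ∧ stripRegion m φ₀ (τ.lowered F) = S' := by
  constructor
  · rintro ⟨⟨n, hn⟩, hne⟩
    obtain ⟨F, -, hF, rfl⟩ := (isSubshapeWith_iff (τ := τ) hS).1 hn
    refine ⟨F, ?_, hF, rfl⟩
    rw [Finset.nonempty_iff_ne_empty]
    rintro rfl
    exact hne (by rw [τ.lowered_empty])
  · rintro ⟨F, hne, hF, rfl⟩
    refine ⟨⟨F.card, (isSubshapeWith_lowered_iff hS hF).2 rfl⟩, fun h => hne.ne_empty ?_⟩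
    refine eq_of_subshape_eq (τ := τ) hF (isRemovable_empty m φ₀ φ) hS.le ?_
    rw [h, lowered_empty]

/-- Adding the removed tiles is a bijection from the triangulations of the subshape to those
triangulations of the shape which contain these tiles. -/
theorem ncard_triangulations (hS : IsLatticeStrip m φ₀ φ) (hF : IsRemovable m φ₀ φ F)
    {p p' : Finset (Finset (ℤ × ℤ)) → Prop}
    (hp : ∀ T, IsPrimitiveTriangulation (stripRegion m φ₀ φ) T → τ.removedTriangles F ⊆ T →
      (p T ↔ p' (T \ τ.removedTriangles F))) :
    {T | IsPrimitiveTriangulation (stripRegion m φ₀ (τ.lowered F)) T ∧ p' T}.ncard =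
      {T | (IsPrimitiveTriangulation (stripRegion m φ₀ φ) T ∧ p T) ∧
        τ.removedTriangles F ⊆ T}.ncard := by
  have hS' := isLatticeStrip_lowered (τ := τ) hS hF
  have hsdiff : ∀ T, IsPrimitiveTriangulation (stripRegion m φ₀ (τ.lowered F)) T →
      (T ∪ τ.removedTriangles F) \ τ.removedTriangles F = T := fun T hT =>
    Finset.union_sdiff_cancel_right (disjoint_removedTriangles hF ((hS'.triangulation_iff T).1 hT))
  refine Set.ncard_congr (fun T _ => T ∪ τ.removedTriangles F) ?_ ?_ ?_
  · rintro T ⟨hT, hpT⟩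
    have hTu := (hS.triangulation_iff _).2
      (isGenericTiling_union hF ((hS'.triangulation_iff T).1 hT))
    refine ⟨⟨hTu, ?_⟩, Finset.subset_union_right⟩
    rw [hp _ hTu Finset.subset_union_right, hsdiff T hT]
    exact hpT
  · intro T T' hT hT' h
    rw [← hsdiff T hT.1, h, hsdiff T' hT'.1]
  · rintro T ⟨⟨hT, hpT⟩, hFT⟩
    exact ⟨T \ τ.removedTriangles F, ⟨(hS'.triangulation_iff _).2
      (isGenericTiling_sdiff hF ((hS.triangulation_iff T).1 hT) hFT), (hp T hT hFT).1 hpT⟩,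
      Finset.sdiff_union_of_subset hFT⟩

open Classical in
/-- The nonempty sets of maximal tiles with pairwise disjoint interiors. -/
noncomputable def removableSets (τ : MaximalTileData m φ₀ φ) : Finset (Finset (Set (ℝ × ℝ))) :=
  τ.finite_maximalTiles.toFinset.powerset.filter fun F => F.Nonempty ∧ IsRemovable m φ₀ φ F

theorem mem_removableSets :
    F ∈ τ.removableSets ↔ F.Nonempty ∧ IsRemovable m φ₀ φ F := by
  simp only [removableSets, Finset.mem_filter, Finset.mem_powerset, and_iff_right_iff_imp]
  intro h Q hQ
  exact (Finite.mem_toFinset _).2 (h.2.maximal Q hQ)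

open Classical in
-- The removed tiles are recovered from the subshape, so the sum can be reindexed injectively by
-- removable sets.
theorem finsum_properSubshapes (hS : IsLatticeStrip m φ₀ φ) (c : Set (ℝ × ℝ) → Prop)
    (f : Set (ℝ × ℝ) → ℤ) :
    ∑ᶠ S' ∈ {S' ∈ properSubshapes m φ₀ (stripRegion m φ₀ φ) | c S'}, f S' =
      ∑ F ∈ τ.removableSets with c (stripRegion m φ₀ (τ.lowered F)),
        f (stripRegion m φ₀ (τ.lowered F)) := by
  have hset : {S' ∈ properSubshapes m φ₀ (stripRegion m φ₀ φ) | c S'} =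
      (((τ.removableSets.filter fun F => c (stripRegion m φ₀ (τ.lowered F))).image
        fun F => stripRegion m φ₀ (τ.lowered F) : Finset (Set (ℝ × ℝ))) : Set (Set (ℝ × ℝ))) := by
    ext S'
    simp only [mem_ofPred_eq, mem_properSubshapes_iff (τ := τ) hS, Finset.coe_image, mem_image,
      Finset.mem_coe, Finset.mem_filter, mem_removableSets]
    constructor
    · rintro ⟨⟨F, h1, h2, rfl⟩, h3⟩
      exact ⟨F, ⟨⟨h1, h2⟩, h3⟩, rfl⟩
    · rintro ⟨F, ⟨⟨h1, h2⟩, h3⟩, rfl⟩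
      exact ⟨⟨F, h1, h2, rfl⟩, h3⟩
  rw [hset, finsum_mem_coe_finset, Finset.sum_image]
  intro F hF F' hF' h
  exact eq_of_subshape_eq (mem_removableSets.1 (Finset.mem_filter.1 hF).1).2
    (mem_removableSets.1 (Finset.mem_filter.1 hF').1).2 hS.le h

/-- Inclusion-exclusion over the maximal tiles contained in a triangulation. -/
theorem ncard_eq_sum (hS : IsLatticeStrip m φ₀ φ) (hne : stripRegion m φ₀ φ ≠ graphOver m φ₀)
    (p : Finset (Finset (ℤ × ℤ)) → Prop) :
    ({T | IsPrimitiveTriangulation (stripRegion m φ₀ φ) T ∧ p T}.ncard : ℤ) =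
      ∑ F ∈ τ.removableSets, (-1 : ℤ) ^ (F.card - 1) *
        ({T | (IsPrimitiveTriangulation (stripRegion m φ₀ φ) T ∧ p T) ∧
          τ.removedTriangles F ⊆ T}.ncard : ℤ) := by
  classical
  have hfin : {T | IsPrimitiveTriangulation (stripRegion m φ₀ φ) T ∧ p T}.Finite :=
    hS.finite_triangulations.subset fun T hT => hT.1
  have hcount : ∀ F, {T | (IsPrimitiveTriangulation (stripRegion m φ₀ φ) T ∧ p T) ∧
      τ.removedTriangles F ⊆ T}.ncard =
      (hfin.toFinset.filter fun T => ∀ Q ∈ F, τ.triangles Q ⊆ T).card := by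
    intro F
    rw [← Set.ncard_coe_finset]
    congr 1
    ext T
    simp [removedTriangles]
  have key := card_eq_sum_of_exists_rel hfin.toFinset τ.finite_maximalTiles.toFinset
    (fun T Q => τ.triangles Q ⊆ T) ?_
  · rw [← Set.ncard_eq_toFinset_card _ hfin] at key
    rw [key]
    simp only [hcount]
    symm
    -- Sets of maximal tiles that are not removable contribute zero: tiles contained in one
    -- triangulation never overlap.
    refine Finset.sum_subset ?_ ?_
    · intro F hF
      simp only [removableSets, Finset.mem_filter] at hF ⊢
      exact ⟨hF.1, hF.2.1⟩
    · intro F hF hF'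
      rw [Finset.filter_eq_empty_iff.2, Finset.card_empty, Nat.cast_zero, mul_zero]
      intro T hT hFT
      rw [Finite.mem_toFinset] at hT
      rw [Finset.mem_filter, Finset.mem_powerset] at hF
      refine hF' (mem_removableSets.2 ⟨hF.2, isRemovable_of_subset
        ((hS.triangulation_iff T).1 hT.1) (fun Q hQ => ?_) hFT⟩)
      exact τ.finite_maximalTiles.mem_toFinset.1 (hF.1 hQ)
  · intro T hT
    rw [Finite.mem_toFinset] at hT
    obtain ⟨D, hD, hDT, hmax⟩ := hS.exists_maximalTile hT.1 hne
    refine ⟨unionOfHulls D, (Finite.mem_toFinset _).2 hmax, ?_⟩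
    -- The chosen triangles of the tile are those found in `T`, since a tile determines its
    -- triangles.
    rwa [(τ.isTile hmax).injective hD (τ.union_eq hmax)]

end MaximalTileData

open MaximalTileData in
theorem lemma2p2 (m : ℕ) (hm : 0 < m) (φ₀ : ℝ → ℝ) (hφ₀ : IsAdmissibleFun m φ₀)
    (S : Set (ℝ × ℝ)) (hS : IsAdmissibleShape m φ₀ S) (hne : S ≠ graphOver m φ₀) :
    -- the numbers `#(S', S)`, `f*(S')` and the sums are well defined
    (∀ S' n n', IsSubshapeWith m φ₀ S S' n → IsSubshapeWith m φ₀ S S' n' → n = n') ∧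
    (∀ S' n, IsSubshapeWith m φ₀ S S' n → {T | IsPrimitiveTriangulation S' T}.Finite) ∧
    {T | IsPrimitiveTriangulation S T}.Finite ∧
    (properSubshapes m φ₀ S).Finite ∧
    -- the formula for `f*`
    (fStar S : ℤ) = ∑ᶠ S' ∈ properSubshapes m φ₀ S,
      (-1 : ℤ) ^ (removedCount m φ₀ S S' - 1) * (fStar S' : ℤ) ∧
    -- the formula for `f`
    ((HasInnerLatticePoint m (graphOver m φ₀) ∨
        ¬ ∃ V, IsPrimitiveTriangle V ∧ S = latticeHull V) →
      (fRestricted m S : ℤ) =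
        ∑ᶠ S' ∈ {S' ∈ properSubshapes m φ₀ S | HasInnerLatticePoint m (upperPart S')},
          (-1 : ℤ) ^ (removedCount m φ₀ S S' - 1) * (fRestricted m S' : ℤ)) := by
  classical
  obtain ⟨φ, hφ, hle, rfl⟩ := hS
  have hS : IsLatticeStrip m φ₀ φ := ⟨hm, hφ₀.isLatticePL, hφ.isLatticePL, hle⟩
  obtain ⟨τ⟩ := exists_maximalTileData hle
  refine ⟨fun S' n n' h h' => ?_, fun S' n h => ?_, hS.finite_triangulations, ?_, ?_,
    fun hcase => ?_⟩
  · obtain ⟨F, hn, hF, rfl⟩ := (isSubshapeWith_iff (τ := τ) hS).1 h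
    rw [← hn, (isSubshapeWith_lowered_iff hS hF).1 h']
  · obtain ⟨F, -, hF, rfl⟩ := (isSubshapeWith_iff (τ := τ) hS).1 h
    exact (isLatticeStrip_lowered hS hF).finite_triangulations
  · refine ((τ.removableSets.finite_toSet).image
      fun F => stripRegion m φ₀ (τ.lowered F)).subset fun S' hS' => ?_
    obtain ⟨F, h1, h2, rfl⟩ := (mem_properSubshapes_iff (τ := τ) hS).1 hS'
    exact ⟨F, mem_removableSets.2 ⟨h1, h2⟩, rfl⟩
  · have h1 := ncard_eq_sum (τ := τ) hS hne fun _ => True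
    have h2 := finsum_properSubshapes (τ := τ) hS (fun _ => True) fun S' =>
      (-1 : ℤ) ^ (removedCount m φ₀ (stripRegion m φ₀ φ) S' - 1) * (fStar S' : ℤ)
    simp only [and_true, Finset.filter_true, ofPred_mem_eq] at h1 h2
    rw [fStar, h1, h2]
    refine Finset.sum_congr rfl fun F hF => ?_
    have hF := (mem_removableSets.1 hF).2
    have := ncard_triangulations (τ := τ) hS hF (p := fun _ => True) (p' := fun _ => True)
      fun _ _ _ => Iff.rfl
    simp only [and_true] at this
    rw [removedCount_lowered hS hF, fStar, this]
  · have h1 := ncard_eq_sum (τ := τ) hS hne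
      fun T => ¬HasFullInteriorEdge m (stripRegion m φ₀ φ) T
    rw [fRestricted, h1, finsum_properSubshapes (τ := τ) hS
      (fun S' => HasInnerLatticePoint m (upperPart S')), Finset.sum_filter]
    refine Finset.sum_congr rfl fun F hF => ?_
    obtain ⟨hFne, hF⟩ := mem_removableSets.1 hF
    split_ifs with hin
    · rw [removedCount_lowered hS hF, fRestricted, ncard_triangulations (τ := τ) hS hF
        (p := fun T => ¬HasFullInteriorEdge m (stripRegion m φ₀ φ) T)]
      intro T hT hFT
      refine not_congr ⟨hasFullInteriorEdge_sdiff hS hF hT hFT hin,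
        hasFullInteriorEdge_of_subshape hS hF hT ?_ Finset.sdiff_subset⟩
      exact ((isLatticeStrip_lowered hS hF).triangulation_iff _).2
        (isGenericTiling_sdiff hF ((hS.triangulation_iff T).1 hT) hFT)
    -- When the top of the subshape has no inner lattice point, every triangulation containing `F`
    -- has a full interior edge, apart from the case excluded by `hcase`; so the term is zero.
    · have hempty : {T | (IsPrimitiveTriangulation (stripRegion m φ₀ φ) T ∧
          ¬HasFullInteriorEdge m (stripRegion m φ₀ φ) T) ∧ τ.removedTriangles F ⊆ T} = ∅ := by
        rw [Set.eq_empty_iff_forall_notMem]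
        rintro T ⟨⟨hT, hfull⟩, hFT⟩
        rcases hasFullInteriorEdge_of_no_inner hS hF hFne hT hFT hin with h | ⟨h, h'⟩
        · exact hfull h
        · exact hcase.elim h fun hc => hc h'
      rw [hempty, Set.ncard_empty, Nat.cast_zero, mul_zero]
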